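/- **Definitions.** An *edge weighted graph* is a finite simple graph $G=(V,E)$ with a weight $w_G(e)\in[0,1]$ on each edge; put $w_G(u,v)=0$ if $uv\notin E$ (in particular if $u=v$). A *drawing* of $G$ represents the vertices by distinct points of the plane and every edge by a simple (injective) continuous curve joining the points of its two endpoints, such that no edge passes through a vertex other than its endpoints, no two edges are tangent at a common interior point, no three edges have a common interior point, and there are only finitely many crossings (common interior points of two edges). It is *straight-line* if every edge is a segment. For a drawing $\mathcal D$ let $\mathrm{cr}(G,\mathcal D)=\sum w_G(e)w_G(f)$, where the sum is over all crossings and $e,f$ are the two edges that cross there. Let $\mathrm{cr}(G)$ and $\overline{\mathrm{cr}}(G)$ be the least value of $\mathrm{cr}(G,\mathcal D)$ over all drawings, respectively all straight-line drawings, of $G$. If $G$ has $n$ vertices, put $\mathrm{cd}(G)=\mathrm{cr}(G)/n^4$ and $\overline{\mathrm{cd}}(G)=\overline{\mathrm{cr}}(G)/n^4$. A *graphon* is a symmetric Lebesgue measurable function $W:[0,1]^2\to[0,1]$. For a bounded Lebesgue measurable $f:[0,1]\to\mathbb R^2$ let $I_f(x_1,x_2,x_3,x_4)=1$ if the (possibly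 degenerate) segments $\mathrm{conv}\{f(x_1),f(x_2)\}$ and $\mathrm{conv}\{f(x_3),f(x_4)\}$ intersect, and $0$ otherwise, and put $$\overline{\mathrm{cd}}(W)=\inf_f\ \frac18\int_{[0,1]^4}W(x_1,x_2)W(x_3,x_4)I_f(x_1,x_2,x_3,x_4)\,dx_1dx_2dx_3dx_4 .$$ A *simple graphon drawing* $\mathcal D$ assigns to each $(x,y)\in[0,1]^2$ a continuous curve $\mathcal D(x,y):[0,1]\to\mathbb R^2$ that is simple (injective) or constant, such that $\mathcal D(x,y)(t)=\mathcal D(y,x)(1-t)$ for all $t$, $\mathcal D(x,x)$ is constant with value denoted $\mathcal D(x)$, $\mathcal D(x,y)(0)=\mathcal D(x)$, and any two of these curves whose images are different have at most one point in common. Let $I_{\mathcal D}(x_1,x_2,x_3,x_4)=1$ if the curves $\mathcal D(x_1,x_2)$ and $\mathcal D(x_3,x_4)$ have a common point, and $0$ otherwise, and put $$\mathrm{cd}(W)=\inf_{\mathcal D}\ \frac18\int_{[0,1]^4}W(x_1,x_2)W(x_3,x_4)I_{\mathcal D}(x_1,x_2,x_3,x_4)\,dx_1dx_2dx_3dx_4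 ,$$ where $\mathcal D$ ranges over the simple graphon drawings for which $I_{\mathcal D}$ is Lebesgue measurable. For an edge weighted graph $G$ with vertices $v_1,\dots,v_n$ ($n\ge1$, in any order), the step graphon $W_G$ is obtained by splitting $[0,1]$ into consecutive intervals $I_1,\dots,I_n$ of length $1/n$ and setting $W_G(x,y)=w_G(v_i,v_j)$ for $x\in I_i$, $y\in I_j$. **Theorem.** For every edge weighted graph $G$ on $n\geq 1$ vertices and every ordering of its vertices, $$0\le\overline{\mathrm{cd}}(W_G)-\overline{\mathrm{cd}}(G)\le\frac1n\qquad\text{and}\qquad 0\le\mathrm{cd}(W_G)-\mathrm{cd}(G)\le\frac1n .$$ -/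

import Mathlib

open Set MeasureTheory
open scoped unitInterval

/-- The Euclidean plane. -/
abbrev Plane : Type := EuclideanSpace ℝ (Fin 2)

/-! ### Edge weighted graphs and their drawings -/

/-- A simple graph on `V` whose edges carry weights in `[0,1]`; pairs that are not edges (in
particular the diagonal pairs) get weight `0`. -/
structure EdgeWeightedGraph (V : Type*) extends SimpleGraph V where
  weight : Sym2 V → ℝ
  weight_mem : ∀ e, weight e ∈ Icc (0 : ℝ) 1
  weight_eq_zero : ∀ e, e ∉ toSimpleGraph.edgeSet → weight e = 0

/-- Two subsets of the plane cross transversally (in the topological sense) at `p`: some local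
homeomorphism around `p` straightens `A` and `B` into the two coordinate axes. For two curves with
the common interior point `p`, this says that they are not tangent at `p`. -/
def CrossAt (A B : Set Plane) (p : Plane) : Prop :=
  ∃ φ : OpenPartialHomeomorph Plane (ℝ × ℝ), p ∈ φ.source ∧ φ p = (0, 0) ∧
    ∀ q ∈ φ.source, (q ∈ A ↔ (φ q).2 = 0) ∧ (q ∈ B ↔ (φ q).1 = 0)

/-- The interior points of a curve: all its points but the endpoints (for a simple curve). -/
def curveInterior (c : C(I, Plane)) : Set Plane := c '' Ioo 0 1

/-- A drawing of a graph in the plane. -/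
structure GraphDrawing {V : Type*} (G : SimpleGraph V) where
  /-- The point that represents a vertex. -/
  pos : V → Plane
  pos_injective : Function.Injective pos
  /-- The curve that represents an edge, in one of its two parametrizations. -/
  arc : G.edgeSet → C(I, Plane)
  arc_simple : ∀ e, Function.Injective (arc e)
  arc_endpoints : ∀ e, s(arc e 0, arc e 1) = Sym2.map pos e.1
  /-- No edge goes through a vertex other than its endpoints. -/
  avoids_vertices : ∀ e v, pos v ∈ range (arc e) → v ∈ e.1
  /-- No two edges are tangent. -/
  not_tangent : ∀ e f, e ≠ f → ∀ p ∈ curveInterior (arc e) ∩ curveInterior (arc f),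
    CrossAt (range (arc e)) (range (arc f)) p
  /-- No three edges have a common interior point. -/
  no_triple : ∀ e f g, e ≠ f → e ≠ g → f ≠ g →
    curveInterior (arc e) ∩ curveInterior (arc f) ∩ curveInterior (arc g) = ∅
  /-- There are only finitely many crossing points. -/
  finite_crossings : ∀ e f, e ≠ f → (curveInterior (arc e) ∩ curveInterior (arc f)).Finite

/-- Every edge is represented by the segment between its endpoints. -/
def GraphDrawing.IsStraightLine {V : Type*} {G : SimpleGraph V} (D : GraphDrawing G) : Prop :=
  ∀ e, range (D.arc e) = segment ℝ (D.arc e 0) (D.arc e 1)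

namespace EdgeWeightedGraph

variable {V : Type*} [Fintype V] (G : EdgeWeightedGraph V)

open Classical in
/-- The weighted number of crossings of a drawing: the sum of `w(e) w(f)` over all crossings, that
is, over all unordered pairs of distinct edges `e`, `f` and all common interior points of `e` and
`f`. The sum below runs over ordered pairs, hence the factor `1 / 2`. -/
noncomputable def crDrawing (D : GraphDrawing G.toSimpleGraph) : ℝ :=
  (1 / 2) * ∑ e : G.edgeSet, ∑ f : G.edgeSet,
    if e = f then 0
    else G.weight e * G.weight f * ((curveInterior (D.arc e) ∩ curveInterior (D.arc f)).ncard : ℝ)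

/-- The crossing number. -/
noncomputable def cr : ℝ := ⨅ D : GraphDrawing G.toSimpleGraph, G.crDrawing D

/-- The rectilinear crossing number. -/
noncomputable def rectCr : ℝ :=
  ⨅ D : {D : GraphDrawing G.toSimpleGraph // D.IsStraightLine}, G.crDrawing D.1

/-- The crossing density of an edge weighted graph. -/
noncomputable def cd : ℝ := G.cr / (Fintype.card V : ℝ) ^ 4

/-- The rectilinear crossing density of an edge weighted graph. -/
noncomputable def rectCd : ℝ := G.rectCr / (Fintype.card V : ℝ) ^ 4

end EdgeWeightedGraph

/-! ### Graphons

A function on a power of `[0,1]` with values in a Euclidean space is Lebesgue measurable if and only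
if it is `AEMeasurable` for `volume`, and a set is Lebesgue measurable if and only if it is a
`NullMeasurableSet` for `volume`. -/

/-- A graphon: a symmetric Lebesgue measurable function `[0,1]² → [0,1]`. -/
structure Graphon where
  toFun : I → I → ℝ
  symm : ∀ x y, toFun x y = toFun y x
  mem_Icc : ∀ x y, toFun x y ∈ Icc (0 : ℝ) 1
  aemeasurable : AEMeasurable (fun p : I × I => toFun p.1 p.2) volume

/-- The index of the part that contains `x` when `[0,1]` is split into the `n` intervals
`[0,1/n), [1/n,2/n), …, [(n-1)/n,1]`. -/
noncomputable def intervalIndex {n : ℕ} (hn : 0 < n) (x : I) : Fin n :=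
  ⟨min ⌊(n : ℝ) * (x : ℝ)⌋₊ (n - 1), by omega⟩

theorem measurable_intervalIndex {n : ℕ} (hn : 0 < n) : Measurable (intervalIndex hn) := by
  have h : Measurable fun x : I => min ⌊(n : ℝ) * (x : ℝ)⌋₊ (n - 1) :=
    (Nat.measurable_floor.comp (measurable_const.mul measurable_subtype_coe)).min measurable_const
  refine measurable_to_countable' fun i => ?_
  have h2 := h (measurableSet_singleton (i : ℕ))
  convert h2 using 1
  ext x
  simp [intervalIndex, Fin.ext_iff]

/-- The step graphon `W_G` of an edge weighted graph whose vertices are ordered by `ord`. -/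
noncomputable def EdgeWeightedGraph.stepGraphon {V : Type*} (G : EdgeWeightedGraph V) {n : ℕ}
    (hn : 0 < n) (ord : Fin n ≃ V) : Graphon where
  toFun x y := G.weight s(ord (intervalIndex hn x), ord (intervalIndex hn y))
  symm x y := by rw [Sym2.eq_swap]
  mem_Icc x y := G.weight_mem _
  aemeasurable := by
    have h : Measurable fun p : Fin n × Fin n => G.weight s(ord p.1, ord p.2) := measurable_of_finite _
    exact (h.comp (((measurable_intervalIndex hn).comp measurable_fst).prodMk
      ((measurable_intervalIndex hn).comp measurable_snd))).aemeasurable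

/-- A simple graphon drawing `D` whose indicator `I_D` is Lebesgue measurable. -/
structure GraphonDrawing where
  curve : I → I → C(I, Plane)
  /-- Every curve is simple or constant. -/
  simple_or_const : ∀ x y, Function.Injective (curve x y) ∨ ∃ p, ∀ t, curve x y t = p
  curve_symm : ∀ x y t, curve x y t = curve y x (unitInterval.symm t)
  /-- The point that represents `x`. -/
  pos : I → Plane
  curve_self : ∀ x t, curve x x t = pos x
  curve_zero : ∀ x y, curve x y 0 = pos x
  inter_subsingleton : ∀ x₁ y₁ x₂ y₂, range (curve x₁ y₁) ≠ range (curve x₂ y₂) →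
    (range (curve x₁ y₁) ∩ range (curve x₂ y₂)).Subsingleton
  measurable_meet : NullMeasurableSet
    {x : Fin 4 → I | (range (curve (x 0) (x 1)) ∩ range (curve (x 2) (x 3))).Nonempty} volume

namespace Graphon

variable (W : Graphon)

open Classical in
/-- `cd(W, D)` for a simple graphon drawing `D`. -/
noncomputable def cdDrawing (D : GraphonDrawing) : ℝ :=
  (1 / 8) * ∫ x : Fin 4 → I, W.toFun (x 0) (x 1) * W.toFun (x 2) (x 3) *
    (if (range (D.curve (x 0) (x 1)) ∩ range (D.curve (x 2) (x 3))).Nonempty then (1 : ℝ) else 0)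

/-- The crossing density of a graphon. -/
noncomputable def cd : ℝ := ⨅ D : GraphonDrawing, W.cdDrawing D

open Classical in
/-- The rectilinear crossing density of `W` with respect to a map `f : [0,1] → ℝ²`. -/
noncomputable def rectCdMap (f : I → Plane) : ℝ :=
  (1 / 8) * ∫ x : Fin 4 → I, W.toFun (x 0) (x 1) * W.toFun (x 2) (x 3) *
    (if (convexHull ℝ {f (x 0), f (x 1)} ∩ convexHull ℝ {f (x 2), f (x 3)}).Nonempty
      then (1 : ℝ) else 0)

/-- The rectilinear crossing density of a graphon: the infimum over all bounded Lebesgue measurable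
maps `f : [0,1] → ℝ²`. -/
noncomputable def rectCd : ℝ :=
  ⨅ f : {f : I → Plane // AEMeasurable f volume ∧ Bornology.IsBounded (range f)}, W.rectCdMap f.1

end Graphon

/-! Upper bounds. Placing all points of the i-th interval at the i-th vertex turns a drawing of `G`
into a drawing of the step graphon. An unordered pair of disjoint edges corresponds to eight of the
`n ^ 4` quadruples of parts, which the factor 1/8 undoes. At most `4 n ^ 3` quadruples have a vertex
in common between the two pairs, and they contribute at most `1 / (2 n)`. For segments nothing else
is needed (`exists_rectCdMap_le`). A simple graphon drawing, however, has to draw all pairs of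
vertices, with any two curves meeting at most once, whereas a drawing of `G` contains only the
edges, which may cross repeatedly. The drawing is therefore made polygonal (`exists_polygonal`), the
missing pairs are added with a tiny weight, and repeated meetings are removed by rerouting one edge
along the other between two common points. Of the two possible detours at least one does not raise
the weighted crossings with third edges, and each lowers the mutual crossings
(`Config.Generic.exists_detours`, `Config.Generic.exists_uncrossed`).

Lower bounds. From a drawing of the step graphon one point is chosen at random in each interval,
independently. Quadruples of different vertices then meet, on average, as often as the integral says
(`exists_sample`). It remains to turn the sampled curves into a legal drawing of `G` in which a pair
of edges crosses at most once, and only if the sampled curves met. Edges with a common vertex do not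
cross at all, since that vertex is already their only common point. The curves are replaced with
polygonal lines, which are moved into general position and freed of loops. None of this creates
crossings, because the number of meeting pairs of segments is upper semicontinuous
(`eventually_cross_le`). Sampled points may coincide; then only one representative of each point is
kept, and the other vertices are restored as nearby clones whose edges run parallel to those of the
representative (`Config.Generic.exists_clone`, `Config.Generic.exists_crossesWithin_univ`).

Throughout, `cross` counts meeting pairs of segments. A common endpoint of two edges counts as a
meeting as well, and this is accounted for separately. -/

open Filter Topology

/-! ### Polygonal lines -/

/-- The consecutive pairs of a list. -/
def segs {α : Type*} : List α → List (α × α)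
  | [] => []
  | [_] => []
  | a :: b :: l => (a, b) :: segs (b :: l)

section Segs
variable {α β : Type*}

@[simp] theorem segs_nil : segs ([] : List α) = [] := rfl

@[simp] theorem segs_singleton (a : α) : segs [a] = [] := rfl
@[simp] theorem segs_cons_cons (a b : α) (l : List α) :
    segs (a :: b :: l) = (a, b) :: segs (b :: l) := rfl

theorem segs_append_cons (l : List α) (a : α) (m : List α) :
    segs (l ++ a :: m) = segs (l ++ [a]) ++ segs (a :: m) := by
  induction l with
  | nil => simp
  | cons x l ih => cases l with
    | nil => simp
    | cons y l => simpa using ih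

theorem segs_append_cons_cons (l : List α) (a b : α) (m : List α) :
    segs (l ++ a :: b :: m) = segs (l ++ [a]) ++ (a, b) :: segs (b :: m) := by
  rw [segs_append_cons, segs_cons_cons]

theorem segs_concat_concat (l : List α) (a b : α) :
    segs (l ++ [a, b]) = segs (l ++ [a]) ++ [(a, b)] := by
  rw [segs_append_cons_cons, segs_singleton]

theorem segs_map (f : α → β) (l : List α) : segs (l.map f) = (segs l).map (Prod.map f f) := by
  induction l with
  | nil => simp
  | cons x l ih => cases l with
    | nil => simp
    | cons y l => simpa using ih

theorem segs_reverse (l : List α) : segs l.reverse = ((segs l).map Prod.swap).reverse := by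
  induction l with
  | nil => simp
  | cons x l ih => cases l with
    | nil => simp
    | cons y l =>
      simp only [List.reverse_cons, List.append_assoc, List.cons_append, List.nil_append,
        segs_cons_cons, List.map_cons, Prod.swap_prod_mk] at ih ⊢
      rw [segs_concat_concat, ih]

theorem mem_segs_iff {l : List α} {s : α × α} :
    s ∈ segs l ↔ ∃ l₁ l₂, l = l₁ ++ s.1 :: s.2 :: l₂ := by
  constructor
  · induction l with
    | nil => simp
    | cons x l ih => cases l with
      | nil => simp
      | cons y l =>
        intro h
        rcases List.mem_cons.1 h with rfl | h
        · exact ⟨[], l, rfl⟩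
        · obtain ⟨l₁, l₂, h⟩ := ih h
          exact ⟨x :: l₁, l₂, by rw [h]; rfl⟩
  · rintro ⟨l₁, l₂, rfl⟩
    rw [segs_append_cons_cons]
    simp

theorem left_mem_of_mem_segs {l : List α} {s : α × α} (h : s ∈ segs l) : s.1 ∈ l := by
  obtain ⟨l₁, l₂, rfl⟩ := mem_segs_iff.1 h
  simp

theorem right_mem_of_mem_segs {l : List α} {s : α × α} (h : s ∈ segs l) : s.2 ∈ l := by
  obtain ⟨l₁, l₂, rfl⟩ := mem_segs_iff.1 h
  simp

theorem swap_mem_segs_reverse {l : List α} {s : α × α} :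
    s.swap ∈ segs l.reverse ↔ s ∈ segs l := by
  rw [segs_reverse]
  simp

theorem ne_of_mem_segs {l : List α} (hl : l.Nodup) {s : α × α} (h : s ∈ segs l) : s.1 ≠ s.2 := by
  obtain ⟨l₁, l₂, rfl⟩ := mem_segs_iff.1 h
  simp [List.nodup_append] at hl
  tauto

theorem segs_nodup {l : List α} (hl : l.Nodup) : (segs l).Nodup := by
  induction l with
  | nil => simp
  | cons x l ih => cases l with
    | nil => simp
    | cons y l =>
      rw [segs_cons_cons, List.nodup_cons]
      refine ⟨fun h => ?_, ih hl.of_cons⟩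
      exact (List.nodup_cons.1 hl).1 (left_mem_of_mem_segs h)

/-- In a list without repetitions the successor of an element is unique. -/
theorem segs_right_unique {l : List α} (hl : l.Nodup) {s t : α × α} (hs : s ∈ segs l)
    (ht : t ∈ segs l) (h : s.1 = t.1) : s = t := by
  induction l with
  | nil => simp at hs
  | cons x l ih => cases l with
    | nil => simp at hs
    | cons y l =>
      rw [segs_cons_cons, List.mem_cons] at hs ht
      have hx := (List.nodup_cons.1 hl).1
      rcases hs with rfl | hs <;> rcases ht with rfl | ht
      · rfl
      · exact absurd (left_mem_of_mem_segs ht) (h ▸ hx)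
      · exact absurd (left_mem_of_mem_segs hs) (h ▸ hx)
      · exact ih hl.of_cons hs ht

theorem segs_left_unique {l : List α} (hl : l.Nodup) {s t : α × α} (hs : s ∈ segs l)
    (ht : t ∈ segs l) (h : s.2 = t.2) : s = t := by
  have := segs_right_unique (List.nodup_reverse.2 hl) (swap_mem_segs_reverse.2 hs)
    (swap_mem_segs_reverse.2 ht) (by simpa using h)
  exact Prod.swap_injective this

theorem exists_eq_cons_concat {l : List α} {a b : α} (ha : l.head? = some a)
    (hb : l.getLast? = some b) (hab : a ≠ b) : ∃ m, l = a :: m ++ [b] := by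
  obtain ⟨m, rfl⟩ : ∃ m, l = a :: m := by
    cases l <;> simp_all
  rcases List.eq_nil_or_concat m with rfl | ⟨m, c, rfl⟩
  · simp_all
  · refine ⟨m, ?_⟩
    simp [List.getLast?_cons] at hb
    simp [hb]

theorem exists_mem_segs_left {l : List α} {a : α} (h : a ∈ l) (hl : l.getLast? ≠ some a) :
    ∃ b, (a, b) ∈ segs l := by
  obtain ⟨l₁, l₂, rfl⟩ := List.append_of_mem h
  cases l₂ with
  | nil => simp at hl
  | cons b l₂ => exact ⟨b, mem_segs_iff.2 ⟨l₁, l₂, rfl⟩⟩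

theorem exists_mem_segs_right {l : List α} {a : α} (h : a ∈ l) (hl : l.head? ≠ some a) :
    ∃ b, (b, a) ∈ segs l := by
  obtain ⟨b, hb⟩ := exists_mem_segs_left (l := l.reverse) (a := a) (by simpa) (by simpa)
  exact ⟨b, by rw [← swap_mem_segs_reverse]; exact hb⟩

end Segs

/-- The segment joining the two points of a pair. -/
def seg (s : Plane × Plane) : Set Plane := segment ℝ s.1 s.2

theorem seg_swap (s : Plane × Plane) : seg s.swap = seg s := segment_symm ..

/-- Two segments have a common point. -/
def Meet (s t : Plane × Plane) : Prop := (seg s ∩ seg t).Nonempty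

theorem Meet.symm {s t : Plane × Plane} (h : Meet s t) : Meet t s := by
  rwa [Meet, inter_comm]

theorem isClosed_seg (s : Plane × Plane) : IsClosed (seg s) := by
  rw [seg, segment_eq_image_lineMap]
  exact (isCompact_Icc.image (by fun_prop)).isClosed

/-- The set is the projection, along the compact square of parameters, of a closed set. This is the
source of all semicontinuity below: disjoint segments stay disjoint under small perturbations. -/
theorem isClosed_meet : IsClosed {p : (Plane × Plane) × (Plane × Plane) | Meet p.1 p.2} := by
  have h := (isClosedMap_fst_of_compactSpace (X := (Plane × Plane) × (Plane × Plane)) (Y := I × I))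
    {q | AffineMap.lineMap q.1.1.1 q.1.1.2 (q.2.1 : ℝ) =
      AffineMap.lineMap q.1.2.1 q.1.2.2 (q.2.2 : ℝ)} (by
        apply isClosed_eq
        · simp only [AffineMap.lineMap_apply_module]; fun_prop
        · simp only [AffineMap.lineMap_apply_module]; fun_prop)
  convert h using 1
  ext ⟨⟨a, b⟩, ⟨c, d⟩⟩
  simp only [Meet, seg, segment_eq_image_lineMap]
  constructor
  · rintro ⟨_, ⟨s, hs, rfl⟩, ⟨t, ht, h⟩⟩
    exact ⟨(((a, b), (c, d)), (⟨s, hs⟩, ⟨t, ht⟩)), h.symm, rfl⟩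
  · rintro ⟨⟨_, s, t⟩, h, rfl⟩
    exact ⟨_, ⟨s, s.2, rfl⟩, ⟨t, t.2, Eq.symm h⟩⟩

/-- The set of points on a polygonal line. -/
def img (l : List Plane) : Set Plane := {x | ∃ s ∈ segs l, x ∈ seg s}

theorem mem_img {l : List Plane} {x : Plane} : x ∈ img l ↔ ∃ s ∈ segs l, x ∈ seg s := Iff.rfl

theorem img_cons_cons (a b : Plane) (l : List Plane) :
    img (a :: b :: l) = segment ℝ a b ∪ img (b :: l) := by
  ext x
  simp [mem_img, seg]

theorem img_append_cons (l : List Plane) (a : Plane) (m : List Plane) :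
    img (l ++ a :: m) = img (l ++ [a]) ∪ img (a :: m) := by
  ext x
  simp only [mem_img, segs_append_cons l a m, List.mem_append, mem_union]
  grind

theorem img_reverse (l : List Plane) : img l.reverse = img l := by
  ext x
  constructor
  · rintro ⟨s, hs, hx⟩
    exact ⟨s.swap, swap_mem_segs_reverse.1 (by simpa using hs), by rwa [seg_swap]⟩
  · rintro ⟨s, hs, hx⟩
    exact ⟨s.swap, swap_mem_segs_reverse.2 hs, by rwa [seg_swap]⟩

/-- The bound on the length matters: a list with a single point has no segments, so its image is
empty. -/
theorem mem_img_of_mem {l : List Plane} {x : Plane} (hx : x ∈ l) (hl : 2 ≤ l.length) :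
    x ∈ img l := by
  obtain ⟨l₁, l₂, rfl⟩ := List.append_of_mem hx
  cases l₂ with
  | cons b l₂ => exact ⟨(x, b), mem_segs_iff.2 ⟨l₁, l₂, rfl⟩, left_mem_segment ..⟩
  | nil =>
    rcases List.eq_nil_or_concat l₁ with rfl | ⟨m, c, rfl⟩
    · simp at hl
    · exact ⟨(c, x), mem_segs_iff.2 ⟨m, [], by simp⟩, right_mem_segment ..⟩

/-! ### Counting crossings -/

open Classical in
/-- `1` if the segments meet and `0` otherwise. -/
noncomputable def meets (s t : Plane × Plane) : ℕ := if Meet s t then 1 else 0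

theorem meets_comm (s t : Plane × Plane) : meets s t = meets t s := by
  simp only [meets]
  congr 1
  exact propext ⟨Meet.symm, Meet.symm⟩

theorem meets_le_one (s t : Plane × Plane) : meets s t ≤ 1 := by
  unfold meets; split_ifs <;> simp

theorem meets_eq_one {s t : Plane × Plane} (h : Meet s t) : meets s t = 1 := if_pos h

theorem meets_eq_zero {s t : Plane × Plane} (h : ¬ Meet s t) : meets s t = 0 := if_neg h

theorem meets_swap_left (s t : Plane × Plane) : meets s.swap t = meets s t := by
  simp only [meets]
  congr 1
  rw [Meet, seg_swap, Meet]

theorem meets_mono {s s' t t' : Plane × Plane} (h : Meet s t → Meet s' t') :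
    meets s t ≤ meets s' t' := by
  unfold meets; split_ifs <;> simp_all

/-- The number of pairs of a segment of the first list and one of the second that meet. -/
noncomputable def crossS (S T : List (Plane × Plane)) : ℕ :=
  (S.map fun s => (T.map (meets s)).sum).sum

/-- The number of pairs of segments of two polygonal lines that meet. -/
noncomputable def cross (l m : List Plane) : ℕ := crossS (segs l) (segs m)

@[simp] theorem crossS_nil (T : List (Plane × Plane)) : crossS [] T = 0 := rfl

theorem crossS_cons (s : Plane × Plane) (S T : List (Plane × Plane)) :
    crossS (s :: S) T = crossS [s] T + crossS S T := by simp [crossS]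

theorem crossS_append (S S' T : List (Plane × Plane)) :
    crossS (S ++ S') T = crossS S T + crossS S' T := by simp [crossS]

theorem crossS_comm (S T : List (Plane × Plane)) : crossS S T = crossS T S := by
  induction S with
  | nil => simp [crossS]
  | cons s S ih =>
    rw [crossS_cons, ih]
    simp only [crossS, List.map_cons, List.sum_cons, List.map_nil, List.sum_nil, add_zero]
    rw [← List.sum_map_add]
    simp_rw [meets_comm s]

theorem crossS_mono_left {S S' : List (Plane × Plane)} (T : List (Plane × Plane))
    (h : List.Forall₂ (fun s s' => seg s ⊆ seg s') S S') : crossS S T ≤ crossS S' T := by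
  induction h with
  | nil => simp
  | cons h _ ih =>
    rw [crossS_cons, crossS_cons _ (_ : List (Plane × Plane))]
    refine add_le_add ?_ ih
    simp only [crossS, List.map_cons, List.sum_cons, List.map_nil, List.sum_nil, add_zero]
    exact List.sum_le_sum fun t _ => meets_mono fun ⟨x, hx⟩ => ⟨x, h hx.1, hx.2⟩

theorem crossS_single_mono {s s' : Plane × Plane} (T : List (Plane × Plane))
    (h : ∀ t ∈ T, Meet s t → Meet s' t) : crossS [s] T ≤ crossS [s'] T := by
  simp only [crossS, List.map_cons, List.sum_cons, List.map_nil, List.sum_nil, add_zero]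
  exact List.sum_le_sum fun t ht => meets_mono (h t ht)

theorem crossS_eq_zero {S T : List (Plane × Plane)} :
    crossS S T = 0 ↔ ∀ s ∈ S, ∀ t ∈ T, ¬ Meet s t := by
  have h1 : ∀ s t, meets s t = 0 ↔ ¬ Meet s t := by simp [meets]
  induction S with
  | nil => simp
  | cons s S ih =>
    rw [crossS_cons, Nat.add_eq_zero_iff, List.forall_mem_cons]
    refine and_congr ?_ ih
    simp only [crossS, List.map_cons, List.sum_cons, List.map_nil, List.sum_nil, add_zero]
    clear ih
    induction T with
    | nil => simp
    | cons t T ih =>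
      rw [List.map_cons, List.sum_cons, Nat.add_eq_zero_iff, ih, List.forall_mem_cons, h1]

theorem one_le_crossS {S T : List (Plane × Plane)} {s t : Plane × Plane} (hs : s ∈ S) (ht : t ∈ T)
    (h : Meet s t) : 1 ≤ crossS S T := by
  rw [Nat.one_le_iff_ne_zero]
  exact fun h' => crossS_eq_zero.1 h' s hs t ht h

theorem cross_comm (l m : List Plane) : cross l m = cross m l := crossS_comm _ _

theorem cross_reverse_left (l m : List Plane) : cross l.reverse m = cross l m := by
  simp only [cross, crossS, segs_reverse, List.map_reverse, List.sum_reverse, List.map_map]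
  congr 2
  ext s
  simp only [Function.comp_apply]
  congr 2
  ext t
  exact meets_swap_left s t

theorem cross_reverse_right (l m : List Plane) : cross l m.reverse = cross l m := by
  rw [cross_comm, cross_reverse_left, cross_comm]

theorem cross_append_cons (l : List Plane) (a : Plane) (m r : List Plane) :
    cross (l ++ a :: m) r = cross (l ++ [a]) r + cross (a :: m) r := by
  simp only [cross, segs_append_cons l a m, crossS_append]

theorem cross_eq_zero {l m : List Plane} : cross l m = 0 ↔ Disjoint (img l) (img m) := by
  rw [cross, crossS_eq_zero, Set.disjoint_left]
  constructor
  · rintro h x ⟨s, hs, hxs⟩ ⟨t, ht, hxt⟩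
    exact h s hs t ht ⟨x, hxs, hxt⟩
  · rintro h s hs t ht ⟨x, hxs, hxt⟩
    exact h ⟨s, hs, hxs⟩ ⟨t, ht, hxt⟩

/-- The number of crossings of moving polygonal lines is upper semicontinuous. -/
theorem eventually_cross_le {A : Type*} [TopologicalSpace A] {a₀ : A} {F : Filter A}
    (hF : F ≤ 𝓝 a₀) {L M : List (A → Plane)}
    (hL : ∀ φ ∈ L, ContinuousAt φ a₀) (hM : ∀ φ ∈ M, ContinuousAt φ a₀) :
    ∀ᶠ a in F, cross (L.map (· a)) (M.map (· a)) ≤ cross (L.map (· a₀)) (M.map (· a₀)) := by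
  -- Only pairs that begin to meet could raise the count, and being disjoint is an open condition on
  -- the endpoints.
  have key : ∀ᶠ a in F, ∀ s ∈ {s | s ∈ segs L}, ∀ t ∈ {t | t ∈ segs M},
      Meet (s.1 a, s.2 a) (t.1 a, t.2 a) → Meet (s.1 a₀, s.2 a₀) (t.1 a₀, t.2 a₀) := by
    refine hF ?_
    refine (Filter.eventually_all_finite (List.finite_toSet _)).2 fun s hs => ?_
    refine (Filter.eventually_all_finite (List.finite_toSet _)).2 fun t ht => ?_
    by_cases h : Meet (s.1 a₀, s.2 a₀) (t.1 a₀, t.2 a₀)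
    · simp [h]
    · have hc : ContinuousAt (fun a => ((s.1 a, s.2 a), (t.1 a, t.2 a))) a₀ :=
        ((hL _ (left_mem_of_mem_segs hs)).prodMk (hL _ (right_mem_of_mem_segs hs))).prodMk
          ((hM _ (left_mem_of_mem_segs ht)).prodMk (hM _ (right_mem_of_mem_segs ht)))
      filter_upwards [hc.eventually (isClosed_meet.isOpen_compl.eventually_mem h)] with a ha h'
      exact absurd h' ha
  filter_upwards [key] with a ha
  simp only [cross, crossS, segs_map, List.map_map]
  exact List.sum_le_sum fun s hs => List.sum_le_sum fun t ht => meets_mono (ha s hs t ht)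

/-! ### Orientation -/

/-- The determinant of two vectors of the plane. -/
def wedge (u v : Plane) : ℝ := u 0 * v 1 - u 1 * v 0

theorem wedge_swap (u v : Plane) : wedge u v = - wedge v u := by simp [wedge]; ring
@[simp] theorem wedge_self (u : Plane) : wedge u u = 0 := by simp [wedge]; ring
@[simp] theorem wedge_zero_right (u : Plane) : wedge u 0 = 0 := by simp [wedge]
@[simp] theorem wedge_zero_left (u : Plane) : wedge 0 u = 0 := by simp [wedge]
theorem wedge_add_right (u v w : Plane) : wedge u (v + w) = wedge u v + wedge u w := by
  simp [wedge]; ring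
theorem wedge_sub_right (u v w : Plane) : wedge u (v - w) = wedge u v - wedge u w := by
  simp [wedge]; ring
theorem wedge_sub_left (u v w : Plane) : wedge (u - v) w = wedge u w - wedge v w := by
  simp [wedge]; ring
theorem wedge_add_left (u v w : Plane) : wedge (u + v) w = wedge u w + wedge v w := by
  simp [wedge]; ring
theorem wedge_smul_right (c : ℝ) (u v : Plane) : wedge u (c • v) = c * wedge u v := by
  simp [wedge]; ring
theorem wedge_smul_left (c : ℝ) (u v : Plane) : wedge (c • u) v = c * wedge u v := by
  simp [wedge]; ring
theorem wedge_neg_right (u v : Plane) : wedge u (-v) = - wedge u v := by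
  simp [wedge]; ring

theorem continuous_wedge : Continuous fun p : Plane × Plane => wedge p.1 p.2 := by
  unfold wedge; fun_prop

theorem Plane.ext' {u v : Plane} (h₀ : u 0 = v 0) (h₁ : u 1 = v 1) : u = v := by
  ext i
  fin_cases i
  exacts [h₀, h₁]

/-- Vectors with vanishing determinant are proportional. -/
theorem exists_smul_of_wedge_eq_zero {u v : Plane} (hu : u ≠ 0) (h : wedge u v = 0) :
    ∃ c : ℝ, v = c • u := by
  have h' : u 0 * v 1 = u 1 * v 0 := by unfold wedge at h; linarith
  by_cases h0 : u 0 = 0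
  · have h1 : u 1 ≠ 0 := fun h1 => hu (Plane.ext' (by simpa using h0) (by simpa using h1))
    refine ⟨v 1 / u 1, Plane.ext' ?_ ?_⟩
    · have : v 0 = 0 := by
        have := h'; rw [h0, zero_mul, eq_comm, mul_eq_zero] at this; tauto
      simp [this, h0]
    · simp; field_simp
  · refine ⟨v 0 / u 0, Plane.ext' ?_ ?_⟩
    · simp; field_simp
    · simp; field_simp; linarith

/-- Two lines with independent directions meet in at most one point. -/
theorem eq_of_wedge_ne_zero {u v x : Plane} (h : wedge u v ≠ 0) (hu : wedge u x = 0)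
    (hv : wedge v x = 0) : x = 0 := by
  unfold wedge at *
  refine Plane.ext' ?_ ?_
  · have : (u 0 * v 1 - u 1 * v 0) * x 0 = 0 := by linear_combination v 0 * hu - u 0 * hv
    simpa [h] using this
  · have : (u 0 * v 1 - u 1 * v 0) * x 1 = 0 := by linear_combination v 1 * hu - u 1 * hv
    simpa [h] using this

theorem mem_seg_iff {s : Plane × Plane} {x : Plane} :
    x ∈ seg s ↔ ∃ t ∈ Icc (0 : ℝ) 1, x = s.1 + t • (s.2 - s.1) := by
  rw [seg, segment_eq_image']
  simp [eq_comm]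

theorem wedge_of_mem_seg {s : Plane × Plane} {x : Plane} (h : x ∈ seg s) :
    wedge (s.2 - s.1) (x - s.1) = 0 := by
  obtain ⟨t, -, rfl⟩ := mem_seg_iff.1 h
  simp [wedge_smul_right]

/-! ### General position -/

/-- No three points are collinear, and no three segments with six different endpoints have a
common point. -/
structure GenPos (S : Set Plane) : Prop where
  wedge_ne : ∀ a ∈ S, ∀ b ∈ S, ∀ c ∈ S, a ≠ b → a ≠ c → b ≠ c → wedge (b - a) (c - a) ≠ 0
  no_triple : ∀ a ∈ S, ∀ b ∈ S, ∀ c ∈ S, ∀ d ∈ S, ∀ e ∈ S, ∀ f ∈ S, [a, b, c, d, e, f].Nodup →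
    ∀ y, y ∈ seg (a, b) → y ∈ seg (c, d) → y ∉ seg (e, f)

/-- If two segments meet and no three of their endpoints are collinear, then they are transversal. -/
theorem wedge_ne_zero_of_meet {a b c d y : Plane} (h : wedge (b - a) (c - a) ≠ 0)
    (hy : y ∈ seg (a, b)) (hy' : y ∈ seg (c, d)) : wedge (b - a) (d - c) ≠ 0 := by
  intro h0
  apply h
  have h1 := wedge_of_mem_seg hy
  obtain ⟨t, -, rfl⟩ := mem_seg_iff.1 hy'
  simp only at h1
  have : c + t • (d - c) - a = (c - a) + t • (d - c) := by abel
  rw [this, wedge_add_right, wedge_smul_right, h0] at h1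
  simpa using h1

/-- Transversal segments meet in at most one point. -/
theorem eq_of_mem_seg {s t : Plane × Plane} {x y : Plane} (h : wedge (s.2 - s.1) (t.2 - t.1) ≠ 0)
    (hxs : x ∈ seg s) (hxt : x ∈ seg t) (hys : y ∈ seg s) (hyt : y ∈ seg t) : x = y := by
  rw [← sub_eq_zero]
  have e1 : ∀ z : Plane, x - y = (x - z) - (y - z) := fun z => by abel
  refine eq_of_wedge_ne_zero h ?_ ?_
  · rw [e1 s.1, wedge_sub_right, wedge_of_mem_seg hxs, wedge_of_mem_seg hys, sub_zero]
  · rw [e1 t.1, wedge_sub_right, wedge_of_mem_seg hxt, wedge_of_mem_seg hyt, sub_zero]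

/-- The excluded positions form a line, a proper affine subspace, which is a null set. -/
theorem ae_wedge_ne_zero {u : Plane} (hu : u ≠ 0) (a : Plane) :
    ∀ᵐ x : Plane, wedge u (x - a) ≠ 0 := by
  let L : Plane →ₗ[ℝ] ℝ :=
    { toFun := wedge u
      map_add' := wedge_add_right u
      map_smul' := fun c v => wedge_smul_right c u v }
  have h := Measure.addHaar_affineSubspace (volume : Measure Plane)
    (AffineSubspace.mk' a (LinearMap.ker L)) (by
      intro h
      have : ∀ v, wedge u v = 0 := fun v => by
        have : v + a ∈ AffineSubspace.mk' a (LinearMap.ker L) := by rw [h]; trivial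
        simpa [AffineSubspace.mem_mk', L] using this
      have h0 := this (!₂[0, 1])
      have h1 := this (!₂[1, 0])
      simp [wedge] at h0 h1
      exact hu (Plane.ext' (by simpa using h0) (by simpa using h1)))
  rw [ae_iff]
  convert h using 2
  ext x
  simp [AffineSubspace.mem_mk', L]

/-- Both conditions are symmetric in the roles of the points, so it is enough to require them with
the new point in one fixed place. -/
theorem GenPos.insert_point {S : Set Plane} (hS : GenPos S) {x : Plane}
    (h₂ : ∀ a ∈ S, ∀ b ∈ S, a ≠ b → wedge (b - a) (x - a) ≠ 0)
    (h₃ : ∀ a ∈ S, ∀ b ∈ S, ∀ c ∈ S, ∀ d ∈ S, ∀ e ∈ S, [a, b, c, d, e].Nodup →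
      ∀ y, y ∈ seg (a, b) → y ∈ seg (c, d) → y ∉ seg (e, x)) : GenPos (insert x S) := by
  have h₃' : ∀ a ∈ S, ∀ b ∈ S, ∀ c ∈ S, ∀ d ∈ S, ∀ e ∈ S, [a, b, c, d, e].Nodup →
      ∀ y, y ∈ seg (a, b) → y ∈ seg (c, d) → y ∉ seg (x, e) := fun a ha b hb c hc d hd e he hn y h h' => by
    rw [← seg_swap]; exact h₃ a ha b hb c hc d hd e he hn y h h'
  constructor
  · rintro a (rfl | ha) b (rfl | hb) c (rfl | hc) hab hac hbc
    any_goals contradiction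
    · have h := h₂ b hb c hc hbc
      contrapose! h
      have e1 : c - b = (c - a) - (b - a) := by abel
      have e2 : a - b = - (b - a) := by abel
      rw [e1, e2, wedge_neg_right, wedge_sub_left, wedge_self, wedge_swap, h]; simp
    · have h := h₂ a ha c hc hac
      rwa [wedge_swap, neg_ne_zero]
    · exact h₂ a ha b hb hab
    · exact hS.wedge_ne a ha b hb c hc hab hac hbc
  · intro a ha b hb c hc d hd e he f hf hn y h1 h2 h3
    have hx : ∀ z, z ∈ insert x S → z ≠ x → z ∈ S := fun z hz hzx => hz.resolve_left hzx
    obtain ⟨⟨ab, ac, ad, ae, af⟩, ⟨bc, bd, be, bf⟩, ⟨cd, ce, cf⟩, ⟨de, df⟩, ef'⟩ :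
      (a ≠ b ∧ a ≠ c ∧ a ≠ d ∧ a ≠ e ∧ a ≠ f) ∧ (b ≠ c ∧ b ≠ d ∧ b ≠ e ∧ b ≠ f) ∧
      (c ≠ d ∧ c ≠ e ∧ c ≠ f) ∧ (d ≠ e ∧ d ≠ f) ∧ e ≠ f := by simpa using hn
    have n5 : ∀ {p q r s t : Plane}, p ≠ q → p ≠ r → p ≠ s → p ≠ t → q ≠ r → q ≠ s → q ≠ t →
        r ≠ s → r ≠ t → s ≠ t → [p, q, r, s, t].Nodup := by
      intro p q r s t; simp; tauto
    by_cases ea : a = x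
    · subst ea
      exact h₃' c (hx c hc ac.symm) d (hx d hd ad.symm) e (hx e he ae.symm) f (hx f hf af.symm) b (hx b hb ab.symm)
        (n5 cd ce cf bc.symm de df bd.symm ef' be.symm bf.symm) y h2 h3 h1
    by_cases eb : b = x
    · subst eb
      exact h₃ c (hx c hc bc.symm) d (hx d hd bd.symm) e (hx e he be.symm) f (hx f hf bf.symm) a (hx a ha ab)
        (n5 cd ce cf ac.symm de df ad.symm ef' ae.symm af.symm) y h2 h3 h1
    by_cases ec : c = x
    · subst ec
      exact h₃' a (hx a ha ac) b (hx b hb bc) e (hx e he ce.symm) f (hx f hf cf.symm) d (hx d hd cd.symm)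
        (n5 ab ae af ad be bf bd ef' de.symm df.symm) y h1 h3 h2
    by_cases ed : d = x
    · subst ed
      exact h₃ a (hx a ha ad) b (hx b hb bd) e (hx e he de.symm) f (hx f hf df.symm) c (hx c hc cd)
        (n5 ab ae af ac be bf bc ef' ce.symm cf.symm) y h1 h3 h2
    by_cases ee : e = x
    · subst ee
      exact h₃' a (hx a ha ae) b (hx b hb be) c (hx c hc ce) d (hx d hd de) f (hx f hf ef'.symm)
        (n5 ab ac ad af bc bd bf cd cf df) y h1 h2 h3
    by_cases ef : f = x
    · subst ef
      exact h₃ a (hx a ha af) b (hx b hb bf) c (hx c hc cf) d (hx d hd df) e (hx e he ef')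
        (n5 ab ac ad ae bc bd be cd ce de) y h1 h2 h3
    exact hS.no_triple a (hx a ha ea) b (hx b hb eb) c (hx c hc ec) d (hx d hd ed) e (hx e he ee)
      f (hx f hf ef) hn y h1 h2 h3

/-- Excluded are the points of `S`, the lines through two of them, and the lines that join a point
of `S` to the crossing of two segments. Such a crossing is unique because the segments are
transversal, so finitely many null sets are excluded. -/
theorem GenPos.ae_insert_point {S : Set Plane} (hS : GenPos S) (hf : S.Finite) :
    ∀ᵐ x : Plane, x ∉ S ∧ GenPos (insert x S) := by
  have h₁ : ∀ᵐ x : Plane, x ∉ S := by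
    rw [ae_iff]; simpa using hf.measure_zero volume
  have h₂ : ∀ᵐ x : Plane, ∀ a ∈ S, ∀ b ∈ S, a ≠ b → wedge (b - a) (x - a) ≠ 0 := by
    refine (ae_ball_iff hf.countable).2 fun a ha => (ae_ball_iff hf.countable).2 fun b hb => ?_
    by_cases hab : a = b
    · simp [hab]
    · filter_upwards [ae_wedge_ne_zero (sub_ne_zero.2 (Ne.symm hab)) a] with x hx _ using hx
  have h₃ : ∀ᵐ x : Plane, ∀ a ∈ S, ∀ b ∈ S, ∀ c ∈ S, ∀ d ∈ S, ∀ e ∈ S, [a, b, c, d, e].Nodup →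
      ∀ y, y ∈ seg (a, b) → y ∈ seg (c, d) → y ∉ seg (e, x) := by
    refine (ae_ball_iff hf.countable).2 fun a ha => (ae_ball_iff hf.countable).2 fun b hb =>
      (ae_ball_iff hf.countable).2 fun c hc => (ae_ball_iff hf.countable).2 fun d hd =>
      (ae_ball_iff hf.countable).2 fun e he => ?_
    by_cases hn : [a, b, c, d, e].Nodup
    · simp only [List.nodup_cons, List.mem_cons, List.not_mem_nil, not_or, not_false_eq_true,
        List.nodup_nil, and_true] at hn
      by_cases hy : ∃ y, y ∈ seg (a, b) ∧ y ∈ seg (c, d)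
      · obtain ⟨y, hy, hy'⟩ := hy
        have hw := wedge_ne_zero_of_meet (hS.wedge_ne a ha b hb c hc (by tauto) (by tauto)
          (by tauto)) hy hy'
        have hye : y ≠ e := fun h => by
          have := wedge_of_mem_seg hy
          rw [h] at this
          exact hS.wedge_ne a ha b hb e he (by tauto) (by tauto) (by tauto) this
        filter_upwards [ae_wedge_ne_zero (sub_ne_zero.2 hye) e] with x hx _ z hz hz' hzx
        rw [eq_of_mem_seg (s := (a, b)) (t := (c, d)) hw hz hz' hy hy'] at hzx
        have := wedge_of_mem_seg hzx
        rw [wedge_swap, neg_eq_zero] at this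
        exact hx this
      · push Not at hy
        exact Eventually.of_forall fun x _ y h h' => absurd h' (hy y h)
    · exact Eventually.of_forall fun x h => absurd h hn
  filter_upwards [h₁, h₂, h₃] with x hx₁ hx₂ hx₃ using ⟨hx₁, hS.insert_point hx₂ hx₃⟩

theorem genPos_empty : GenPos ∅ := ⟨by simp, by simp⟩

/-- Points can be moved into general position by an arbitrarily small perturbation. -/
theorem exists_genPos_near {K : Type*} [Finite K] (q : K → Plane) {U : Set (K → Plane)}
    (hU : U ∈ 𝓝 q) : ∃ q' ∈ U, Function.Injective q' ∧ GenPos (range q') := by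
  classical
  have := Fintype.ofFinite K
  -- The points are moved one after another; almost every position of the next point is admissible,
  -- so some admissible position lies in the prescribed open set.
  have key : ∀ s : Finset K, ∀ U ∈ 𝓝 q, ∃ q' ∈ U, InjOn q' s ∧ GenPos (q' '' s) := by
    intro s
    induction s using Finset.induction_on with
    | empty => intro U hU; exact ⟨q, mem_of_mem_nhds hU, by simp, by simpa using genPos_empty⟩
    | insert k s hk ih =>
      intro U hU
      obtain ⟨q₁, hq₁, hi, hg⟩ := ih (interior U) (interior_mem_nhds.2 hU)
      have hopen : IsOpen ((fun x => Function.update q₁ k x) ⁻¹' interior U) :=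
        isOpen_interior.preimage ((continuous_const (y := q₁)).update k continuous_id)
      obtain ⟨x, hxU, hx, hxg⟩ := (Measure.dense_of_ae (hg.ae_insert_point
        ((Finset.finite_toSet s).image q₁))).inter_open_nonempty _ hopen ⟨q₁ k, by simpa⟩
      have he : ∀ j ∈ s, Function.update q₁ k x j = q₁ j := fun j hj =>
        Function.update_of_ne (fun h : j = k => hk (h ▸ hj)) ..
      refine ⟨Function.update q₁ k x, interior_subset hxU, ?_, ?_⟩
      · rw [Finset.coe_insert, injOn_insert (by simpa using hk)]
        refine ⟨hi.congr fun j hj => (he j hj).symm, ?_⟩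
        rw [Function.update_self]
        rintro ⟨j, hj, h⟩
        exact hx ⟨j, hj, by rw [← he j hj, h]⟩
      · rw [Finset.coe_insert, image_insert_eq, Function.update_self, image_congr he]
        exact hxg
  obtain ⟨q', h1, h2, h3⟩ := key Finset.univ U hU
  exact ⟨q', h1, by simpa [injOn_univ] using h2, by simpa using h3⟩

/-! ### Polygonal drawings of the complete graph -/

/-- The edges of the complete graph on a linearly ordered type. -/
abbrev VPair (V : Type*) [LinearOrder V] : Type _ := {p : V × V // p.1 < p.2}

/-- A family of polygonal lines, one for each edge of the complete graph on `V`. -/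
structure Config (V : Type*) [LinearOrder V] where
  pos : V → Plane
  bends : VPair V → List Plane

namespace Config

variable {V : Type*} [LinearOrder V]

/-- The polygonal line that represents an edge. -/
def poly (c : Config V) (e : VPair V) : List Plane := c.pos e.1.1 :: c.bends e ++ [c.pos e.1.2]

/-- All vertices and bends are distinct and in general position. -/
structure Generic (c : Config V) : Prop where
  pos_injective : Function.Injective c.pos
  bends_nodup : ∀ e, (c.bends e).Nodup
  pos_notMem_bends : ∀ e v, c.pos v ∉ c.bends e
  bends_disjoint : ∀ e f, e ≠ f → ∀ x, x ∈ c.bends e → x ∉ c.bends f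
  genPos : GenPos (range c.pos ∪ {x | ∃ e, x ∈ c.bends e})

/-- Every family of polygonal lines can be made generic by a small perturbation, which creates no
crossings. -/
theorem exists_generic [Finite V] (c : Config V) : ∃ c' : Config V, c'.Generic ∧
    (∀ e f, cross (c'.poly e) (c'.poly f) ≤ cross (c.poly e) (c.poly f)) ∧
    ∀ e, (c'.bends e).length = (c.bends e).length := by
  -- All vertices and bends are treated as one family of points that move independently.
  let K := V ⊕ (Σ e : VPair V, Fin (c.bends e).length)
  let q : K → Plane := Sum.elim c.pos fun p => (c.bends p.1).get p.2
  let cfg : (K → Plane) → Config V := fun q =>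
    ⟨fun v => q (Sum.inl v), fun e => List.ofFn fun k => q (Sum.inr ⟨e, k⟩)⟩
  have hcfg : cfg q = c := by
    cases c
    simp [cfg, q]
  let idx : VPair V → List K := fun e =>
    Sum.inl e.1.1 :: (List.ofFn fun k => Sum.inr ⟨e, k⟩) ++ [Sum.inl e.1.2]
  have hpoly : ∀ q e, (cfg q).poly e = ((idx e).map fun k (q : K → Plane) => q k).map (· q) := by
    intro q e
    simp only [poly, idx, cfg, List.map_append, List.map_cons, List.map_nil,
      List.map_ofFn]
    rfl
  have hev : ∀ᶠ q' in 𝓝 q, ∀ e f, cross ((cfg q').poly e) ((cfg q').poly f) ≤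
      cross ((cfg q).poly e) ((cfg q).poly f) := by
    refine eventually_all.2 fun e => eventually_all.2 fun f => ?_
    simp only [hpoly]
    apply eventually_cross_le le_rfl <;>
    · intro φ hφ
      obtain ⟨k, -, rfl⟩ := List.mem_map.1 hφ
      exact (continuous_apply k).continuousAt
  obtain ⟨q', h1, h2, h3⟩ := exists_genPos_near q hev
  rw [hcfg] at h1
  refine ⟨cfg q', ⟨?_, ?_, ?_, ?_, ?_⟩, h1, fun e => by simp [cfg]⟩
  · exact fun u v h => Sum.inl_injective (h2 h)
  · intro e
    refine List.nodup_ofFn.2 fun i j h => ?_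
    have := Sum.inr_injective (h2 h)
    simpa using this
  · intro e v h
    obtain ⟨k, hk⟩ := (List.mem_ofFn' _ _).1 h
    exact absurd (h2 hk) (by simp)
  · intro e f hef x hx hx'
    obtain ⟨k, rfl⟩ := (List.mem_ofFn' _ _).1 hx
    obtain ⟨k', hk⟩ := (List.mem_ofFn' _ _).1 hx'
    have := Sum.inr_injective (h2 hk)
    exact hef (congrArg Sigma.fst this).symm
  · convert h3 using 1
    ext x
    simp only [cfg, mem_union, mem_range, mem_ofPred_eq, List.mem_ofFn]
    constructor
    · rintro (⟨v, h⟩ | ⟨e, i, h⟩)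
      exacts [⟨_, h⟩, ⟨_, h⟩]
    · rintro ⟨v | ⟨e, i⟩, h⟩
      exacts [Or.inl ⟨_, h⟩, Or.inr ⟨_, _, h⟩]

end Config

/-! ### Simple polygonal lines and the removal of loops -/

theorem not_swap_mem_segs {α : Type*} {l : List α} (hl : l.Nodup) {a b : α} (h : (a, b) ∈ segs l) :
    (b, a) ∉ segs l := by
  obtain ⟨l₁, l₂, rfl⟩ := mem_segs_iff.1 h
  intro h'
  simp only [List.nodup_append, List.nodup_cons, List.mem_cons] at hl
  rw [segs_append_cons_cons, List.mem_append, List.mem_cons] at h'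
  rcases h' with h' | h' | h'
  · have := left_mem_of_mem_segs h'
    simp only [List.mem_append, List.mem_singleton] at this
    grind
  · simp only [Prod.mk.injEq] at h'
    grind
  · have := right_mem_of_mem_segs h'
    simp only [List.mem_cons] at this
    grind

theorem segs_order {α : Type*} {l : List α} {s t : α × α} (hs : s ∈ segs l) (ht : t ∈ segs l)
    (hst : s ≠ t) : (∃ A B, l = A ++ s.1 :: s.2 :: B ∧ t ∈ segs (s.2 :: B)) ∨
      (∃ A B, l = A ++ t.1 :: t.2 :: B ∧ s ∈ segs (t.2 :: B)) := by
  induction l with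
  | nil => simp at hs
  | cons x l ih => cases l with
    | nil => simp at hs
    | cons y l =>
      rw [segs_cons_cons, List.mem_cons] at hs ht
      rcases hs with rfl | hs <;> rcases ht with rfl | ht
      · exact absurd rfl hst
      · exact Or.inl ⟨[], l, rfl, ht⟩
      · exact Or.inr ⟨[], l, rfl, hs⟩
      · rcases ih hs ht with ⟨A, B, h, h'⟩ | ⟨A, B, h, h'⟩
        · exact Or.inl ⟨x :: A, B, by rw [h]; rfl, h'⟩
        · exact Or.inr ⟨x :: A, B, by rw [h]; rfl, h'⟩

/-- Since no three points are collinear, two meeting segments are never parallel. A common endpoint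
is therefore their only common point, and without one they cross properly. -/
theorem GenPos.of_mem_seg {S : Set Plane} (hS : GenPos S) {s t : Plane × Plane} (h₁ : s.1 ∈ S)
    (h₂ : s.2 ∈ S) (h₃ : t.1 ∈ S) (h₄ : t.2 ∈ S) (hs : s.1 ≠ s.2) (ht : t.1 ≠ t.2) (hst : s ≠ t)
    (hst' : s ≠ t.swap) {y : Plane} (hy : y ∈ seg s) (hy' : y ∈ seg t) :
    wedge (s.2 - s.1) (t.2 - t.1) ≠ 0 ∧
      ([s.1, s.2, t.1, t.2].Nodup ∨ ((y = s.1 ∨ y = s.2) ∧ (y = t.1 ∨ y = t.2))) := by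
  obtain ⟨a, b⟩ := s
  obtain ⟨c, d⟩ := t
  simp only [ne_eq, Prod.mk.injEq, Prod.swap_prod_mk] at *
  have l1 : ∀ {a b : Plane}, a ∈ seg (a, b) := fun {a b} => left_mem_segment ..
  have l2 : ∀ {a b : Plane}, b ∈ seg (a, b) := fun {a b} => right_mem_segment ..
  by_cases hac : a = c
  · subst hac
    have hw := hS.wedge_ne a h₁ b h₂ d h₄ hs ht (by tauto)
    have := eq_of_mem_seg (s := (a, b)) (t := (a, d)) hw hy hy' l1 l1
    exact ⟨hw, Or.inr (by tauto)⟩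
  by_cases had : a = d
  · subst had
    have hw := hS.wedge_ne a h₁ b h₂ c h₃ hs hac (by tauto)
    have hw' : wedge (b - a) (a - c) ≠ 0 := by
      rw [← neg_sub c a, wedge_neg_right]; exact neg_ne_zero.2 hw
    have := eq_of_mem_seg (s := (a, b)) (t := (c, a)) hw' hy hy' l1 l2
    exact ⟨hw', Or.inr (by tauto)⟩
  by_cases hbc : b = c
  · subst hbc
    have hw := hS.wedge_ne a h₁ b h₂ d h₄ hs had ht
    have hw' : wedge (b - a) (d - b) ≠ 0 := by
      have : d - b = (d - a) - (b - a) := by abel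
      rwa [this, wedge_sub_right, wedge_self, sub_zero]
    have := eq_of_mem_seg (s := (a, b)) (t := (b, d)) hw' hy hy' l2 l1
    exact ⟨hw', Or.inr (by tauto)⟩
  by_cases hbd : b = d
  · subst hbd
    have hw := hS.wedge_ne a h₁ b h₂ c h₃ hs hac (by tauto)
    have hw' : wedge (b - a) (b - c) ≠ 0 := by
      have : b - c = (b - a) - (c - a) := by abel
      rw [this, wedge_sub_right, wedge_self, zero_sub]; exact neg_ne_zero.2 hw
    have := eq_of_mem_seg (s := (a, b)) (t := (c, b)) hw' hy hy' l2 l2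
    exact ⟨hw', Or.inr (by tauto)⟩
  · exact ⟨wedge_ne_zero_of_meet (hS.wedge_ne a h₁ b h₂ c h₃ hs hac hbc) hy hy',
      Or.inl (by simp; tauto)⟩

/-- A polygonal line without repeated points whose segments are disjoint, but for the common point
of two consecutive segments. -/
structure IsSimpleLine (Q : List Plane) : Prop where
  nodup : Q.Nodup
  inter : ∀ s ∈ segs Q, ∀ t ∈ segs Q, s ≠ t → ∀ x, x ∈ seg s → x ∈ seg t →
    (x = s.2 ∧ x = t.1) ∨ (x = s.1 ∧ x = t.2)

theorem IsSimpleLine.reverse {Q : List Plane} (h : IsSimpleLine Q) : IsSimpleLine Q.reverse := by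
  refine ⟨List.nodup_reverse.2 h.nodup, fun s hs t ht hst x hxs hxt => ?_⟩
  have := h.inter s.swap (by rw [← swap_mem_segs_reverse]; simpa) t.swap
    (by rw [← swap_mem_segs_reverse]; simpa) (fun h => hst (Prod.swap_injective h)) x
    (by rwa [seg_swap]) (by rwa [seg_swap])
  simp only [Prod.fst_swap, Prod.snd_swap] at this
  tauto

theorem seg_subset_of_mem {s : Plane × Plane} {a b : Plane} (ha : a ∈ seg s) (hb : b ∈ seg s) :
    seg (a, b) ⊆ seg s :=
  (convex_segment _ _).segment_subset ha hb

/-- A loop of a polygonal line can be removed. -/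
theorem exists_shorter {L : List Plane} {s t : Plane × Plane} (hs : s ∈ segs L) (ht : t ∈ segs L)
    (hd : [s.1, s.2, t.1, t.2].Nodup) {x : Plane} (hxs : x ∈ seg s) (hxt : x ∈ seg t) :
    ∃ L', L'.head? = L.head? ∧ L'.getLast? = L.getLast? ∧ L'.length < L.length ∧
      ∀ R, cross L' R ≤ cross L R := by
  wlog h : ∃ A B, L = A ++ s.1 :: s.2 :: B ∧ t ∈ segs (s.2 :: B) generalizing s t
  · refine this ht hs ?_ hxt hxs ?_
    · simp at hd ⊢
      have := fun h : s.1 = t.1 => hd.1.2.1 h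
      grind
    · refine (segs_order hs ht ?_).resolve_left h
      rintro rfl
      simp at hd
  obtain ⟨A, B, rfl, htB⟩ := h
  obtain ⟨C, D, hCD⟩ := mem_segs_iff.1 htB
  obtain ⟨C, rfl⟩ : ∃ C', C = s.2 :: C' := by
    cases C with
    | nil => simp at hCD; simp [hCD.1] at hd
    | cons y C => simp at hCD; exact ⟨C, by rw [hCD.1]⟩
  obtain rfl : B = C ++ t.1 :: t.2 :: D := by simpa using hCD
  -- The loop from `x` through `s.2` and `t.1` back to `x` is dropped. The remaining pieces of `s`
  -- and `t` are subsegments, so no crossings arise, and `s.2` and `t.1` are replaced with the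
  -- single point `x`.
  refine ⟨A ++ s.1 :: x :: t.2 :: D, ?_, ?_, ?_, fun R => ?_⟩
  · cases A <;> simp
  · have : ∀ (A B : List Plane) (z : Plane), (A ++ z :: B).getLast? = (z :: B).getLast? := by
      intro A B z; rw [List.getLast?_append]; simp [List.getLast?_cons]
    have h1 : A ++ s.1 :: x :: t.2 :: D = (A ++ [s.1, x]) ++ t.2 :: D := by simp
    have h2 : A ++ s.1 :: (s.2 :: C ++ t.1 :: t.2 :: D) = (A ++ s.1 :: s.2 :: C ++ [t.1]) ++ t.2 :: D := by
      simp
    rw [h1, ← List.cons_append, h2, this, this]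
  · simp
  · simp only [cross]
    rw [segs_append_cons_cons, segs_append_cons_cons, segs_cons_cons, ← List.cons_append,
      segs_append_cons_cons, crossS_append, crossS_cons, crossS_cons (x, t.2), crossS_append _ (_ :: _),
      crossS_cons s, crossS_append, crossS_cons t]
    have h1 : crossS [(s.1, x)] (segs R) ≤ crossS [s] (segs R) :=
      crossS_mono_left _ (.cons (seg_subset_of_mem (left_mem_segment ..) hxs) .nil)
    have h2 : crossS [(x, t.2)] (segs R) ≤ crossS [t] (segs R) :=
      crossS_mono_left _ (.cons (seg_subset_of_mem hxt (right_mem_segment ..)) .nil)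
    omega

namespace Config

variable {V : Type*} [LinearOrder V] {c : Config V}

theorem head?_poly (c : Config V) (e : VPair V) : (c.poly e).head? = some (c.pos e.1.1) := rfl

theorem getLast?_poly (c : Config V) (e : VPair V) :
    (c.poly e).getLast? = some (c.pos e.1.2) := List.getLast?_concat

theorem two_le_length_poly (c : Config V) (e : VPair V) : 2 ≤ (c.poly e).length := by simp [poly]

theorem mem_poly {e : VPair V} {x : Plane} :
    x ∈ c.poly e ↔ x = c.pos e.1.1 ∨ x ∈ c.bends e ∨ x = c.pos e.1.2 := by simp [poly]

/-- Replacing one polygonal line. -/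
theorem exists_update (c : Config V) (e : VPair V) {L : List Plane}
    (h₁ : L.head? = some (c.pos e.1.1)) (h₂ : L.getLast? = some (c.pos e.1.2))
    (hne : c.pos e.1.1 ≠ c.pos e.1.2) :
    ∃ c' : Config V, c'.poly e = L ∧ (∀ f ≠ e, c'.poly f = c.poly f) ∧
      (∀ f ≠ e, c'.bends f = c.bends f) ∧ (c'.bends e).length + 2 = L.length := by
  classical
  obtain ⟨m, rfl⟩ := exists_eq_cons_concat h₁ h₂ hne
  refine ⟨⟨c.pos, Function.update c.bends e m⟩, by simp [poly], ?_, ?_, by simp⟩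
  · intro f hf; simp [poly, Function.update_of_ne hf]
  · intro f hf; simp [Function.update_of_ne hf]

namespace Generic

theorem poly_nodup (hc : c.Generic) (e : VPair V) : (c.poly e).Nodup := by
  have h : c.pos e.1.1 ≠ c.pos e.1.2 := hc.pos_injective.ne e.2.ne
  have h1 := hc.pos_notMem_bends e
  simp only [poly, List.cons_append, List.nodup_cons, List.mem_append, List.mem_singleton,
    List.nodup_append, hc.bends_nodup e]
  refine ⟨by simp [h, h1], trivial, by simp, ?_⟩
  rintro a ha b rfl rfl
  exact h1 _ ha

theorem mem_of_mem_poly {e : VPair V} {x : Plane} (h : x ∈ c.poly e) :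
    x ∈ range c.pos ∪ {x | ∃ e, x ∈ c.bends e} := by
  rcases mem_poly.1 h with rfl | h | rfl
  · exact Or.inl (mem_range_self _)
  · exact Or.inr ⟨e, h⟩
  · exact Or.inl (mem_range_self _)

theorem pos_mem_poly (hc : c.Generic) {e : VPair V} {v : V} (h : c.pos v ∈ c.poly e) :
    v = e.1.1 ∨ v = e.1.2 := by
  rcases mem_poly.1 h with h | h | h
  · exact Or.inl (hc.pos_injective h)
  · exact absurd h (hc.pos_notMem_bends _ _)
  · exact Or.inr (hc.pos_injective h)

theorem exists_pos_of_mem_poly (hc : c.Generic) {e f : VPair V} (hef : e ≠ f) {x : Plane}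
    (he : x ∈ c.poly e) (hf : x ∈ c.poly f) :
    ∃ v, x = c.pos v ∧ (v = e.1.1 ∨ v = e.1.2) ∧ (v = f.1.1 ∨ v = f.1.2) := by
  obtain ⟨v, rfl⟩ : ∃ v, x = c.pos v := by
    rcases mem_poly.1 he with h | h | h
    · exact ⟨_, h⟩
    · rcases mem_poly.1 hf with h' | h' | h'
      · exact ⟨_, h'⟩
      · exact absurd h' (hc.bends_disjoint e f hef _ h)
      · exact ⟨_, h'⟩
    · exact ⟨_, h⟩
  exact ⟨v, rfl, hc.pos_mem_poly he, hc.pos_mem_poly hf⟩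

end Generic

theorem _root_.VPair.eq_of_common {e f : VPair V} {u v : V} (huv : u ≠ v)
    (hue : u = e.1.1 ∨ u = e.1.2) (huf : u = f.1.1 ∨ u = f.1.2) (hve : v = e.1.1 ∨ v = e.1.2)
    (hvf : v = f.1.1 ∨ v = f.1.2) : e = f := by
  obtain ⟨⟨a, b⟩, h⟩ := e
  obtain ⟨⟨a', b'⟩, h'⟩ := f
  simp only [Subtype.mk.injEq, Prod.mk.injEq] at *
  grind

namespace Generic

/-- Segments of different edges are transversal, if they meet, and only meet in a common vertex
if they have a common endpoint. -/
theorem of_mem_seg (hc : c.Generic) {e f : VPair V} (hef : e ≠ f) {s t : Plane × Plane}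
    (hs : s ∈ segs (c.poly e)) (ht : t ∈ segs (c.poly f)) {y : Plane} (hys : y ∈ seg s)
    (hyt : y ∈ seg t) : wedge (s.2 - s.1) (t.2 - t.1) ≠ 0 ∧
      ([s.1, s.2, t.1, t.2].Nodup ∨ ((y = s.1 ∨ y = s.2) ∧ (y = t.1 ∨ y = t.2))) := by
  have m1 := left_mem_of_mem_segs hs
  have m2 := right_mem_of_mem_segs hs
  have m3 := left_mem_of_mem_segs ht
  have m4 := right_mem_of_mem_segs ht
  have n1 := ne_of_mem_segs (hc.poly_nodup e) hs
  -- Otherwise both ends of `s` would be vertices of `e` and of `f`, and the two edges would be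
  -- equal.
  have key : ¬ (s.1 ∈ c.poly f ∧ s.2 ∈ c.poly f) := by
    rintro ⟨h1, h2⟩
    obtain ⟨u, hu, hue, huf⟩ := hc.exists_pos_of_mem_poly hef m1 h1
    obtain ⟨v, hv, hve, hvf⟩ := hc.exists_pos_of_mem_poly hef m2 h2
    exact hef (VPair.eq_of_common (fun h => n1 (by rw [hu, hv, h])) hue huf hve hvf)
  refine hc.genPos.of_mem_seg (mem_of_mem_poly m1) (mem_of_mem_poly m2) (mem_of_mem_poly m3)
    (mem_of_mem_poly m4) n1 (ne_of_mem_segs (hc.poly_nodup f) ht) ?_ ?_ hys hyt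
  · rintro rfl; exact key ⟨m3, m4⟩
  · rintro rfl; exact key ⟨m4, m3⟩

/-- A point of three edges is a vertex. -/
theorem exists_pos_of_mem_img (hc : c.Generic) {e f g : VPair V} (hef : e ≠ f) (heg : e ≠ g)
    (hfg : f ≠ g) {y : Plane} (he : y ∈ img (c.poly e)) (hf : y ∈ img (c.poly f))
    (hg : y ∈ img (c.poly g)) : ∃ v, y = c.pos v := by
  obtain ⟨s, hs, hys⟩ := he
  obtain ⟨t, ht, hyt⟩ := hf
  obtain ⟨u, hu, hyu⟩ := hg
  have hv : ∀ {e f : VPair V} (hef : e ≠ f) {s t : Plane × Plane} (hs : s ∈ segs (c.poly e))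
      (ht : t ∈ segs (c.poly f)), ((y = s.1 ∨ y = s.2) ∧ (y = t.1 ∨ y = t.2)) →
        ∃ v, y = c.pos v := by
    rintro e f hef s t hs ht ⟨h1, h2⟩
    have m1 : y ∈ c.poly e := by
      rcases h1 with rfl | rfl
      exacts [left_mem_of_mem_segs hs, right_mem_of_mem_segs hs]
    have m2 : y ∈ c.poly f := by
      rcases h2 with rfl | rfl
      exacts [left_mem_of_mem_segs ht, right_mem_of_mem_segs ht]
    obtain ⟨v, hv, -⟩ := hc.exists_pos_of_mem_poly hef m1 m2
    exact ⟨v, hv⟩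
  rcases (hc.of_mem_seg hef hs ht hys hyt).2 with h1 | h1
  swap
  · exact hv hef hs ht h1
  rcases (hc.of_mem_seg heg hs hu hys hyu).2 with h2 | h2
  swap
  · exact hv heg hs hu h2
  rcases (hc.of_mem_seg hfg ht hu hyt hyu).2 with h3 | h3
  swap
  · exact hv hfg ht hu h3
  refine absurd hyu (hc.genPos.no_triple s.1 (mem_of_mem_poly (left_mem_of_mem_segs hs))
    s.2 (mem_of_mem_poly (right_mem_of_mem_segs hs)) t.1 (mem_of_mem_poly (left_mem_of_mem_segs ht))
    t.2 (mem_of_mem_poly (right_mem_of_mem_segs ht)) u.1 (mem_of_mem_poly (left_mem_of_mem_segs hu))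
    u.2 (mem_of_mem_poly (right_mem_of_mem_segs hu)) ?_ y hys hyt)
  simp at h1 h2 h3 ⊢
  tauto

/-- If two segments of one line meet in a common endpoint, then they are consecutive. A violation of
simplicity thus involves four different endpoints and closes a loop, which can be cut off. -/
theorem exists_shorter_of_not_simple (hc : c.Generic) {e : VPair V}
    (h : ¬ IsSimpleLine (c.poly e)) : ∃ L', L'.head? = (c.poly e).head? ∧
      L'.getLast? = (c.poly e).getLast? ∧ L'.length < (c.poly e).length ∧
      ∀ R, cross L' R ≤ cross (c.poly e) R := by
  have hn := hc.poly_nodup e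
  have h' : ∃ s ∈ segs (c.poly e), ∃ t ∈ segs (c.poly e), s ≠ t ∧ ∃ x, x ∈ seg s ∧ x ∈ seg t ∧
      ¬ ((x = s.2 ∧ x = t.1) ∨ (x = s.1 ∧ x = t.2)) := by
    by_contra! h'
    exact h ⟨hn, fun s hs t ht hst x hxs hxt => by
      have := h' s hs t ht hst x hxs hxt
      tauto⟩
  obtain ⟨s, hs, t, ht, hst, x, hxs, hxt, hx⟩ := h'
  have := hc.genPos.of_mem_seg (mem_of_mem_poly (left_mem_of_mem_segs hs))
    (mem_of_mem_poly (right_mem_of_mem_segs hs)) (mem_of_mem_poly (left_mem_of_mem_segs ht))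
    (mem_of_mem_poly (right_mem_of_mem_segs ht)) (ne_of_mem_segs hn hs) (ne_of_mem_segs hn ht) hst
    (fun h => not_swap_mem_segs hn hs (by rw [h]; simpa using ht)) hxs hxt
  rcases this.2 with hd | ⟨h1, h2⟩
  · exact exists_shorter hs ht hd hxs hxt
  · exfalso
    rcases h1 with h1 | h1 <;> rcases h2 with h2 | h2
    · exact hst (segs_right_unique hn hs ht (h1.symm.trans h2))
    · exact hx (Or.inr ⟨h1, h2⟩)
    · exact hx (Or.inl ⟨h1, h2⟩)
    · exact hst (segs_left_unique hn hs ht (h1.symm.trans h2))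

/-- All polygonal lines of a generic family can be made simple. -/
theorem exists_simple [Fintype V] (hc : c.Generic) : ∃ c' : Config V, c'.Generic ∧
    (∀ e, IsSimpleLine (c'.poly e)) ∧
    (∀ e f, e ≠ f → cross (c'.poly e) (c'.poly f) ≤ cross (c.poly e) (c.poly f)) ∧
    ((∀ e, c.bends e = []) → ∀ e, c'.bends e = []) := by
  classical
  -- The total number of bends drops when a loop is cut off, and the perturbation that restores
  -- general position keeps it.
  induction hN : ∑ e, (c.bends e).length using Nat.strong_induction_on generalizing c with
  | _ N ih =>
    subst hN
    by_cases h : ∀ e, IsSimpleLine (c.poly e)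
    · exact ⟨c, hc, h, fun _ _ _ => le_rfl, id⟩
    · push Not at h
      obtain ⟨e, he⟩ := h
      obtain ⟨L, h1, h2, h3, h4⟩ := hc.exists_shorter_of_not_simple he
      obtain ⟨c₁, k1, k2, k3, k4⟩ := c.exists_update e (h1.trans (c.head?_poly e))
        (h2.trans (c.getLast?_poly e)) (hc.pos_injective.ne e.2.ne)
      obtain ⟨c₂, hc₂, m1, m2⟩ := c₁.exists_generic
      have hlt : (c₁.bends e).length < (c.bends e).length := by
        have : (c.poly e).length = (c.bends e).length + 2 := by simp [poly]
        omega
      have hcr : ∀ f g, f ≠ g → cross (c₁.poly f) (c₁.poly g) ≤ cross (c.poly f) (c.poly g) := by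
        intro f g hfg
        by_cases hf : f = e
        · subst hf
          rw [k1, k2 g hfg.symm]
          exact h4 _
        by_cases hg : g = e
        · subst hg
          rw [k1, k2 f hf, cross_comm, cross_comm (c.poly f)]
          exact h4 _
        rw [k2 f hf, k2 g hg]
      obtain ⟨c', g1, g2, g3, -⟩ := ih (∑ e, (c₂.bends e).length) (by
        refine Finset.sum_lt_sum (fun f _ => ?_) ⟨e, Finset.mem_univ _, by rw [m2]; exact hlt⟩
        by_cases hf : f = e
        · subst hf; rw [m2]; exact hlt.le
        · rw [m2, k3 f hf]) hc₂ rfl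
      refine ⟨c', g1, g2, fun f g hfg => (g3 f g hfg).trans ((m1 f g).trans (hcr f g hfg)), ?_⟩
      -- A line without bends has no loop to cut off, so this case cannot occur for straight edges.
      intro hb
      rw [hb e] at hlt
      simp at hlt

end Generic

end Config

/-! ### Parallel copies of a polygonal line -/

theorem exists_wedge_pos {d : Plane} (hd : d ≠ 0) {κ : ℝ} (hk : κ ≠ 0) :
    ∃ m, 0 < κ * wedge d m := by
  refine ⟨κ • !₂[- d 1, d 0], ?_⟩
  have : κ * wedge d (κ • !₂[- d 1, d 0]) = κ ^ 2 * (d 0 ^ 2 + d 1 ^ 2) := by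
    simp [wedge]; ring
  rw [this]
  have h : d 0 ≠ 0 ∨ d 1 ≠ 0 := by
    by_contra! h
    exact hd (Plane.ext' (by simpa using h.1) (by simpa using h.2))
  rcases h with h | h <;> positivity

theorem wedge_of_mem_seg_pair {A B x : Plane} (h : x ∈ seg (A, B)) (d p : Plane) :
    ∃ t ∈ Icc (0 : ℝ) 1, x = A + t • (B - A) ∧
      wedge d (x - p) = (1 - t) * wedge d (A - p) + t * wedge d (B - p) := by
  obtain ⟨t, ht, rfl⟩ := mem_seg_iff.1 h
  exact ⟨t, ht, rfl, by simp [wedge]; ring⟩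

/-- The wedge is affine along the segment, so it can vanish only at the end `B`. -/
theorem wedge_pos_of_mem_seg {A B x d p : Plane} {κ : ℝ} (h : x ∈ seg (A, B))
    (hA : 0 < κ * wedge d (A - p)) (hB : 0 ≤ κ * wedge d (B - p)) :
    x = B ∨ 0 < κ * wedge d (x - p) := by
  obtain ⟨t, ht, hx, hw⟩ := wedge_of_mem_seg_pair h d p
  rcases eq_or_lt_of_le ht.2 with rfl | h1
  · left; rw [hx]; simp
  · right
    rw [hw]
    have : κ * ((1 - t) * wedge d (A - p) + t * wedge d (B - p)) =
      (1 - t) * (κ * wedge d (A - p)) + t * (κ * wedge d (B - p)) := by ring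
    rw [this]
    have := ht.1
    have : 0 < 1 - t := by linarith
    positivity

theorem wedge_nonpos_of_mem_seg {A B x d p : Plane} {κ : ℝ} (h : x ∈ seg (A, B))
    (hA : κ * wedge d (A - p) ≤ 0) (hB : κ * wedge d (B - p) ≤ 0) :
    κ * wedge d (x - p) ≤ 0 := by
  obtain ⟨t, ht, hx, hw⟩ := wedge_of_mem_seg_pair h d p
  rw [hw]
  have : κ * ((1 - t) * wedge d (A - p) + t * wedge d (B - p)) =
    (1 - t) * (κ * wedge d (A - p)) + t * (κ * wedge d (B - p)) := by ring
  rw [this]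
  have := ht.1
  have : 0 ≤ 1 - t := by linarith [ht.2]
  nlinarith

/-- The vector `m` points to the left (if `κ > 0`) or to the right (if `κ < 0`) of the two segments
of the polygonal line `Q` at its point `z`. -/
def LeftOf (κ : ℝ) (Q : List Plane) (z m : Plane) : Prop :=
  (∀ u, (u, z) ∈ segs Q → 0 < κ * wedge (z - u) m) ∧
  (∀ u, (z, u) ∈ segs Q → 0 < κ * wedge (u - z) m)

/-- A segment of a polygonal line can be moved off the line, to one of its sides. -/
theorem eventually_shift_seg {Q : List Plane} (hQ : IsSimpleLine Q) {κ : ℝ} {z z' m m' : Plane}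
    (hz : (z, z') ∈ segs Q) (hm : LeftOf κ Q z m)
    (hm' : LeftOf κ Q z' m' ∨ (m' = 0 ∧ ∀ u, (z', u) ∉ segs Q)) :
    ∀ᶠ ε : ℝ in 𝓝[>] 0, ∀ x ∈ seg (z + ε • m, z' + ε • m'), x ∈ img Q → m' = 0 ∧ x = z' := by
  have hpos : ∀ᶠ ε : ℝ in 𝓝[>] 0, 0 < ε := eventually_mem_nhdsWithin
  have hd := hm.2 z' hz
  have hd' : 0 ≤ κ * wedge (z' - z) m' := by
    rcases hm' with h | ⟨rfl, -⟩
    · exact (h.1 z hz).le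
    · simp
  -- The shifted segment lies strictly on the chosen side of the line through `z` and `z'`, except
  -- for its end if `z'` is not moved.
  have left : ∀ ε : ℝ, 0 < ε → ∀ x ∈ seg (z + ε • m, z' + ε • m'),
      κ * wedge (z' - z) (x - z) ≤ 0 → m' = 0 ∧ x = z' := by
    intro ε hε x hx hx0
    have hA : 0 < κ * wedge (z' - z) (z + ε • m - z) := by
      rw [add_sub_cancel_left, wedge_smul_right]
      have := mul_pos hε hd; linarith
    have hB : κ * wedge (z' - z) (z' + ε • m' - z) = ε * (κ * wedge (z' - z) m') := by
      rw [add_sub_right_comm, wedge_add_right, wedge_self, wedge_smul_right]; ring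
    rcases wedge_pos_of_mem_seg hx hA (by rw [hB]; positivity) with rfl | h
    · rcases hm' with h | ⟨rfl, -⟩
      · rw [hB] at hx0
        have := mul_pos hε (h.1 z hz)
        linarith
      · simp
    · linarith
  suffices ∀ᶠ ε : ℝ in 𝓝[>] 0, ∀ t ∈ {t | t ∈ segs Q},
      ∀ x ∈ seg (z + ε • m, z' + ε • m'), x ∈ seg t → m' = 0 ∧ x = z' by
    filter_upwards [this] with ε hε x hx hxQ
    obtain ⟨t, ht, hxt⟩ := hxQ
    exact hε t ht x hx hxt
  refine (Filter.eventually_all_finite (List.finite_toSet _)).2 fun t ht => ?_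
  have ht : t ∈ segs Q := ht
  by_cases ht0 : t = (z, z')
  · subst ht0
    filter_upwards [hpos] with ε hε x hx hxt
    exact left ε hε x hx (by rw [wedge_of_mem_seg hxt, mul_zero])
  by_cases ht1 : t.2 = z
  · obtain ⟨u, w⟩ := t
    obtain rfl : w = z := ht1
    -- Either the preceding segment avoids the open chosen side of the line through `w` and `z'`,
    -- where the shifted segment lies, or the polygonal line turns towards the chosen side. In the
    -- second case `z'` is strictly on the chosen side of the preceding segment, and that segment's
    -- line separates.
    by_cases hu : κ * wedge (z' - w) (u - w) ≤ 0
    · filter_upwards [hpos] with ε hε x hx hxt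
      exact left ε hε x hx (wedge_nonpos_of_mem_seg hxt hu (by simp))
    · have hc : ContinuousAt (fun ε : ℝ => κ * wedge (w - u) (z' + ε • m' - w)) 0 := by
        unfold wedge; fun_prop
      have h0 : 0 < κ * wedge (w - u) (z' + (0 : ℝ) • m' - w) := by
        rw [zero_smul, add_zero]
        have : wedge (w - u) (z' - w) = wedge (z' - w) (u - w) := by simp [wedge]; ring
        rw [this]; linarith
      filter_upwards [hpos, nhdsWithin_le_nhds (hc.eventually (lt_mem_nhds h0))] with ε hε h1 x hx hxt
      exfalso
      have hA : 0 < κ * wedge (w - u) (w + ε • m - w) := by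
        rw [add_sub_cancel_left, wedge_smul_right]
        have := mul_pos hε (hm.1 u ht); linarith
      have hx0 : wedge (w - u) (x - w) = 0 := by
        have := wedge_of_mem_seg hxt
        simp only at this
        rw [← this]; simp [wedge]; ring
      rcases wedge_pos_of_mem_seg hx hA h1.le with rfl | h
      · rw [hx0] at h1; simp at h1
      · rw [hx0] at h; simp at h
  by_cases ht2 : t.1 = z'
  · obtain ⟨w, u⟩ := t
    obtain rfl : w = z' := ht2
    have hm'' : LeftOf κ Q w m' := hm'.resolve_right fun h => h.2 u ht
    by_cases hu : κ * wedge (w - z) (u - z) ≤ 0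
    · filter_upwards [hpos] with ε hε x hx hxt
      exact left ε hε x hx (wedge_nonpos_of_mem_seg hxt (by simp) hu)
    · have hc : ContinuousAt (fun ε : ℝ => κ * wedge (u - w) (z + ε • m - w)) 0 := by
        unfold wedge; fun_prop
      have h0 : 0 < κ * wedge (u - w) (z + (0 : ℝ) • m - w) := by
        rw [zero_smul, add_zero]
        have : wedge (u - w) (z - w) = wedge (w - z) (u - z) := by simp [wedge]; ring
        rw [this]; linarith
      filter_upwards [hpos, nhdsWithin_le_nhds (hc.eventually (lt_mem_nhds h0))] with ε hε h1 x hx hxt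
      exfalso
      have hA : 0 < κ * wedge (u - w) (w + ε • m' - w) := by
        rw [add_sub_cancel_left, wedge_smul_right]
        have := mul_pos hε (hm''.2 u ht); linarith
      have hx0 : wedge (u - w) (x - w) = 0 := wedge_of_mem_seg hxt
      have hx' : x ∈ seg (w + ε • m', z + ε • m) := by rwa [← seg_swap]
      rcases wedge_pos_of_mem_seg hx' hA h1.le with rfl | h
      · rw [hx0] at h1; simp at h1
      · rw [hx0] at h; simp at h
  -- All other segments of a simple line are disjoint from this one, and remain so after a small
  -- shift.
  · have hn : ¬ Meet (z, z') t := by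
      rintro ⟨x, hx, hxt⟩
      rcases hQ.inter (z, z') hz t ht (Ne.symm ht0) x hx hxt with h | h
      · exact ht2 (h.2.symm.trans h.1)
      · exact ht1 (h.2.symm.trans h.1)
    have hc : ContinuousAt (fun ε : ℝ => ((z + ε • m, z' + ε • m'), t)) 0 := by fun_prop
    have := hc.eventually (isClosed_meet.isOpen_compl.eventually_mem (by simpa using hn))
    filter_upwards [nhdsWithin_le_nhds this] with ε hε x hx hxt
    exact absurd ⟨x, hx, hxt⟩ hε

/-! ### Inserting a point -/

section Insert

theorem eq_of_mem_seg_of_mem_seg {p q a x : Plane} (ha : a ∈ seg (p, q)) (h₁ : x ∈ seg (p, a))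
    (h₂ : x ∈ seg (a, q)) : x = a := by
  have h1 : Wbtw ℝ p a q := mem_segment_iff_wbtw.1 ha
  have h2 : Wbtw ℝ p x a := mem_segment_iff_wbtw.1 h₁
  have h3 : Wbtw ℝ a x q := mem_segment_iff_wbtw.1 h₂
  exact ((h1.trans_left_right h2).swap_left_iff.1 h3)

theorem eq_of_mem_seg_right {p q a : Plane} (ha : a ∈ seg (p, q)) (h₁ : q ∈ seg (p, a)) :
    a = q := by
  have h1 : Wbtw ℝ p a q := mem_segment_iff_wbtw.1 ha
  exact h1.swap_right_iff.1 (mem_segment_iff_wbtw.1 h₁)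

theorem eq_of_mem_seg_left {p q a : Plane} (ha : a ∈ seg (p, q)) (h₁ : p ∈ seg (a, q)) :
    a = p := by
  have h1 : Wbtw ℝ p a q := mem_segment_iff_wbtw.1 ha
  exact (h1.swap_left_iff.1 (mem_segment_iff_wbtw.1 h₁)).symm

theorem seg_eq_union {p q a : Plane} (ha : a ∈ seg (p, q)) :
    seg (p, q) = seg (p, a) ∪ seg (a, q) := by
  apply Subset.antisymm
  · intro x hx
    have hx' := hx
    obtain ⟨t, ht, rfl⟩ := mem_seg_iff.1 hx
    obtain ⟨s, hs, rfl⟩ := mem_seg_iff.1 ha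
    simp only
    rcases le_total t s with h | h
    · left
      rw [mem_seg_iff]
      rcases eq_or_lt_of_le hs.1 with h0 | h0
      · have : t = 0 := le_antisymm (h0 ▸ h) ht.1
        exact ⟨0, by simp, by simp [this]⟩
      · exact ⟨t / s, ⟨by have := ht.1; positivity, (div_le_one h0).2 h⟩, by
          rw [add_sub_cancel_left, smul_smul, div_mul_cancel₀ _ h0.ne']⟩
    · right
      rw [mem_seg_iff]
      rcases eq_or_lt_of_le hs.2 with h0 | h0
      · have : t = 1 := le_antisymm ht.2 (h0 ▸ h)
        exact ⟨1, by simp, by simp [this]⟩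
      · have h1 : 0 < 1 - s := by linarith
        refine ⟨(t - s) / (1 - s), ⟨div_nonneg (by linarith) h1.le,
          (div_le_one h1).2 (by linarith [ht.2])⟩, ?_⟩
        have : q - (p + s • (q - p)) = (1 - s) • (q - p) := by module
        simp only [this]
        rw [smul_smul, div_mul_cancel₀ _ h1.ne']
        module
  · exact union_subset (seg_subset_of_mem (left_mem_segment ..) ha)
      (seg_subset_of_mem ha (right_mem_segment ..))

variable {Q₁ Q₂ : List Plane} {p q a : Plane}

theorem segs_insert (Q₁ Q₂ : List Plane) (p q a : Plane) : segs (Q₁ ++ p :: a :: q :: Q₂) =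
    segs (Q₁ ++ [p]) ++ (p, a) :: (a, q) :: segs (q :: Q₂) := by
  rw [segs_append_cons_cons, segs_cons_cons]

theorem mem_segs_insert {t : Plane × Plane} (ht : t ∈ segs (Q₁ ++ p :: a :: q :: Q₂)) :
    (t ∈ segs (Q₁ ++ p :: q :: Q₂) ∧ (t ∈ segs (Q₁ ++ [p]) ∨ t ∈ segs (q :: Q₂))) ∨
      t = (p, a) ∨ t = (a, q) := by
  rw [segs_insert] at ht
  rw [segs_append_cons_cons]
  simp only [List.mem_append, List.mem_cons] at ht ⊢
  tauto

theorem img_insert (ha : a ∈ seg (p, q)) :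
    img (Q₁ ++ p :: a :: q :: Q₂) = img (Q₁ ++ p :: q :: Q₂) := by
  have h := seg_eq_union ha
  rw [img_append_cons, img_append_cons (m := q :: Q₂), img_cons_cons, img_cons_cons, img_cons_cons,
    ← union_assoc (segment ℝ p a)]
  change _ ∪ (seg (p, a) ∪ seg (a, q) ∪ _) = _ ∪ (seg (p, q) ∪ _)
  rw [h]

/-- Inserting a point adds at most the number of segments that contain it to the number of
crossings. -/
theorem cross_insert_le (ha : a ∈ seg (p, q)) (R : List Plane) :
    cross (Q₁ ++ p :: a :: q :: Q₂) R ≤ cross (Q₁ ++ p :: q :: Q₂) R + cross [a, a] R := by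
  simp only [cross]
  rw [segs_insert, segs_append_cons_cons, crossS_append, crossS_append, crossS_cons,
    crossS_cons (a, q), crossS_cons (p, q), segs_cons_cons, segs_singleton]
  have key : ∀ T, crossS [(p, a)] T + crossS [(a, q)] T ≤ crossS [(p, q)] T + crossS [(a, a)] T := by
    intro T
    simp only [crossS, List.map_cons, List.sum_cons, List.map_nil, List.sum_nil, add_zero]
    rw [← List.sum_map_add, ← List.sum_map_add]
    refine List.sum_le_sum fun t _ => ?_
    have hU := seg_eq_union ha
    by_cases h1 : Meet (p, a) t
    · by_cases h2 : Meet (a, q) t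
      · obtain ⟨y₁, hy₁, hy₁'⟩ := h1
        obtain ⟨y₂, hy₂, hy₂'⟩ := h2
        -- A segment that meets both halves contains the point between them, by convexity; only such
        -- segments are counted twice.
        have h3 : a ∈ seg (y₁, y₂) := by
          have w1 : Wbtw ℝ p a q := mem_segment_iff_wbtw.1 ha
          have w2 : Wbtw ℝ p y₁ a := mem_segment_iff_wbtw.1 hy₁
          have w3 : Wbtw ℝ a y₂ q := mem_segment_iff_wbtw.1 hy₂
          exact mem_segment_iff_wbtw.2 ((w1.trans_left_right w2).trans_right_left w3)
        have h4 : a ∈ seg t := seg_subset_of_mem hy₁' hy₂' h3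
        have m1 : meets (p, q) t = 1 := meets_eq_one ⟨y₁, hU ▸ Or.inl hy₁, hy₁'⟩
        have m2 : meets (a, a) t = 1 := meets_eq_one ⟨a, left_mem_segment .., h4⟩
        rw [m1, m2]
        exact add_le_add (meets_le_one _ _) (meets_le_one _ _)
      · rw [meets_eq_zero h2, add_zero]
        exact (meets_mono fun ⟨x, hx, hx'⟩ => ⟨x, hU ▸ Or.inl hx, hx'⟩).trans (Nat.le_add_right _ _)
    · rw [meets_eq_zero h1, zero_add]
      exact (meets_mono fun ⟨x, hx, hx'⟩ => ⟨x, hU ▸ Or.inr hx, hx'⟩).trans (Nat.le_add_right _ _)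
  have := key (segs R)
  omega

/-- Every listed point is an end of some segment, and another segment of a simple line can touch `s`
only at the ends of `s`. -/
theorem IsSimpleLine.notMem_of_mem_seg {Q : List Plane} (hQ : IsSimpleLine Q)
    {s : Plane × Plane} (hs : s ∈ segs Q) (ha : a ∈ seg s) (h₁ : a ≠ s.1) (h₂ : a ≠ s.2) :
    a ∉ Q := by
  intro h
  have hl : 2 ≤ Q.length := by
    obtain ⟨A, B, rfl⟩ := mem_segs_iff.1 hs
    simp only [List.length_append, List.length_cons]
    omega
  have key : ∀ t ∈ segs Q, (a = t.1 ∨ a = t.2) → False := by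
    intro t ht h
    by_cases hst : s = t
    · subst hst; tauto
    · have : a ∈ seg t := by
        rcases h with rfl | rfl
        exacts [left_mem_segment .., right_mem_segment ..]
      rcases hQ.inter s hs t ht hst a ha this with h | h
      · exact h₂ h.1
      · exact h₁ h.1
  by_cases hlast : Q.getLast? = some a
  · obtain ⟨b, hb⟩ := exists_mem_segs_right h (by
      intro hh
      cases Q with
      | nil => simp at hl
      | cons x Q =>
        simp at hh
        subst hh
        have := hQ.nodup
        rw [List.nodup_cons] at this
        rcases List.eq_nil_or_concat Q with rfl | ⟨m, c, rfl⟩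
        · simp at hl
        · simp [List.getLast?_cons] at hlast
          simp [hlast] at this)
    exact key _ hb (Or.inr rfl)
  · obtain ⟨b, hb⟩ := exists_mem_segs_left h hlast
    exact key _ hb (Or.inl rfl)

theorem IsSimpleLine.insert_point (hQ : IsSimpleLine (Q₁ ++ p :: q :: Q₂)) (ha : a ∈ seg (p, q))
    (h₁ : a ≠ p) (h₂ : a ≠ q) : IsSimpleLine (Q₁ ++ p :: a :: q :: Q₂) := by
  have hpq : (p, q) ∈ segs (Q₁ ++ p :: q :: Q₂) := mem_segs_iff.2 ⟨_, _, rfl⟩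
  have hU := seg_eq_union ha
  have hn := hQ.notMem_of_mem_seg hpq ha h₁ h₂
  have hne : ∀ t, t ∈ segs (Q₁ ++ [p]) ∨ t ∈ segs (q :: Q₂) → (p, q) ≠ t := by
    have := segs_nodup hQ.nodup
    rw [segs_append_cons_cons] at this
    simp only [List.nodup_append, List.nodup_cons] at this
    rintro t (h | h) rfl
    · exact this.2.2 _ h _ (List.mem_cons_self ..) rfl
    · exact this.2.1.1 h
  have c1 : ∀ t ∈ segs (Q₁ ++ p :: q :: Q₂), (p, q) ≠ t → ∀ x, x ∈ seg (p, a) → x ∈ seg t →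
      x = p ∧ x = t.2 := by
    intro t ht htn x hx hxt
    rcases hQ.inter _ hpq t ht htn x (hU ▸ Or.inl hx) hxt with h | h
    · obtain ⟨rfl, -⟩ := h
      exact absurd (eq_of_mem_seg_right ha hx) h₂
    · exact h
  have c2 : ∀ t ∈ segs (Q₁ ++ p :: q :: Q₂), (p, q) ≠ t → ∀ x, x ∈ seg (a, q) → x ∈ seg t →
      x = q ∧ x = t.1 := by
    intro t ht htn x hx hxt
    rcases hQ.inter _ hpq t ht htn x (hU ▸ Or.inr hx) hxt with h | h
    · exact h
    · obtain ⟨rfl, -⟩ := h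
      exact absurd (eq_of_mem_seg_left ha hx) h₁
  constructor
  · have : (a :: (Q₁ ++ p :: q :: Q₂)).Nodup := List.nodup_cons.2 ⟨hn, hQ.nodup⟩
    have hp : (Q₁ ++ p :: a :: q :: Q₂).Perm (a :: (Q₁ ++ p :: q :: Q₂)) := by
      have h1 : Q₁ ++ p :: a :: q :: Q₂ = (Q₁ ++ [p]) ++ a :: (q :: Q₂) := by simp
      have h2 : Q₁ ++ p :: q :: Q₂ = (Q₁ ++ [p]) ++ (q :: Q₂) := by simp
      rw [h1, h2]
      exact List.perm_middle
    exact hp.nodup_iff.2 this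
  · intro s hs t ht hst x hxs hxt
    rcases mem_segs_insert hs with ⟨hs, hs'⟩ | rfl | rfl <;>
      rcases mem_segs_insert ht with ⟨ht, ht'⟩ | rfl | rfl
    · exact hQ.inter s hs t ht hst x hxs hxt
    · have := c1 s hs (hne s hs') x hxt hxs
      exact Or.inl ⟨this.2, this.1⟩
    · have := c2 s hs (hne s hs') x hxt hxs
      exact Or.inr ⟨this.2, this.1⟩
    · have := c1 t ht (hne t ht') x hxs hxt
      exact Or.inr ⟨this.1, this.2⟩
    · exact absurd rfl hst
    · have := eq_of_mem_seg_of_mem_seg ha hxs hxt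
      exact Or.inl ⟨this, this⟩
    · have := c2 t ht (hne t ht') x hxs hxt
      exact Or.inl ⟨this.1, this.2⟩
    · have := eq_of_mem_seg_of_mem_seg ha hxt hxs
      exact Or.inr ⟨this, this⟩
    · exact absurd rfl hst

theorem exists_pos_smul_of_mem_seg (ha : a ∈ seg (p, q)) (h₁ : a ≠ p) (h₂ : a ≠ q) :
    (∃ c > (0 : ℝ), a - p = c • (q - p)) ∧ ∃ c > (0 : ℝ), q - a = c • (q - p) := by
  obtain ⟨t, ht, rfl⟩ := mem_seg_iff.1 ha
  simp only at *
  have ht0 : t ≠ 0 := by rintro rfl; simp at h₁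
  have ht1 : t ≠ 1 := by rintro rfl; simp at h₂
  refine ⟨⟨t, lt_of_le_of_ne ht.1 ht0.symm, by module⟩, ⟨1 - t, ?_, by module⟩⟩
  have := lt_of_le_of_ne ht.2 ht1
  linarith

/-- Both halves of the divided segment are positive multiples of the whole, so the signs do not
change. -/
theorem LeftOf.insert_point (ha : a ∈ seg (p, q)) (h₁ : a ≠ p) (h₂ : a ≠ q) {κ : ℝ} {z m : Plane}
    (hz : z ≠ a) (h : LeftOf κ (Q₁ ++ p :: q :: Q₂) z m) :
    LeftOf κ (Q₁ ++ p :: a :: q :: Q₂) z m := by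
  have hpq : (p, q) ∈ segs (Q₁ ++ p :: q :: Q₂) := mem_segs_iff.2 ⟨_, _, rfl⟩
  obtain ⟨⟨c, hc, e1⟩, ⟨c', hc', e2⟩⟩ := exists_pos_smul_of_mem_seg ha h₁ h₂
  constructor
  · intro u hu
    rcases mem_segs_insert hu with ⟨hu, -⟩ | hu | hu
    · exact h.1 u hu
    · simp only [Prod.mk.injEq] at hu; exact absurd hu.2 hz
    · simp only [Prod.mk.injEq] at hu
      obtain ⟨rfl, rfl⟩ := hu
      rw [e2, wedge_smul_left]
      have := mul_pos hc' (h.1 p hpq); linarith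
  · intro u hu
    rcases mem_segs_insert hu with ⟨hu, -⟩ | hu | hu
    · exact h.2 u hu
    · simp only [Prod.mk.injEq] at hu
      obtain ⟨rfl, rfl⟩ := hu
      rw [e1, wedge_smul_left]
      have := mul_pos hc (h.2 q hpq); linarith
    · simp only [Prod.mk.injEq] at hu; exact absurd hu.1 hz

theorem leftOf_inserted (hn : a ∉ Q₁ ++ p :: q :: Q₂) (ha : a ∈ seg (p, q)) (h₁ : a ≠ p)
    (h₂ : a ≠ q) {κ : ℝ} {m : Plane} (h : 0 < κ * wedge (q - p) m) :
    LeftOf κ (Q₁ ++ p :: a :: q :: Q₂) a m := by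
  obtain ⟨⟨c, hc, e1⟩, ⟨c', hc', e2⟩⟩ := exists_pos_smul_of_mem_seg ha h₁ h₂
  constructor
  · intro u hu
    rcases mem_segs_insert hu with ⟨hu, -⟩ | hu | hu
    · exact absurd (right_mem_of_mem_segs hu) hn
    · simp only [Prod.mk.injEq] at hu
      obtain ⟨rfl, -⟩ := hu
      rw [e1, wedge_smul_left]
      have := mul_pos hc h; linarith
    · simp only [Prod.mk.injEq] at hu; exact absurd hu.2 h₂
  · intro u hu
    rcases mem_segs_insert hu with ⟨hu, -⟩ | hu | hu
    · exact absurd (left_mem_of_mem_segs hu) hn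
    · simp only [Prod.mk.injEq] at hu; exact absurd hu.1 h₁
    · simp only [Prod.mk.injEq] at hu
      obtain ⟨-, rfl⟩ := hu
      rw [e2, wedge_smul_left]
      have := mul_pos hc' h; linarith

end Insert

/-! ### Rerouting one line along a parallel copy of another -/

theorem crossS_single_lt {s s' : Plane × Plane} {T : List (Plane × Plane)}
    (h : ∀ t ∈ T, Meet s t → Meet s' t) {t : Plane × Plane} (ht : t ∈ T) (h₁ : ¬ Meet s t)
    (h₂ : Meet s' t) : crossS [s] T + 1 ≤ crossS [s'] T := by
  obtain ⟨A, B, rfl⟩ := List.append_of_mem ht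
  rw [crossS_comm, crossS_comm [s'], crossS_append, crossS_append, crossS_cons, crossS_cons t B]
  have e1 : crossS A [s] ≤ crossS A [s'] := by
    rw [crossS_comm, crossS_comm A]
    exact crossS_single_mono _ fun t ht => h t (by simp [ht])
  have e2 : crossS B [s] ≤ crossS B [s'] := by
    rw [crossS_comm, crossS_comm B]
    exact crossS_single_mono _ fun t ht => h t (by simp [ht])
  have e3 : crossS [t] [s] = 0 := crossS_eq_zero.2 (by
    simp only [List.mem_singleton, forall_eq]; exact fun hh => h₁ hh.symm)
  have e4 : 1 ≤ crossS [t] [s'] := one_le_crossS (List.mem_singleton_self _)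
    (List.mem_singleton_self _) h₂.symm
  omega

theorem notMem_segs_of_getLast? {α : Type*} {l : List α} (hl : l.Nodup) {b : α}
    (hb : l.getLast? = some b) (u : α) : (b, u) ∉ segs l := by
  intro h
  obtain ⟨C, D, rfl⟩ := mem_segs_iff.1 h
  simp only [List.nodup_append, List.nodup_cons] at hl
  refine hl.2.1.1 (List.mem_of_getLast? ?_)
  simpa [List.getLast?_append, List.getLast?_cons] using hb

theorem notMem_segs_of_head? {α : Type*} {l : List α} (hl : l.Nodup) {b : α}
    (hb : l.head? = some b) (u : α) : (u, b) ∉ segs l := by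
  intro h
  refine notMem_segs_of_getLast? (List.nodup_reverse.2 hl) (b := b) (by simpa) u ?_
  exact swap_mem_segs_reverse.2 h

theorem cross_three (A₁ β A₂ R : List Plane) (x a b : Plane) :
    cross (A₁ ++ x :: (a :: β ++ [b]) ++ A₂) R =
      cross (A₁ ++ [x, a]) R + cross (a :: β ++ [b]) R + cross (b :: A₂) R := by
  have h1 : A₁ ++ x :: (a :: β ++ [b]) ++ A₂ = (A₁ ++ [x]) ++ a :: ((β ++ [b]) ++ A₂) := by simp
  have h2 : a :: ((β ++ [b]) ++ A₂) = (a :: β) ++ b :: A₂ := by simp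
  have h3 : A₁ ++ [x] ++ [a] = A₁ ++ [x, a] := by simp
  rw [h1, cross_append_cons, h2, cross_append_cons (a :: β), h3, add_assoc]

theorem LeftOf.ne_zero_right {κ : ℝ} {Q : List Plane} {u z m : Plane} (h : LeftOf κ Q z m)
    (hu : (u, z) ∈ segs Q) : m ≠ 0 := by
  rintro rfl
  have := h.1 u hu
  simp at this

/-- The parallel copy of a part of a simple line can be used as a detour. -/
theorem exists_reroute {Q Q' : List Plane} (hQ' : IsSimpleLine Q')
    (himg : img Q' = img Q) {A₁ A₂ B₁ B₂ β : List Plane} {a b x : Plane}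
    (hB : Q' = B₁ ++ (a :: β ++ [b]) ++ B₂) {κ : ℝ}
    (hβ : ∀ z ∈ β, ∃ m, LeftOf κ Q' z m) (ha : LeftOf κ Q' a (x - a))
    (hb : (A₂ = [] ∧ B₂ = [] ∧ cross [b, b] Q ≤ 1) ∨ (A₂ ≠ [] ∧ ∃ m, LeftOf κ Q' b m))
    {t : Plane × Plane} (ht : t ∈ segs Q) (hat : a ∈ seg t) (hx : wedge (t.2 - t.1) (x - a) ≠ 0)
    {𝓡 : Set (List Plane)} (h𝓡 : 𝓡.Finite) :
    ∃ γ, (A₁ ++ x :: γ ++ A₂).getLast? = (A₁ ++ x :: (a :: β ++ [b]) ++ A₂).getLast? ∧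
      (∀ R ∈ 𝓡, cross (A₁ ++ x :: γ ++ A₂) R ≤
        cross (A₁ ++ [x, a]) R + cross (a :: β ++ [b]) R + cross (b :: A₂) R) ∧
      cross (A₁ ++ x :: γ ++ A₂) Q + 1 ≤
        cross (A₁ ++ [x, a]) Q + cross (b :: A₂) Q + (if A₂ = [] then 1 else 0) := by
  classical
  set core := a :: β ++ [b] with hcore
  have hsub : ∀ s ∈ segs core, s ∈ segs Q' := by
    intro s hs
    obtain ⟨C, D, h⟩ := mem_segs_iff.1 hs
    exact mem_segs_iff.2 ⟨B₁ ++ C, D ++ B₂, by rw [hB, h]; simp⟩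
  have hnc : core.Nodup := by
    have := hQ'.nodup
    rw [hB] at this
    exact (List.nodup_append.1 (List.nodup_append.1 this).1).2.1
  have hbab : b ∉ a :: β := by
    rw [hcore, List.nodup_append] at hnc
    exact fun h => hnc.2.2 b h b (by simp) rfl
  have haβ : a ∉ β := by
    rw [hcore, List.cons_append, List.nodup_cons] at hnc
    exact fun h => hnc.1 (by simp [h])
  -- the shift vectors
  obtain ⟨μ, hμa, hμ, hμb⟩ : ∃ μ : Plane → Plane, μ a = x - a ∧ (∀ z ∈ a :: β, LeftOf κ Q' z (μ z)) ∧
      ((A₂ = [] ∧ B₂ = [] ∧ cross [b, b] Q ≤ 1 ∧ μ b = 0) ∨ (A₂ ≠ [] ∧ LeftOf κ Q' b (μ b))) := by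
    choose! μ₀ hμ₀ using hβ
    obtain ⟨mb, hmb⟩ : ∃ mb, (A₂ = [] ∧ B₂ = [] ∧ cross [b, b] Q ≤ 1 ∧ mb = 0) ∨
        (A₂ ≠ [] ∧ LeftOf κ Q' b mb) := by
      rcases hb with h | ⟨h, m, hm⟩
      · exact ⟨0, Or.inl ⟨h.1, h.2.1, h.2.2, rfl⟩⟩
      · exact ⟨m, Or.inr ⟨h, hm⟩⟩
    have hba : b ≠ a := fun h => hbab (by simp [h])
    refine ⟨fun z => if z = a then x - a else if z = b then mb else μ₀ z, by simp, ?_, ?_⟩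
    · intro z hz
      rcases List.mem_cons.1 hz with rfl | hz
      · simpa using ha
      · have h1 : z ≠ a := fun h => haβ (h ▸ hz)
        have h2 : z ≠ b := fun h => hbab (by simp [← h, hz])
        simpa [h1, h2] using hμ₀ z hz
    · simpa [hba] using hmb
  have hlast : A₂ = [] → ∀ u, (b, u) ∉ segs Q' := by
    intro hA u hu
    have hB₂ : B₂ = [] := by
      rcases hμb with h | h
      exacts [h.2.1, absurd hA h.1]
    refine notMem_segs_of_getLast? hQ'.nodup ?_ u hu
    rw [hB, hB₂, List.append_nil, hcore, ← List.append_assoc, List.getLast?_concat]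
  have hgood : ∀ s ∈ segs core, LeftOf κ Q' s.1 (μ s.1) ∧
      (LeftOf κ Q' s.2 (μ s.2) ∨ (μ s.2 = 0 ∧ ∀ u, (s.2, u) ∉ segs Q')) ∧
      (s.2 ∈ a :: β ∨ s.2 = b) := by
    intro s hs
    have m1 : s.1 ∈ a :: β := by
      have h1 := left_mem_of_mem_segs hs
      rw [hcore, List.mem_append, List.mem_singleton] at h1
      refine h1.resolve_right fun h => ?_
      exact notMem_segs_of_getLast? hnc (b := s.1) (by rw [hcore, h, List.getLast?_concat]) s.2 hs
    have m2 : s.2 ∈ a :: β ∨ s.2 = b := by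
      have h1 := right_mem_of_mem_segs hs
      rwa [hcore, List.mem_append, List.mem_singleton] at h1
    refine ⟨hμ _ m1, ?_, m2⟩
    rcases m2 with m2 | m2
    · exact Or.inl (hμ _ m2)
    · rw [m2]
      rcases hμb with h | h
      · exact Or.inr ⟨h.2.2.2, hlast h.1⟩
      · exact Or.inl h.2
  -- The detour is the core moved by a small multiple of `μ`. At `a` the shift vector points back to
  -- `x`, so the detour branches off from the segment from `x` to `a` just before `a`.
  let F : ℝ → Plane → Plane := fun ε z => z + ε • μ z

  have hshift : ∀ᶠ ε : ℝ in 𝓝[>] 0, ∀ s ∈ {s | s ∈ segs core}, ∀ y ∈ seg (F ε s.1, F ε s.2),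
      y ∈ img Q' → μ s.2 = 0 ∧ y = s.2 := by
    refine (Filter.eventually_all_finite (List.finite_toSet _)).2 fun s hs => ?_
    obtain ⟨h1, h2, -⟩ := hgood s hs
    exact eventually_shift_seg hQ' (hsub s hs) h1 h2
  have husc : ∀ P S R : List Plane, ∀ᶠ ε : ℝ in 𝓝[>] 0,
      cross (P ++ S.map (F ε) ++ A₂) R ≤ cross (P ++ S ++ A₂) R := by
    intro P S R
    have h := eventually_cross_le (A := ℝ) (a₀ := 0) (F := 𝓝[>] 0) nhdsWithin_le_nhds
      (L := P.map (fun p _ => p) ++ S.map (fun z ε => F ε z) ++ A₂.map (fun p _ => p))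
      (M := R.map (fun p _ => p)) (by
        intro φ hφ
        simp only [List.mem_append, List.mem_map] at hφ
        rcases hφ with (⟨p, -, rfl⟩ | ⟨p, -, rfl⟩) | ⟨p, -, rfl⟩
        · fun_prop
        · simp only [F]; fun_prop
        · fun_prop) (by
        intro φ hφ
        obtain ⟨p, -, rfl⟩ := List.mem_map.1 hφ
        fun_prop)
    filter_upwards [h] with ε hε
    simpa [List.map_append, List.map_map, Function.comp_def, F] using hε
  have hall : ∀ᶠ ε : ℝ in 𝓝[>] 0, ∀ R ∈ 𝓡,
      cross ((A₁ ++ [x]) ++ core.map (F ε) ++ A₂) R ≤ cross ((A₁ ++ [x]) ++ core ++ A₂) R :=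
    (Filter.eventually_all_finite h𝓡).2 fun R _ => husc _ _ R
  have hsmall : ∀ᶠ ε : ℝ in 𝓝[>] 0, ε ∈ Ioo (0 : ℝ) 1 := Ioo_mem_nhdsGT one_pos
  obtain ⟨ε, hε, h1, h2, h3⟩ := (hsmall.and (hshift.and (hall.and (husc [] [b] Q)))).exists
  have hcε : core.map (F ε) = F ε a :: β.map (F ε) ++ [F ε b] := by simp [hcore]
  refine ⟨core.map (F ε), ?_, ?_, ?_⟩
  · by_cases hA : A₂ = []
    · have hb0 : μ b = 0 := by
        rcases hμb with h | h
        exacts [h.2.2.2, absurd hA h.1]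
      have : F ε b = b := by simp [F, hb0]
      rw [hcε, hA, this, List.append_nil, List.append_nil, List.getLast?_append,
        List.getLast?_append, hcore]
      simp only [← List.cons_append, List.getLast?_concat, Option.some_or]
    · obtain ⟨y, A, rfl⟩ := List.exists_cons_of_ne_nil hA
      rw [List.getLast?_append, List.getLast?_append]
      simp [List.getLast?_cons]
  · intro R hR
    have := h2 R hR
    have e1 : A₁ ++ x :: core.map (F ε) ++ A₂ = (A₁ ++ [x]) ++ core.map (F ε) ++ A₂ := by simp
    have e2 : (A₁ ++ [x]) ++ core ++ A₂ = A₁ ++ x :: core ++ A₂ := by simp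
    rw [e1]
    refine this.trans ?_
    rw [e2, hcore, cross_three]
  · rw [hcε, cross_three, ← hcε]
    have k3 : cross (F ε b :: A₂) Q ≤ cross (b :: A₂) Q := by
      simpa using h3
    -- The shortened segment stops before `a`, the only point that it could share with `t`. This is
    -- the crossing that is gained.
    have k1 : cross (A₁ ++ [x, F ε a]) Q + 1 ≤ cross (A₁ ++ [x, a]) Q := by
      simp only [cross]
      rw [segs_concat_concat, segs_concat_concat, crossS_append, crossS_append, add_assoc]
      have hFa : F ε a = a + ε • (x - a) := by simp [F, hμa]
      have hmem : F ε a ∈ seg (x, a) := by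
        rw [← seg_swap, mem_seg_iff]
        exact ⟨ε, ⟨hε.1.le, hε.2.le⟩, hFa⟩
      have hxa : x ≠ a := by rintro rfl; simp at hx
      have hFne : F ε a ≠ a := by
        rw [hFa]; simp [hε.1.ne', sub_ne_zero.2 hxa]
      have hsubset : seg (x, F ε a) ⊆ seg (x, a) := seg_subset_of_mem (left_mem_segment ..) hmem
      refine Nat.add_le_add_left (crossS_single_lt (fun t _ ⟨y, hy, hy'⟩ => ⟨y, hsubset hy, hy'⟩) ht
        ?_ ⟨a, right_mem_segment .., hat⟩) _
      rintro ⟨y, hy, hy'⟩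
      have hya : y = a := by
        refine eq_of_mem_seg (s := t) (t := (x, a)) ?_ hy' (hsubset hy) hat (right_mem_segment ..)
        have : a - x = -(x - a) := by abel
        simp only
        rw [this, wedge_neg_right]; simpa using hx
      subst hya
      exact hFne (eq_of_mem_seg_right hmem hy)
    -- The shifted core misses `Q`, unless it ends at the unmoved point `b`; then its last segment
    -- still meets `Q`, but only there.
    have k2 : cross (core.map (F ε)) Q ≤ if A₂ = [] then 1 else 0 := by
      have hz : ∀ s ∈ segs core, μ s.2 ≠ 0 → ∀ t ∈ segs Q, ¬ Meet (Prod.map (F ε) (F ε) s) t := by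
        rintro s hs h0 t ht ⟨y, hy, hy'⟩
        exact h0 (h1 s hs y hy (himg ▸ ⟨t, ht, hy'⟩)).1
      by_cases hA : A₂ = []
      · rw [if_pos hA]
        obtain ⟨γ, w, hγ⟩ : ∃ γ w, a :: β = γ ++ [w] := by
          rcases List.eq_nil_or_concat (a :: β) with h | ⟨γ, w, h⟩
          · simp at h
          · exact ⟨γ, w, by simpa using h⟩
        have hcw : core = γ ++ [w, b] := by rw [hcore, hγ]; simp
        have hb1 : cross [b, b] Q ≤ 1 := by
          rcases hμb with h | h
          exacts [h.2.2.1, absurd hA h.1]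
        simp only [cross]
        rw [segs_map, hcw, segs_concat_concat, List.map_append, crossS_append]
        have z1 : crossS ((segs (γ ++ [w])).map (Prod.map (F ε) (F ε))) (segs Q) = 0 := by
          rw [crossS_eq_zero]
          intro s' hs' t ht
          obtain ⟨s, hs, rfl⟩ := List.mem_map.1 hs'
          have hsc : s ∈ segs core := by
            rw [hcw, segs_concat_concat]; exact List.mem_append_left _ hs
          refine hz s hsc ?_ t ht
          have := right_mem_of_mem_segs hs
          rw [← hγ] at this
          exact (hμ _ this).ne_zero_right (hsub _ hsc)
        rw [z1, zero_add]
        refine le_trans ?_ hb1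
        simp only [cross, segs_cons_cons, segs_singleton, List.map_cons, List.map_nil]
        refine crossS_single_mono _ fun t ht => ?_
        rintro ⟨y, hy, hy'⟩
        have := h1 (w, b) (by rw [mem_ofPred_eq, hcw, segs_concat_concat]; simp) y hy
          (himg ▸ ⟨t, ht, hy'⟩)
        exact ⟨y, by rw [this.2]; exact left_mem_segment .., hy'⟩
      · rw [if_neg hA, Nat.le_zero]
        simp only [cross]
        rw [segs_map, crossS_eq_zero]
        intro s' hs' t ht
        obtain ⟨s, hs, rfl⟩ := List.mem_map.1 hs'
        refine hz s hs ?_ t ht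
        rcases (hgood s hs).2.1 with h | h
        · exact h.ne_zero_right (hsub _ hs)
        · rcases (hgood s hs).2.2 with h' | h'
          · exact (hμ _ h').ne_zero_right (hsub _ hs)
          · rcases hμb with h'' | h''
            · exact absurd h''.1 hA
            · rw [h']
              exact h''.2.ne_zero_right (u := s.1) (by rw [← h']; exact hsub _ hs)
    omega

theorem LeftOf.reverse {κ : ℝ} {Q : List Plane} {z m : Plane} (h : LeftOf (-κ) Q z m) :
    LeftOf κ Q.reverse z m := by
  constructor
  · intro u hu
    have := h.2 u (swap_mem_segs_reverse.1 (by simpa using hu))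
    rw [← neg_sub z u, ← neg_one_smul ℝ (z - u), wedge_smul_left] at this
    linarith
  · intro u hu
    have := h.1 u (swap_mem_segs_reverse.1 (by simpa using hu))
    rw [← neg_sub u z, ← neg_one_smul ℝ (u - z), wedge_smul_left] at this
    linarith

/-- Every point of the polygonal line can be moved to both sides of the line. -/
def TwoSided (P : List Plane) : Prop := ∀ z ∈ P, ∀ κ : ℝ, κ ≠ 0 → ∃ m, LeftOf κ P z m

theorem TwoSided.reverse {P : List Plane} (h : TwoSided P) : TwoSided P.reverse := by
  intro z hz κ hk
  obtain ⟨m, hm⟩ := h z (by simpa using hz) (-κ) (neg_ne_zero.2 hk)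
  exact ⟨m, hm.reverse⟩

/-- The polygonal line runs at `a` along the segment `s`. -/
structure RunsAlong (P : List Plane) (a : Plane) (s : Plane × Plane) : Prop where
  mem : a ∈ seg s
  nbr : ∀ u, (u, a) ∈ segs P ∨ (a, u) ∈ segs P → u ∈ seg s
  left : ∀ m, wedge (s.2 - s.1) m ≠ 0 → ∀ κ : ℝ, κ ≠ 0 → ∃ c : ℝ, LeftOf κ P a (c • m)

theorem RunsAlong.reverse {P : List Plane} {a : Plane} {s : Plane × Plane} (h : RunsAlong P a s) :
    RunsAlong P.reverse a s := by
  refine ⟨h.mem, fun u hu => h.nbr u ?_, fun m hm κ hk => ?_⟩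
  · rcases hu with hu | hu
    · exact Or.inr (swap_mem_segs_reverse.1 (by simpa using hu))
    · exact Or.inl (swap_mem_segs_reverse.1 (by simpa using hu))
  · obtain ⟨c, hc⟩ := h.left m hm (-κ) (neg_ne_zero.2 hk)
    exact ⟨c, hc.reverse⟩

/-- The inserted point is interior to its segment, so both its neighbours lie on that segment and
the line runs straight through it. The last clause allows a second point to be inserted without
losing this information about the first one. -/
theorem exists_insert {P : List Plane} (hP : IsSimpleLine P) (hL : TwoSided P) {a : Plane}
    (ha : a ∈ img P) (han : a ∉ P) : ∃ P', IsSimpleLine P' ∧ img P' = img P ∧ P'.head? = P.head? ∧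
      P'.getLast? = P.getLast? ∧ TwoSided P' ∧ (∀ z, z ∈ P' ↔ z = a ∨ z ∈ P) ∧
      (∀ R, cross P' R ≤ cross P R + cross [a, a] R) ∧
      (∀ s ∈ segs P, a ∈ seg s → RunsAlong P' a s) ∧
      (∀ z s, z ≠ a → RunsAlong P z s → RunsAlong P' z s) := by
  obtain ⟨⟨p, q⟩, hs, has⟩ := ha
  have h1 : a ≠ p := fun h => han (h ▸ left_mem_of_mem_segs hs)
  have h2 : a ≠ q := fun h => han (h ▸ right_mem_of_mem_segs hs)
  have hp := hP
  obtain ⟨Q₁, Q₂, rfl⟩ := mem_segs_iff.1 hs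
  simp only at *
  have hmem : ∀ z, z ∈ Q₁ ++ p :: a :: q :: Q₂ ↔ z = a ∨ z ∈ Q₁ ++ p :: q :: Q₂ := by
    intro z; simp only [List.mem_append, List.mem_cons]; tauto
  have hruns : RunsAlong (Q₁ ++ p :: a :: q :: Q₂) a (p, q) := by
    refine ⟨has, ?_, ?_⟩
    · rintro u (hu | hu)
      · rcases mem_segs_insert hu with ⟨hu, -⟩ | hu | hu
        · exact absurd (right_mem_of_mem_segs hu) han
        · simp only [Prod.mk.injEq] at hu; rw [hu.1]; exact left_mem_segment ..
        · simp only [Prod.mk.injEq] at hu; exact absurd hu.2 h2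
      · rcases mem_segs_insert hu with ⟨hu, -⟩ | hu | hu
        · exact absurd (left_mem_of_mem_segs hu) han
        · simp only [Prod.mk.injEq] at hu; exact absurd hu.1 h1
        · simp only [Prod.mk.injEq] at hu; rw [hu.2]; exact right_mem_segment ..
    · intro m hm κ hk
      refine ⟨κ * wedge (q - p) m, leftOf_inserted han has h1 h2 ?_⟩
      rw [wedge_smul_right]
      have : κ * (κ * wedge (q - p) m * wedge (q - p) m) = (κ * wedge (q - p) m) ^ 2 := by ring
      rw [this]
      have := mul_ne_zero hk hm
      positivity
  refine ⟨Q₁ ++ p :: a :: q :: Q₂, hp.insert_point has h1 h2, img_insert has, ?_, ?_, ?_, hmem,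
    cross_insert_le has, ?_, ?_⟩
  · cases Q₁ <;> simp
  · simp [List.getLast?_append, List.getLast?_cons]
  · intro z hz κ hk
    by_cases hza : z = a
    · subst hza
      obtain ⟨m, hm⟩ := exists_wedge_pos (d := q - p) (sub_ne_zero.2 (ne_of_mem_segs hp.nodup hs).symm) hk
      exact ⟨m, leftOf_inserted han has h1 h2 hm⟩
    · obtain ⟨m, hm⟩ := hL z (((hmem z).1 hz).resolve_left hza) κ hk
      exact ⟨m, hm.insert_point has h1 h2 hza⟩
  · intro s hs' has'
    by_cases hst : s = (p, q)
    · rw [hst]; exact hruns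
    · exfalso
      rcases hp.inter s hs' (p, q) hs hst a has' has with h | h
      · exact h1 h.2
      · exact h2 h.2
  · intro z s hza hz
    refine ⟨hz.mem, ?_, fun m hm κ hk => ?_⟩
    · rintro u (hu | hu)
      · rcases mem_segs_insert hu with ⟨hu, -⟩ | hu | hu
        · exact hz.nbr u (Or.inl hu)
        · simp only [Prod.mk.injEq] at hu; exact absurd hu.2 hza
        · simp only [Prod.mk.injEq] at hu
          obtain ⟨rfl, rfl⟩ := hu
          exact seg_subset_of_mem (hz.nbr p (Or.inl hs)) hz.mem has
      · rcases mem_segs_insert hu with ⟨hu, -⟩ | hu | hu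
        · exact hz.nbr u (Or.inr hu)
        · simp only [Prod.mk.injEq] at hu
          obtain ⟨rfl, rfl⟩ := hu
          exact seg_subset_of_mem hz.mem (hz.nbr q (Or.inr hs)) has
        · simp only [Prod.mk.injEq] at hu; exact absurd hu.1 hza
    · obtain ⟨c, hc⟩ := hz.left m hm κ hk
      exact ⟨c, hc.insert_point has h1 h2 hza⟩

/-- A simple line through `a` and `b`, with `a` and `b` inserted and oriented from `a` to `b`. -/
theorem exists_strand {P : List Plane} (hP : IsSimpleLine P) (hL : TwoSided P) {a b : Plane}
    (hab : a ≠ b) {s : Plane × Plane} (hs : s ∈ segs P) (has : a ∈ seg s) (haP : a ∉ P)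
    (hb : (b ∉ P ∧ b ∈ img P) ∨ P.head? = some b ∨ P.getLast? = some b) :
    ∃ P₀ P' A₁ x α A₂, P' = A₁ ++ x :: (a :: α ++ [b]) ++ A₂ ∧ (P₀ = P ∨ P₀ = P.reverse) ∧
      IsSimpleLine P' ∧ img P' = img P ∧ P'.head? = P₀.head? ∧ P'.getLast? = P₀.getLast? ∧
      TwoSided P' ∧ x ∈ seg s ∧ x ≠ a ∧ RunsAlong P' a s ∧ (A₂ = [] ↔ b ∈ P) ∧
      ∀ R, cross P' R ≤ cross P R + cross [a, a] R + (if A₂ = [] then 0 else cross [b, b] R) := by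
  obtain ⟨P₁, k1, k2, k3, k4, k5, k6, k7, k8, -⟩ := exists_insert hP hL ⟨s, hs, has⟩ haP
  obtain ⟨P₂, q1, q2, q3, q4, q5, q6, q7, q8, q9⟩ : ∃ P₂, IsSimpleLine P₂ ∧ img P₂ = img P ∧
      P₂.head? = P.head? ∧ P₂.getLast? = P.getLast? ∧ TwoSided P₂ ∧ a ∈ P₂ ∧ b ∈ P₂ ∧
      (∀ R, cross P₂ R ≤ cross P R + cross [a, a] R + (open Classical in if b ∈ P then 0 else cross [b, b] R)) ∧
      RunsAlong P₂ a s := by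
    by_cases hbP : b ∈ P
    · refine ⟨P₁, k1, k2, k3, k4, k5, (k6 a).2 (Or.inl rfl), (k6 b).2 (Or.inr hbP), ?_, k8 s hs has⟩
      intro R; simpa [hbP] using k7 R
    · have hbi : b ∈ img P := by
        rcases hb with h | h | h
        · exact h.2
        · exact absurd (List.mem_of_head? h) hbP
        · exact absurd (List.mem_of_getLast? h) hbP
      have hb1 : b ∉ P₁ := by rw [k6]; tauto
      obtain ⟨P₂, m1, m2, m3, m4, m5, m6, m7, -, m9⟩ := exists_insert k1 k5 (k2 ▸ hbi) hb1
      refine ⟨P₂, m1, m2.trans k2, m3.trans k3, m4.trans k4, m5, ?_, ?_, ?_, m9 a s hab (k8 s hs has)⟩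
      · exact (m6 a).2 (Or.inr ((k6 a).2 (Or.inl rfl)))
      · exact (m6 b).2 (Or.inl rfl)
      · intro R
        rw [if_neg hbP]
        have := m7 R
        have := k7 R
        omega
  -- orientation
  obtain ⟨P₀, P', A, α, A₂, h0, h1, h2⟩ : ∃ P₀ P' A α A₂, P' = A ++ a :: α ++ b :: A₂ ∧
      (P₀ = P ∨ P₀ = P.reverse) ∧ ((P' = P₂ ∧ P₀ = P) ∨ (P' = P₂.reverse ∧ P₀ = P.reverse)) := by
    obtain ⟨X, Y, hXY⟩ := List.append_of_mem q7
    have : a ∈ X ∨ a ∈ Y := by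
      rw [hXY] at q6
      simp only [List.mem_append, List.mem_cons] at q6
      tauto
    rcases this with h | h
    · obtain ⟨X₁, X₂, rfl⟩ := List.append_of_mem h
      exact ⟨P, P₂, X₁, X₂, Y, hXY, Or.inl rfl, Or.inl ⟨rfl, rfl⟩⟩
    · obtain ⟨Y₁, Y₂, rfl⟩ := List.append_of_mem h
      refine ⟨P.reverse, P₂.reverse, Y₂.reverse, Y₁.reverse, X.reverse, ?_, Or.inr rfl,
        Or.inr ⟨rfl, rfl⟩⟩
      rw [hXY]; simp
  have r1 : IsSimpleLine P' := by
    rcases h2 with h | h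
    · rw [h.1]; exact q1
    · rw [h.1]; exact q1.reverse
  have r3 : P'.head? = P₀.head? := by
    rcases h2 with h | h
    · rw [h.1, h.2, q3]
    · rw [h.1, h.2, List.head?_reverse, List.head?_reverse, q4]
  have r4 : P'.getLast? = P₀.getLast? := by
    rcases h2 with h | h
    · rw [h.1, h.2, q4]
    · rw [h.1, h.2, List.getLast?_reverse, List.getLast?_reverse, q3]
  have hP₀ : ∀ z, z ∈ P₀ ↔ z ∈ P := by
    rcases h1 with rfl | rfl <;> simp
  have r5 : RunsAlong P' a s := by
    rcases h2 with h | h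
    · rw [h.1]; exact q9
    · rw [h.1]; exact q9.reverse
  -- The point `a` is not listed in the original line, so it is not its first point and has a
  -- predecessor.
  obtain ⟨A₁, x, rfl⟩ : ∃ A₁ x, A = A₁ ++ [x] := by
    rcases List.eq_nil_or_concat A with rfl | ⟨A₁, x, h⟩
    · rw [h0] at r3
      exact absurd ((hP₀ a).1 (List.mem_of_head? (by rw [← r3]; rfl))) haP
    · exact ⟨A₁, x, by simpa using h⟩
  have hform : P' = A₁ ++ x :: (a :: α ++ [b]) ++ A₂ := by rw [h0]; simp
  have hxa : (x, a) ∈ segs P' := mem_segs_iff.2 ⟨A₁, α ++ b :: A₂, by rw [h0]; simp⟩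
  -- The point `b` is listed in `P` only if it is an end of `P`; as it comes after `a`, it is then
  -- the last point.
  have hiff : A₂ = [] ↔ b ∈ P := by
    constructor
    · rintro rfl
      refine (hP₀ b).1 (List.mem_of_getLast? (a := b) ?_)
      rw [← r4, h0, List.getLast?_concat]
    · intro h
      have hb' : P₀.head? = some b ∨ P₀.getLast? = some b := by
        have := hb.resolve_left (fun h' => h'.1 h)
        rcases h1 with rfl | rfl
        · exact this
        · simpa using this.symm
      rw [← r3, ← r4] at hb'
      rcases hb' with hb' | hb'
      · exfalso
        obtain ⟨w, hw⟩ : ∃ w, (w, b) ∈ segs P' := by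
          refine exists_mem_segs_right (by rw [h0]; simp) fun hh => ?_
          have hn := r1.nodup
          rw [h0] at hh hn
          cases A₁ with
          | nil => simp at hh; simp [hh] at hn
          | cons y A₁ => simp at hh; simp [hh] at hn
        exact notMem_segs_of_head? r1.nodup hb' w hw
      · cases A₂ with
        | nil => rfl
        | cons y A₂ =>
          exfalso
          exact notMem_segs_of_getLast? r1.nodup hb' y (mem_segs_iff.2 ⟨_, _, h0⟩)
  refine ⟨P₀, P', A₁, x, α, A₂, hform, h1, r1, ?_, r3, r4, ?_, r5.nbr x (Or.inl hxa),
    ne_of_mem_segs r1.nodup hxa, r5, hiff, ?_⟩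
  · rcases h2 with h | h
    · rw [h.1, q2]
    · rw [h.1, img_reverse, q2]
  · rcases h2 with h | h
    · rw [h.1]; exact q5
    · rw [h.1]; exact q5.reverse
  · intro R
    have e : cross P' R = cross P₂ R := by
      rcases h2 with h | h
      · rw [h.1]
      · rw [h.1, cross_reverse_left]
    rw [e]
    refine (q8 R).trans ?_
    by_cases hA : A₂ = []
    · rw [if_pos hA, if_pos (hiff.1 hA)]
    · rw [if_neg hA, if_neg (fun h => hA (hiff.2 h))]

/-- The part from `a` to `b` meets `Q` at both of its ends. If the part is a single segment,
transversality prevents `t` from containing both points, so two segments of `Q` are met; otherwise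
two different segments of the part meet `Q`. This makes up for the crossings that the insertion of
`a` and `b` may add. -/
theorem two_le_cross_core {P' Q : List Plane} {a b : Plane} {s t : Plane × Plane}
    {A₁ α A₂ : List Plane} {x : Plane} (hP' : P' = A₁ ++ x :: (a :: α ++ [b]) ++ A₂) (hab : a ≠ b)
    (hr : RunsAlong P' a s) (ht : t ∈ segs Q) (hat : a ∈ seg t)
    (hw : wedge (t.2 - t.1) (s.2 - s.1) ≠ 0) (hbQ : b ∈ img Q) :
    2 ≤ cross (a :: α ++ [b]) Q := by
  obtain ⟨t', ht', hbt'⟩ := hbQ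
  cases α with
  | nil =>
    have hb : b ∈ seg s := hr.nbr b (Or.inr (mem_segs_iff.2 ⟨A₁ ++ [x], A₂, by rw [hP']; simp⟩))
    have htt : t ≠ t' := by
      rintro rfl
      exact hab (eq_of_mem_seg hw hat hr.mem hbt' hb)
    have m1 : Meet (a, b) t := ⟨a, left_mem_segment .., hat⟩
    have m2 : Meet (a, b) t' := ⟨b, right_mem_segment .., hbt'⟩
    simp only [cross, List.cons_append, List.nil_append, segs_cons_cons, segs_singleton]
    rw [crossS_comm]
    obtain ⟨C, D, hCD⟩ := List.append_of_mem ht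
    rw [hCD] at ht' ⊢
    rw [crossS_append, crossS_cons]
    have e1 : 1 ≤ crossS [t] [(a, b)] := one_le_crossS (List.mem_singleton_self _)
      (List.mem_singleton_self _) m1.symm
    simp only [List.mem_append, List.mem_cons] at ht'
    rcases ht' with h | h | h
    · have e2 : 1 ≤ crossS C [(a, b)] := one_le_crossS h (List.mem_singleton_self _) m2.symm
      omega
    · exact absurd h.symm htt
    · have e2 : 1 ≤ crossS D [(a, b)] := one_le_crossS h (List.mem_singleton_self _) m2.symm
      omega
  | cons y α =>
    simp only [cross, List.cons_append, segs_cons_cons]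
    rw [crossS_cons]
    have e1 : 1 ≤ crossS [(a, y)] (segs Q) := one_le_crossS (List.mem_singleton_self _) ht
      ⟨a, left_mem_segment .., hat⟩
    obtain ⟨u, hu, hbu⟩ : b ∈ img (y :: (α ++ [b])) := mem_img_of_mem (by simp) (by simp)
    have e2 : 1 ≤ crossS (segs (y :: (α ++ [b]))) (segs Q) := one_le_crossS hu ht' ⟨b, hbu, hbt'⟩
    omega

/-- One of two simple lines that meet in two points can be rerouted along the other. -/
theorem exists_detour {P Q : List Plane} {a b : Plane} {s t : Plane × Plane} {Q' B₁ β B₂ : List Plane}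
    {w : Plane} {P₀ P' A₁ α A₂ : List Plane} {x : Plane}
    (hab : a ≠ b) (hP' : P' = A₁ ++ x :: (a :: α ++ [b]) ++ A₂)
    (hxs : x ∈ seg s) (hxa : x ≠ a)
    (hrP : RunsAlong P' a s) (hAP : A₂ = [] ↔ b ∈ P)
    (hPcr : ∀ R, cross P' R ≤ cross P R + cross [a, a] R + (if A₂ = [] then 0 else cross [b, b] R))
    (hend : P'.head? = P₀.head? ∧ P'.getLast? = P₀.getLast?)
    (hQ' : Q' = B₁ ++ w :: (a :: β ++ [b]) ++ B₂) (hQs : IsSimpleLine Q')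
    (hQimg : img Q' = img Q) (hQt : TwoSided Q')
    (hrQ : RunsAlong Q' a t) (hBQ : B₂ = [] ↔ b ∈ Q)
    (hbPQ : b ∈ P ↔ b ∈ Q) (ht : t ∈ segs Q) (hat : a ∈ seg t)
    (hw : wedge (t.2 - t.1) (s.2 - s.1) ≠ 0) (haQ : cross [a, a] Q ≤ 1) (hbQ : cross [b, b] Q ≤ 1)
    {𝓡 : Set (List Plane)} (h𝓡 : 𝓡.Finite)
    (h𝓡a : ∀ R ∈ 𝓡, cross [a, a] R = 0 ∧ (b ∉ P → cross [b, b] R = 0)) :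
    ∃ L : List Plane, L.head? = P₀.head? ∧ L.getLast? = P₀.getLast? ∧
      (∀ R ∈ 𝓡, cross L R + cross (a :: α ++ [b]) R ≤ cross P R + cross (a :: β ++ [b]) R) ∧
      cross L Q + 1 ≤ cross P Q := by
  have hxw : wedge (t.2 - t.1) (x - a) ≠ 0 := by
    intro h0
    obtain ⟨c₁, -, e1⟩ := mem_seg_iff.1 hxs
    obtain ⟨c₂, -, e2⟩ := mem_seg_iff.1 hrP.mem
    have : x - a = (c₁ - c₂) • (s.2 - s.1) := by rw [e1, e2]; module
    rw [this, wedge_smul_right, mul_eq_zero] at h0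
    rcases h0 with h0 | h0
    · rw [h0, zero_smul, sub_eq_zero] at this
      exact hxa this
    · exact hw h0
  -- The side is dictated: the detour runs on the side of `Q'` where the predecessor `x` of `a`
  -- lies.
  obtain ⟨κ, hk, hka⟩ : ∃ κ : ℝ, κ ≠ 0 ∧ LeftOf κ Q' a (x - a) := by
    obtain ⟨c, hc⟩ := hrQ.left (x - a) hxw 1 one_ne_zero
    have hwa : (w, a) ∈ segs Q' := mem_segs_iff.2 ⟨B₁, β ++ [b] ++ B₂, by rw [hQ']; simp⟩
    refine ⟨c, ?_, ?_, ?_⟩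
    · rintro rfl
      exact hc.ne_zero_right hwa (by simp)
    · intro u hu
      have := hc.1 u hu
      rwa [wedge_smul_right, one_mul] at this
    · intro u hu
      have := hc.2 u hu
      rwa [wedge_smul_right, one_mul] at this
  have hbi : b ∈ img Q := by
    rw [← hQimg]
    exact mem_img_of_mem (by rw [hQ']; simp) (by rw [hQ']; simp; omega)
  have h2 := two_le_cross_core hP' hab hrP ht hat hw hbi
  obtain ⟨γ, g1, g2, g3⟩ := exists_reroute (A₁ := A₁) (A₂ := A₂) (B₁ := B₁ ++ [w]) (B₂ := B₂)
    (β := β) (a := a) (b := b) (x := x) hQs hQimg (by rw [hQ']; simp) (κ := κ)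
    (fun z hz => hQt z (by rw [hQ']; simp [hz]) κ hk) hka
    (by
      by_cases hb : b ∈ P
      · exact Or.inl ⟨hAP.2 hb, hBQ.2 (hbPQ.1 hb), hbQ⟩
      · exact Or.inr ⟨fun h => hb (hAP.1 h), hQt b (by rw [hQ']; simp) κ hk⟩) ht hat hxw h𝓡
  refine ⟨A₁ ++ x :: γ ++ A₂, ?_, ?_, ?_, ?_⟩
  · rw [← hend.1, hP']; cases A₁ <;> simp
  · have : ∀ C : List Plane, (A₁ ++ x :: (a :: C ++ [b]) ++ A₂).getLast? =
        A₂.getLast?.or (some b) := by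
      intro C
      have e : A₁ ++ x :: (a :: C ++ [b]) = (A₁ ++ x :: a :: C) ++ [b] := by simp
      rw [List.getLast?_append, e, List.getLast?_concat]
    rw [g1, ← hend.2, hP', this, this]
  · intro R hR
    have := g2 R hR
    have h3 := hPcr R
    rw [hP', cross_three] at h3
    obtain ⟨e1, e2⟩ := h𝓡a R hR
    have e3 : (if A₂ = [] then 0 else cross [b, b] R) = 0 := by
      split_ifs with h
      · rfl
      · exact e2 fun h' => h (hAP.2 h')
    rw [e1, e3] at h3
    omega
  -- If `b` is no end, the two insertions add at most two crossings, the dropped part had at least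
  -- two, and the cut before `a` saves one more. If `b` is an end, only `a` is inserted, and the
  -- meeting at `b` is retained; the balance is the same.
  · have h3 := hPcr Q
    rw [hP', cross_three] at h3
    split_ifs at g3 h3 <;> omega

theorem crossS_single_le_one {S : List (Plane × Plane)} (hS : S.Nodup) {u : Plane × Plane}
    (h : ∀ s ∈ S, ∀ t ∈ S, Meet u s → Meet u t → s = t) : crossS [u] S ≤ 1 := by
  rw [crossS_comm]
  induction S with
  | nil => simp
  | cons s S ih =>
    rw [crossS_cons]
    have h1 := ih (List.nodup_cons.1 hS).2 fun s hs t ht => h s (by simp [hs]) t (by simp [ht])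
    by_cases hm : Meet u s
    · have : crossS S [u] = 0 := crossS_eq_zero.2 fun t ht v hv hvt => by
        rw [List.mem_singleton.1 hv] at hvt
        have := h s (by simp) t (by simp [ht]) hm hvt.symm
        exact (List.nodup_cons.1 hS).1 (this ▸ ht)
      rw [this]
      simpa [crossS] using meets_le_one s u
    · have : crossS [s] [u] = 0 := crossS_eq_zero.2 fun t ht v hv hvt => by
        rw [List.mem_singleton.1 hv, List.mem_singleton.1 ht] at hvt
        exact hm hvt.symm
      omega

theorem seg_self (x : Plane) : seg (x, x) = {x} := segment_same ℝ x

theorem meet_point_iff {x : Plane} {s : Plane × Plane} : Meet (x, x) s ↔ x ∈ seg s := by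
  rw [Meet, seg_self, singleton_inter_nonempty]

theorem cross_point_eq_zero {x : Plane} {P : List Plane} : cross [x, x] P = 0 ↔ x ∉ img P := by
  rw [cross_eq_zero, img_cons_cons]
  have : img [x] = ∅ := by ext; simp [img]
  rw [this, segment_same, union_empty, disjoint_singleton_left]

/-- Two segments of a simple line share a point only if they are consecutive, and that point is then
listed without being an end. -/
theorem IsSimpleLine.cross_point_le_one {P : List Plane} (hP : IsSimpleLine P) {x : Plane}
    (hx : x ∉ P ∨ P.head? = some x ∨ P.getLast? = some x) : cross [x, x] P ≤ 1 := by
  refine crossS_single_le_one (segs_nodup hP.nodup) fun s hs t ht h1 h2 => ?_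
  rw [meet_point_iff] at h1 h2
  by_contra hst
  have key : ∀ s ∈ segs P, ∀ t ∈ segs P, x = s.2 → x = t.1 → False := by
    rintro s hs t ht rfl h
    rcases hx with hx | hx | hx
    · exact hx (right_mem_of_mem_segs hs)
    · exact notMem_segs_of_head? hP.nodup hx s.1 hs
    · exact notMem_segs_of_getLast? hP.nodup hx t.2 (by rw [h]; exact ht)
  rcases hP.inter s hs t ht hst x h1 h2 with h | h
  · exact key s hs t ht h.1 h.2
  · exact key t ht s hs h.2 h.1

theorem cross_le_mul {P Q : List Plane} {x : Plane} (h : img P ∩ img Q ⊆ {x}) :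
    cross P Q ≤ cross [x, x] P * cross [x, x] Q := by
  simp only [cross, segs_cons_cons, segs_singleton, crossS, List.map_cons, List.map_nil,
    List.sum_cons, List.sum_nil, add_zero]
  rw [← List.sum_map_mul_right]
  refine List.sum_le_sum fun s hs => ?_
  rw [← List.sum_map_mul_left]
  refine List.sum_le_sum fun t ht => ?_
  by_cases hm : Meet s t
  · obtain ⟨y, hys, hyt⟩ := hm
    obtain rfl : y = x := h ⟨⟨s, hs, hys⟩, ⟨t, ht, hyt⟩⟩
    rw [meets_eq_one (meet_point_iff.2 hys), meets_eq_one (meet_point_iff.2 hyt)]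
    exact meets_le_one _ _
  · rw [meets_eq_zero hm]; exact Nat.zero_le _

namespace Config

variable {V : Type*} [LinearOrder V] {c : Config V}

namespace Generic

/-- At a bend the difference of the two directions has the same wedge with both of them, the turn
`W`, which is nonzero in general position. Scaling the difference by `κ * W` therefore gives the
right sign on both segments. -/
theorem twoSided (hc : c.Generic) (e : VPair V) : TwoSided (c.poly e) := by
  intro z hz κ hk
  have hn := hc.poly_nodup e
  by_cases h1 : ∃ u, (u, z) ∈ segs (c.poly e)
  · obtain ⟨u, hu⟩ := h1
    have e1 : ∀ y, (y, z) ∈ segs (c.poly e) → y = u := fun y hy => by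
      have := segs_left_unique hn hy hu rfl
      simpa using this
    by_cases h2 : ∃ v, (z, v) ∈ segs (c.poly e)
    · obtain ⟨v, hv⟩ := h2
      have e2 : ∀ y, (z, y) ∈ segs (c.poly e) → y = v := fun y hy => by
        have := segs_right_unique hn hy hv rfl
        simpa using this
      have hw : wedge (z - u) (v - u) ≠ 0 :=
        hc.genPos.wedge_ne u (mem_of_mem_poly (left_mem_of_mem_segs hu)) z (mem_of_mem_poly hz)
          v (mem_of_mem_poly (right_mem_of_mem_segs hv)) (ne_of_mem_segs hn hu)
          (fun h => not_swap_mem_segs hn hu (h ▸ hv)) (ne_of_mem_segs hn hv)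
      set W := wedge (z - u) (v - u) with hW
      refine ⟨(κ * W) • ((v - z) - (z - u)), ?_, ?_⟩
      · intro y hy
        rw [e1 y hy]
        have : wedge (z - u) ((κ * W) • ((v - z) - (z - u))) = κ * W * W := by
          rw [hW]; simp [wedge]; ring
        rw [this]
        have h3 : κ * (κ * W * W) = (κ * W) ^ 2 := by ring
        rw [h3]
        have := mul_ne_zero hk hw
        positivity
      · intro y hy
        rw [e2 y hy]
        have : wedge (v - z) ((κ * W) • ((v - z) - (z - u))) = κ * W * W := by
          rw [hW]; simp [wedge]; ring
        rw [this]
        have h3 : κ * (κ * W * W) = (κ * W) ^ 2 := by ring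
        rw [h3]
        have := mul_ne_zero hk hw
        positivity
    · push Not at h2
      obtain ⟨m, hm⟩ := exists_wedge_pos (d := z - u) (sub_ne_zero.2 (ne_of_mem_segs hn hu).symm) hk
      exact ⟨m, fun y hy => by rw [e1 y hy]; exact hm, fun y hy => absurd hy (h2 y)⟩
  · push Not at h1
    by_cases h2 : ∃ v, (z, v) ∈ segs (c.poly e)
    · obtain ⟨v, hv⟩ := h2
      obtain ⟨m, hm⟩ := exists_wedge_pos (d := v - z) (sub_ne_zero.2 (ne_of_mem_segs hn hv).symm) hk
      refine ⟨m, fun y hy => absurd hy (h1 y), fun y hy => ?_⟩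
      have := segs_right_unique hn hy hv rfl
      simp only [Prod.mk.injEq, true_and] at this
      rw [this]; exact hm
    · push Not at h2
      exact ⟨0, fun y hy => absurd hy (h1 y), fun y hy => absurd hy (h2 y)⟩

/-- A listed point on a segment that is not one of its ends would be collinear with these ends. -/
theorem mem_poly_of_mem_img (hc : c.Generic) {e f : VPair V} {x : Plane}
    (hx : x ∈ c.poly e) (hxf : x ∈ img (c.poly f)) : x ∈ c.poly f := by
  obtain ⟨t, ht, hxt⟩ := hxf
  by_contra hn
  have m1 := left_mem_of_mem_segs ht
  have m2 := right_mem_of_mem_segs ht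
  exact hc.genPos.wedge_ne t.1 (mem_of_mem_poly m1) t.2 (mem_of_mem_poly m2) x (mem_of_mem_poly hx)
    (ne_of_mem_segs (hc.poly_nodup f) ht) (fun h => hn (h ▸ m1)) (fun h => hn (h ▸ m2))
    (wedge_of_mem_seg hxt)

theorem end_of_mem_poly (hc : c.Generic) {e f : VPair V} (hef : e ≠ f) {x : Plane}
    (hx : x ∈ c.poly e) (hxf : x ∈ c.poly f) :
    (c.poly e).head? = some x ∨ (c.poly e).getLast? = some x := by
  obtain ⟨v, rfl, h, -⟩ := hc.exists_pos_of_mem_poly hef hx hxf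
  rw [head?_poly, getLast?_poly]
  rcases h with rfl | rfl <;> simp

theorem cross_point_le_one (hc : c.Generic) (hs : ∀ e, IsSimpleLine (c.poly e)) {e f : VPair V}
    (hef : e ≠ f) {x : Plane} (hx : x ∈ img (c.poly f)) : cross [x, x] (c.poly e) ≤ 1 := by
  refine (hs e).cross_point_le_one ?_
  by_cases hxe : x ∈ c.poly e
  · exact Or.inr (hc.end_of_mem_poly hef hxe (hc.mem_poly_of_mem_img hxe hx))
  · exact Or.inl hxe

/-- Two edges that cross at most once as often as they have a common point. -/
theorem cross_le_one (hc : c.Generic) (hs : ∀ e, IsSimpleLine (c.poly e)) {e f : VPair V}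
    (hef : e ≠ f) (h : (img (c.poly e) ∩ img (c.poly f)).Subsingleton) :
    cross (c.poly e) (c.poly f) ≤ 1 := by
  rcases h.eq_empty_or_singleton with h | ⟨x, h⟩
  · rw [cross_eq_zero.2 (disjoint_iff_inter_eq_empty.2 h)]; simp
  · refine (cross_le_mul h.subset).trans ?_
    have hx : x ∈ img (c.poly e) ∩ img (c.poly f) := by rw [h]; rfl
    exact (Nat.mul_le_mul (hc.cross_point_le_one hs hef hx.2)
      (hc.cross_point_le_one hs hef.symm hx.1)).trans (by simp)

/-- If two edges cross more than once, then one of them can be rerouted along the other. -/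
theorem exists_detours [Finite V] (hc : c.Generic) (hs : ∀ e, IsSimpleLine (c.poly e))
    {e f : VPair V} (hef : e ≠ f) (h2 : 2 ≤ cross (c.poly e) (c.poly f)) :
    ∃ (L M : List Plane) (A B : VPair V → ℕ),
      L.head? = (c.poly e).head? ∧ L.getLast? = (c.poly e).getLast? ∧
      M.head? = (c.poly f).head? ∧ M.getLast? = (c.poly f).getLast? ∧
      (∀ g, g ≠ e → g ≠ f → cross L (c.poly g) + A g ≤ cross (c.poly e) (c.poly g) + B g) ∧
      (∀ g, g ≠ e → g ≠ f → cross M (c.poly g) + B g ≤ cross (c.poly f) (c.poly g) + A g) ∧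
      cross L (c.poly f) + 1 ≤ cross (c.poly e) (c.poly f) ∧
      cross M (c.poly e) + 1 ≤ cross (c.poly e) (c.poly f) := by
  have hX : ¬ (img (c.poly e) ∩ img (c.poly f)).Subsingleton := fun h => by
    have := hc.cross_le_one hs hef h
    omega
  have hboth : ∀ x, x ∈ img (c.poly e) → x ∈ img (c.poly f) → (x ∈ c.poly e ↔ x ∈ c.poly f) :=
    fun x hx hx' => ⟨fun h => hc.mem_poly_of_mem_img h hx',
      fun h => hc.mem_poly_of_mem_img h hx⟩
  -- Different edges share at most one vertex, so at least one of two common points is a proper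
  -- crossing. It is called `a`.
  obtain ⟨a, b, ⟨hae, haf⟩, ⟨hbe, hbf⟩, hab, hane⟩ : ∃ a b, a ∈ img (c.poly e) ∩ img (c.poly f) ∧
      b ∈ img (c.poly e) ∩ img (c.poly f) ∧ a ≠ b ∧ a ∉ c.poly e := by
    rw [not_subsingleton_iff] at hX
    obtain ⟨a, ha, b, hb, hab⟩ := hX
    by_cases h : a ∈ c.poly e
    · refine ⟨b, a, hb, ha, hab.symm, fun h' => ?_⟩
      obtain ⟨u, rfl, h1, h1'⟩ := hc.exists_pos_of_mem_poly hef h ((hboth a ha.1 ha.2).1 h)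
      obtain ⟨v, rfl, h3, h3'⟩ := hc.exists_pos_of_mem_poly hef h' ((hboth b hb.1 hb.2).1 h')
      exact hef (VPair.eq_of_common (fun h => hab (by rw [h])) h1 h1' h3 h3')
    · exact ⟨a, b, ha, hb, hab, h⟩
  have hanf : a ∉ c.poly f := fun h => hane ((hboth a hae haf).2 h)
  have hbef := hboth b hbe hbf
  obtain ⟨s, hs', has⟩ := hae
  obtain ⟨t, ht', hat⟩ := haf
  have hw := (hc.of_mem_seg hef hs' ht' has hat).1
  have hw' : wedge (t.2 - t.1) (s.2 - s.1) ≠ 0 := by rw [wedge_swap]; simpa using hw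
  have hbe' : (b ∉ c.poly e ∧ b ∈ img (c.poly e)) ∨ (c.poly e).head? = some b ∨
      (c.poly e).getLast? = some b := by
    by_cases h : b ∈ c.poly e
    · exact Or.inr (hc.end_of_mem_poly hef h (hbef.1 h))
    · exact Or.inl ⟨h, hbe⟩
  have hbf' : (b ∉ c.poly f ∧ b ∈ img (c.poly f)) ∨ (c.poly f).head? = some b ∨
      (c.poly f).getLast? = some b := by
    by_cases h : b ∈ c.poly f
    · exact Or.inr (hc.end_of_mem_poly hef.symm h (hbef.2 h))
    · exact Or.inl ⟨h, hbf⟩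
  obtain ⟨P₀, P', A₁, x, α, A₂, p1, p2, p3, p4, p5, p6, p7, p8, p9, p10, p11, p12⟩ :=
    exists_strand (hs e) (hc.twoSided e) hab hs' has hane hbe'
  obtain ⟨Q₀, Q', B₁, w, β, B₂, q1, q2, q3, q4, q5, q6, q7, q8, q9, q10, q11, q12⟩ :=
    exists_strand (hs f) (hc.twoSided f) hab ht' hat hanf hbf'
  have hfin : (c.poly '' {g | g ≠ e ∧ g ≠ f}).Finite := (Set.toFinite _).image _
  -- A point of three edges is a vertex, and a vertex that lies on an edge is listed there. Hence
  -- the inserted points lie on no third edge, and inserting them is free with respect to third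
  -- edges.
  have hvert : ∀ g, g ≠ e → g ≠ f → ∀ y, y ∈ img (c.poly e) → y ∈ img (c.poly f) → y ∉ c.poly e →
      cross [y, y] (c.poly g) = 0 := by
    intro g hge hgf y hye hyf hyn
    rw [cross_point_eq_zero]
    intro hyg
    obtain ⟨v, rfl⟩ := hc.exists_pos_of_mem_img hef hge.symm hgf.symm hye hyf hyg
    obtain ⟨s, hs, hvs⟩ := hye
    have m1 := left_mem_of_mem_segs hs
    have m2 := right_mem_of_mem_segs hs
    exact hc.genPos.wedge_ne s.1 (mem_of_mem_poly m1) s.2 (mem_of_mem_poly m2) (c.pos v)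
      (Or.inl (mem_range_self v)) (ne_of_mem_segs (hc.poly_nodup e) hs) (fun h => hyn (h ▸ m1))
      (fun h => hyn (h ▸ m2)) (wedge_of_mem_seg hvs)
  have hR : ∀ R ∈ c.poly '' {g | g ≠ e ∧ g ≠ f}, cross [a, a] R = 0 ∧
      (b ∉ c.poly e → cross [b, b] R = 0) := by
    rintro _ ⟨g, ⟨hge, hgf⟩, rfl⟩
    exact ⟨hvert g hge hgf a ⟨s, hs', has⟩ ⟨t, ht', hat⟩ hane,
      fun hb => hvert g hge hgf b hbe hbf hb⟩
  obtain ⟨L, l1, l2, l3, l4⟩ := exists_detour hab p1 p8 p9 p10 p11 p12 ⟨p5, p6⟩ q1 q3 q4 q7 q10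
    q11 hbef ht' hat hw' (hc.cross_point_le_one hs hef.symm ⟨s, hs', has⟩)
    (hc.cross_point_le_one hs hef.symm hbe) hfin hR
  obtain ⟨M, m1, m2, m3, m4⟩ := exists_detour hab q1 q8 q9 q10 q11 q12 ⟨q5, q6⟩ p1 p3 p4 p7 p10
    p11 hbef.symm hs' has hw (hc.cross_point_le_one hs hef ⟨t, ht', hat⟩)
    (hc.cross_point_le_one hs hef hbf) hfin
    (fun R hR' => ⟨(hR R hR').1, fun hb => (hR R hR').2 fun h => hb (hbef.1 h)⟩)
  have orient : ∀ {P P₀ L : List Plane}, P₀ = P ∨ P₀ = P.reverse → L.head? = P₀.head? →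
      L.getLast? = P₀.getLast? → ∃ L' : List Plane, L'.head? = P.head? ∧ L'.getLast? = P.getLast? ∧
        ∀ R, cross L' R = cross L R := by
    rintro P P₀ L (rfl | rfl) h1 h2
    · exact ⟨L, h1, h2, fun R => rfl⟩
    · refine ⟨L.reverse, ?_, ?_, fun R => cross_reverse_left L R⟩
      · rw [List.head?_reverse, h2, List.getLast?_reverse]
      · rw [List.getLast?_reverse, h1, List.head?_reverse]
  obtain ⟨L', n1, n2, n3⟩ := orient p2 l1 l2
  obtain ⟨M', o1, o2, o3⟩ := orient q2 m1 m2
  -- The two counts are the crossings of `g` with the parts of `e` and of `f` between `a` and `b`.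
  -- The two detours trade these parts in opposite directions.
  refine ⟨L', M', fun g => cross (a :: α ++ [b]) (c.poly g), fun g => cross (a :: β ++ [b]) (c.poly g),
    n1, n2, o1, o2, ?_, ?_, ?_, ?_⟩
  · intro g hge hgf
    rw [n3]; exact l3 _ ⟨g, ⟨hge, hgf⟩, rfl⟩
  · intro g hge hgf
    rw [o3]; exact m3 _ ⟨g, ⟨hge, hgf⟩, rfl⟩
  · rw [n3]; exact l4
  · rw [o3, cross_comm (c.poly e)]; exact m4

end Generic

/-! ### Weighted cost and uncrossing -/

open Classical in
/-- The weighted number of crossings, every pair of edges being counted twice. -/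
noncomputable def cost [Fintype V] (c : Config V) (w : VPair V → ℝ) : ℝ :=
  ∑ e, ∑ f, if e = f then 0 else w e * w f * (cross (c.poly e) (c.poly f) : ℝ)

theorem cost_mono [Fintype V] {c c' : Config V} {w : VPair V → ℝ} (hw : ∀ e, 0 ≤ w e)
    (h : ∀ e f, e ≠ f → cross (c'.poly e) (c'.poly f) ≤ cross (c.poly e) (c.poly f)) :
    c'.cost w ≤ c.cost w := by
  refine Finset.sum_le_sum fun e _ => Finset.sum_le_sum fun f _ => ?_
  split_ifs with hef
  · rfl
  · exact mul_le_mul_of_nonneg_left (by exact_mod_cast h e f hef) (mul_nonneg (hw e) (hw f))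

-- Only pairs that contain `e` change; the factor 2 comes from the two orders of such a pair.
open Classical in
theorem cost_update [Fintype V] {c c' : Config V} (w : VPair V → ℝ) (e : VPair V)
    (h : ∀ f ≠ e, c'.poly f = c.poly f) : c'.cost w = c.cost w + 2 * w e *
      ∑ g ∈ Finset.univ.erase e, w g * ((cross (c'.poly e) (c.poly g) : ℝ) -
        cross (c.poly e) (c.poly g)) := by
  let d : VPair V → ℝ := fun g => if g = e then 0 else
    w g * ((cross (c'.poly e) (c.poly g) : ℝ) - cross (c.poly e) (c.poly g))
  have hd : ∑ g ∈ Finset.univ.erase e, w g * ((cross (c'.poly e) (c.poly g) : ℝ) -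
        cross (c.poly e) (c.poly g)) = ∑ g, d g := by
    rw [← Finset.add_sum_erase _ _ (Finset.mem_univ e)]
    simp only [d, if_true, zero_add]
    refine Finset.sum_congr rfl fun g hg => ?_
    rw [if_neg (Finset.ne_of_mem_erase hg)]
  rw [hd]
  have key : ∀ f g, (if f = g then 0 else w f * w g * (cross (c'.poly f) (c'.poly g) : ℝ)) =
      (if f = g then 0 else w f * w g * (cross (c.poly f) (c.poly g) : ℝ)) +
      ((if f = e then w e * d g else 0) + (if g = e then w e * d f else 0)) := by
    intro f g
    by_cases hfg : f = g
    · subst hfg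
      by_cases hf : f = e <;> simp [hf, d]
    · by_cases hf : f = e
      · subst hf
        simp only [hfg, if_false, if_true, Ne.symm hfg, d, add_zero]
        rw [h g (Ne.symm hfg)]; ring
      · by_cases hg : g = e
        · subst hg
          simp only [hfg, if_false, if_true, d, zero_add]
          rw [h f hf, cross_comm (c.poly f), cross_comm (c.poly f)]; ring
        · simp [hfg, hf, hg, h f hf, h g hg]
  simp only [cost]
  simp_rw [key, Finset.sum_add_distrib, Finset.sum_ite_eq', Finset.sum_ite_irrel, Finset.sum_const_zero,
    Finset.sum_ite_eq']
  simp only [Finset.mem_univ, if_true]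
  rw [← Finset.mul_sum]
  ring

/-- If all weights are positive, then the edges of a generic family can be rerouted such that any
two of them cross at most once, without increasing the weighted number of crossings. -/
theorem Generic.exists_uncrossed [Fintype V] {w : VPair V → ℝ} (hw : ∀ e, 0 < w e)
    (hc : c.Generic) : ∃ c' : Config V, c'.Generic ∧ (∀ e, IsSimpleLine (c'.poly e)) ∧
      (∀ e f, e ≠ f → cross (c'.poly e) (c'.poly f) ≤ 1) ∧ c'.cost w ≤ c.cost w := by
  classical
  -- Each detour will lower the cost by at least `η`, which bounds the number of detours. This is
  -- where positive weights are needed.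
  obtain ⟨η, hη, hηw⟩ : ∃ η > (0 : ℝ), ∀ e f, η ≤ w e * w f := by
    rcases isEmpty_or_nonempty (VPair V) with h | h
    · exact ⟨1, one_pos, fun e => h.elim e⟩
    · obtain ⟨e₀, he₀⟩ := Finite.exists_min w
      exact ⟨w e₀ * w e₀, mul_pos (hw _) (hw _), fun e f =>
        mul_le_mul (he₀ e) (he₀ f) (hw _).le (hw _).le⟩
  obtain ⟨N, hN⟩ := exists_nat_ge (c.cost w / η)
  rw [div_le_iff₀ hη] at hN
  induction N generalizing c with
  | zero =>
    obtain ⟨c₁, h1, h2, h3, -⟩ := hc.exists_simple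
    refine ⟨c₁, h1, h2, ?_, cost_mono (fun e => (hw e).le) h3⟩
    by_contra! hcr
    obtain ⟨e, f, hef, h⟩ := hcr
    have hpos : 0 < c₁.cost w := by
      refine Finset.sum_pos' (fun e _ => Finset.sum_nonneg fun f _ => ?_) ⟨e, Finset.mem_univ _, ?_⟩
      · split_ifs
        · rfl
        · exact mul_nonneg (mul_nonneg (hw _).le (hw _).le) (Nat.cast_nonneg _)
      · refine Finset.sum_pos' (fun f _ => ?_) ⟨f, Finset.mem_univ _, ?_⟩
        · split_ifs
          · rfl
          · exact mul_nonneg (mul_nonneg (hw _).le (hw _).le) (Nat.cast_nonneg _)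
        · rw [if_neg hef]
          exact mul_pos (mul_pos (hw _) (hw _)) (by exact_mod_cast (by omega))
    have := cost_mono (fun e => (hw e).le) h3
    simp at hN
    linarith
  | succ N ih =>
    obtain ⟨c₁, h1, h2, h3, -⟩ := hc.exists_simple
    have hle := cost_mono (fun e => (hw e).le) h3
    by_cases hcr : ∀ e f, e ≠ f → cross (c₁.poly e) (c₁.poly f) ≤ 1
    · exact ⟨c₁, h1, h2, hcr, hle⟩
    push Not at hcr
    obtain ⟨e, f, hef, h⟩ := hcr
    obtain ⟨L, M, A, B, l1, l2, m1, m2, hL, hM, hLf, hMe⟩ := h1.exists_detours h2 hef h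
    obtain ⟨c₂, hc₂⟩ : ∃ c₂ : Config V, c₂.cost w ≤ c₁.cost w - η := by
      have hes : f ∈ Finset.univ.erase e := Finset.mem_erase.2 ⟨hef.symm, Finset.mem_univ _⟩
      have hfs : e ∈ Finset.univ.erase f := Finset.mem_erase.2 ⟨hef, Finset.mem_univ _⟩
      have hsets : (Finset.univ.erase f).erase e = (Finset.univ.erase e).erase f :=
        Finset.erase_right_comm
      -- The weighted change of the crossings with third edges is at most `D` if `e` is rerouted and
      -- at most `-D` if `f` is, so one of the two detours does no harm to third edges.
      set D : ℝ := ∑ g ∈ (Finset.univ.erase e).erase f, w g * ((B g : ℝ) - A g) with hD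
      have hη' := hηw e f
      rcases le_total D 0 with hD0 | hD0
      · obtain ⟨c₂, k1, k2, -, -⟩ := c₁.exists_update e (l1.trans (c₁.head?_poly e))
          (l2.trans (c₁.getLast?_poly e)) (h1.pos_injective.ne e.2.ne)
        refine ⟨c₂, ?_⟩
        rw [cost_update w e k2, k1, ← Finset.add_sum_erase _ _ hes]
        have s1 : ∑ g ∈ (Finset.univ.erase e).erase f,
            w g * ((cross L (c₁.poly g) : ℝ) - cross (c₁.poly e) (c₁.poly g)) ≤ D := by
          refine Finset.sum_le_sum fun g hg => mul_le_mul_of_nonneg_left ?_ (hw g).le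
          simp only [Finset.mem_erase, Finset.mem_univ, and_true] at hg
          have : ((cross L (c₁.poly g) + A g : ℕ) : ℝ) ≤ (cross (c₁.poly e) (c₁.poly g) + B g : ℕ) := by
            exact_mod_cast hL g hg.2 hg.1
          push_cast at this
          linarith
        have s2 : w f * ((cross L (c₁.poly f) : ℝ) - cross (c₁.poly e) (c₁.poly f)) ≤ w f * (-1) := by
          refine mul_le_mul_of_nonneg_left ?_ (hw f).le
          have : ((cross L (c₁.poly f) + 1 : ℕ) : ℝ) ≤ (cross (c₁.poly e) (c₁.poly f) : ℕ) := by
            exact_mod_cast hLf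
          push_cast at this
          linarith
        have := hw e
        nlinarith
      · obtain ⟨c₂, k1, k2, -, -⟩ := c₁.exists_update f (m1.trans (c₁.head?_poly f))
          (m2.trans (c₁.getLast?_poly f)) (h1.pos_injective.ne f.2.ne)
        refine ⟨c₂, ?_⟩
        rw [cost_update w f k2, k1, ← Finset.add_sum_erase _ _ hfs, hsets]
        have s1 : ∑ g ∈ (Finset.univ.erase e).erase f,
            w g * ((cross M (c₁.poly g) : ℝ) - cross (c₁.poly f) (c₁.poly g)) ≤ - D := by
          rw [hD, ← Finset.sum_neg_distrib]
          refine Finset.sum_le_sum fun g hg => ?_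
          rw [← mul_neg]
          refine mul_le_mul_of_nonneg_left ?_ (hw g).le
          simp only [Finset.mem_erase, Finset.mem_univ, and_true] at hg
          have : ((cross M (c₁.poly g) + B g : ℕ) : ℝ) ≤ (cross (c₁.poly f) (c₁.poly g) + A g : ℕ) := by
            exact_mod_cast hM g hg.2 hg.1
          push_cast at this
          linarith
        have s2 : w e * ((cross M (c₁.poly e) : ℝ) - cross (c₁.poly f) (c₁.poly e)) ≤ w e * (-1) := by
          refine mul_le_mul_of_nonneg_left ?_ (hw e).le
          have : ((cross M (c₁.poly e) + 1 : ℕ) : ℝ) ≤ (cross (c₁.poly e) (c₁.poly f) : ℕ) := by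
            exact_mod_cast hMe
          rw [cross_comm (c₁.poly f)]
          push_cast at this
          linarith
        have := hw f
        nlinarith
    obtain ⟨c₃, g1, g2, -⟩ := c₂.exists_generic
    have hle3 : c₃.cost w ≤ c₂.cost w := cost_mono (fun e => (hw e).le) fun e f _ => g2 e f
    obtain ⟨c', r1, r2, r3, r4⟩ := ih g1 (by push_cast at hN; linarith)
    exact ⟨c', r1, r2, r3, by linarith⟩

end Config

/-! ### Cloning a vertex -/

namespace Config

variable {V : Type*} [LinearOrder V]

/-- The bends between two vertices, in the order in which they are met from the first one. -/
def bendsFrom (c : Config V) (u w : V) : List Plane :=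
  if h : u < w then c.bends ⟨(u, w), h⟩ else if h : w < u then (c.bends ⟨(w, u), h⟩).reverse else []

/-- The polygonal line from one vertex to another one. -/
def line (c : Config V) (u w : V) : List Plane := c.pos u :: c.bendsFrom u w ++ [c.pos w]

theorem bendsFrom_self (c : Config V) (u : V) : c.bendsFrom u u = [] := by simp [bendsFrom]

theorem bendsFrom_symm (c : Config V) (u w : V) : c.bendsFrom w u = (c.bendsFrom u w).reverse := by
  rcases lt_trichotomy u w with h | rfl | h
  · simp [bendsFrom, h, h.not_gt]
  · simp [bendsFrom]
  · simp [bendsFrom, h, h.not_gt]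

theorem line_symm (c : Config V) (u w : V) : c.line w u = (c.line u w).reverse := by
  rw [line, line, bendsFrom_symm]; simp

theorem line_eq_poly (c : Config V) (e : VPair V) : c.line e.1.1 e.1.2 = c.poly e := by
  simp [line, poly, bendsFrom, e.2]

theorem cross_line_symm_left (c : Config V) (u w : V) (R : List Plane) :
    cross (c.line w u) R = cross (c.line u w) R := by rw [line_symm, cross_reverse_left]

theorem cross_line_symm_right (c : Config V) (u w : V) (R : List Plane) :
    cross R (c.line w u) = cross R (c.line u w) := by rw [line_symm, cross_reverse_right]

theorem cross_line_congr {c : Config V} {u w u' w' : V} (h : s(u, w) = s(u', w'))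
    {R : List Plane} : cross (c.line u w) R = cross (c.line u' w') R := by
  rw [Sym2.eq_iff] at h
  rcases h with ⟨rfl, rfl⟩ | ⟨rfl, rfl⟩
  · rfl
  · exact c.cross_line_symm_left _ _ R

theorem _root_.VPair.exists_mk {u w : V} (h : u ≠ w) :
    ∃ e : VPair V, (u = e.1.1 ∧ w = e.1.2) ∨ (u = e.1.2 ∧ w = e.1.1) := by
  rcases lt_or_gt_of_ne h with h | h
  · exact ⟨⟨(u, w), h⟩, Or.inl ⟨rfl, rfl⟩⟩
  · exact ⟨⟨(w, u), h⟩, Or.inr ⟨rfl, rfl⟩⟩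

theorem exists_pair {u w : V} (h : u ≠ w) : ∃ e : VPair V, s(e.1.1, e.1.2) = s(u, w) ∧
    ∀ c : Config V, c.line u w = c.poly e ∨ c.line u w = (c.poly e).reverse := by
  obtain ⟨e, ⟨rfl, rfl⟩ | ⟨rfl, rfl⟩⟩ := VPair.exists_mk h
  · exact ⟨e, rfl, fun c => Or.inl (c.line_eq_poly e)⟩
  · exact ⟨e, Sym2.eq_swap, fun c => Or.inr (by rw [line_symm, c.line_eq_poly e])⟩

theorem cross_line_le {c c' : Config V}
    (h : ∀ e f, e ≠ f → cross (c'.poly e) (c'.poly f) ≤ cross (c.poly e) (c.poly f))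
    {u w k l : V} (huw : u ≠ w) (hkl : k ≠ l) (hne : s(u, w) ≠ s(k, l)) :
    cross (c'.line u w) (c'.line k l) ≤ cross (c.line u w) (c.line k l) := by
  obtain ⟨e, he, h1⟩ := exists_pair huw
  obtain ⟨f, hf, h2⟩ := exists_pair hkl
  have hef : e ≠ f := by
    rintro rfl
    exact hne (he.symm.trans hf)
  have key : ∀ c : Config V, cross (c.line u w) (c.line k l) = cross (c.poly e) (c.poly f) := by
    intro c
    rcases h1 c with h1 | h1 <;> rcases h2 c with h2 | h2 <;>
      simp only [h1, h2, cross_reverse_left, cross_reverse_right]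
  rw [key, key]
  exact h e f hef

variable {c : Config V}

theorem Generic.twoSided_line (hc : c.Generic) {u w : V} (h : u ≠ w) : TwoSided (c.line u w) := by
  obtain ⟨e, -, he⟩ := exists_pair h
  rcases he c with he | he <;> rw [he]
  · exact hc.twoSided e
  · exact (hc.twoSided e).reverse

theorem isSimpleLine_line (hs : ∀ e, IsSimpleLine (c.poly e)) {u w : V} (h : u ≠ w) :
    IsSimpleLine (c.line u w) := by
  obtain ⟨e, -, he⟩ := exists_pair h
  rcases he c with he | he <;> rw [he]
  · exact hs e
  · exact (hs e).reverse

theorem Generic.pos_notMem_img_line (hc : c.Generic) {i u w : V} (huw : u ≠ w) (hu : i ≠ u)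
    (hw : i ≠ w) : c.pos i ∉ img (c.line u w) := by
  intro h
  obtain ⟨e, he, hl⟩ := exists_pair huw
  obtain ⟨f, hf, -⟩ := exists_pair hu
  have hef : f ≠ e := by
    rintro rfl
    have : i ∈ s(u, w) := by rw [← he, hf]; simp
    simp [hu, hw] at this
  have himg : c.pos i ∈ img (c.poly e) := by
    rcases hl c with hl | hl <;> rw [hl] at h
    · exact h
    · rwa [img_reverse] at h
  have hif : c.pos i ∈ c.poly f := by
    have : i ∈ s(f.1.1, f.1.2) := by rw [hf]; simp
    rw [mem_poly]
    rcases Sym2.mem_iff.1 this with h | h <;> simp [h]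
  have hmem := hc.pos_mem_poly (hc.mem_poly_of_mem_img hif himg)
  have : i ∈ s(u, w) := by rw [← he]; rcases hmem with h | h <;> simp [h]
  simp [hu, hw] at this

theorem cross_point_line_le_one (hs : ∀ e, IsSimpleLine (c.poly e)) {u w : V} (h : u ≠ w) :
    cross [c.pos u, c.pos u] (c.line u w) ≤ 1 :=
  (isSimpleLine_line hs h).cross_point_le_one (Or.inr (Or.inl rfl))

open Classical in
/-- A vertex `v` of a generic family can be moved close to another vertex `i`, every edge at `v`
following the corresponding edge at `i`. -/
theorem Generic.exists_clone [Fintype V] (hc : c.Generic) (hs : ∀ e, IsSimpleLine (c.poly e))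
    {i v : V} (hiv : i ≠ v) : ∃ c' : Config V, c'.Generic ∧ (∀ e, IsSimpleLine (c'.poly e)) ∧
      (∀ u w k l, u ≠ w → k ≠ l → s(u, w) ≠ s(k, l) →
        cross (c'.line u w) (c'.line k l) ≤
          cross (c.line (if u = v then i else u) (if w = v then i else w))
            (c.line (if k = v then i else k) (if l = v then i else l))) ∧
      ∀ j, j ≠ v → j ≠ i → cross (c'.line v j) (c'.line i j) ≤ 1 := by
  have hfirst : ∀ j, ∃ z, j ≠ i → (c.pos i, z) ∈ segs (c.line i j) := by
    intro j
    by_cases hj : j = i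
    · exact ⟨0, fun h => absurd hj h⟩
    obtain ⟨z, hz⟩ := exists_mem_segs_left (l := c.line i j) (a := c.pos i) (by simp [line]) (by
      rw [line, List.getLast?_concat]
      simpa using fun h => hj (hc.pos_injective h))
    exact ⟨z, fun _ => hz⟩
  choose z hz using hfirst
  -- A single direction in which to leave `i`, not parallel to the first segment of any edge at `i`.
  -- It decides for each of these edges on which side the edge of the clone follows it.
  obtain ⟨m₀, hm₀⟩ : ∃ m₀ : Plane, ∀ j, j ≠ i → wedge (z j - c.pos i) m₀ ≠ 0 := by
    have : ∀ᵐ x : Plane, ∀ j, j ≠ i → wedge (z j - c.pos i) (x - 0) ≠ 0 := by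
      refine ae_all_iff.2 fun j => ?_
      by_cases hj : j = i
      · exact Filter.Eventually.of_forall fun x h => absurd hj h
      · filter_upwards [ae_wedge_ne_zero (sub_ne_zero.2
          (ne_of_mem_segs (isSimpleLine_line hs (Ne.symm hj)).nodup (hz j hj)).symm) 0] with x hx _
        exact hx
    obtain ⟨m, hm⟩ := this.exists
    exact ⟨m, by simpa using hm⟩
  have hside : ∀ j, ∀ x, ∃ m, j ≠ i → x ∈ c.line i j →
      LeftOf (wedge (z j - c.pos i) m₀) (c.line i j) x m := by
    intro j x
    by_cases hj : j ≠ i ∧ x ∈ c.line i j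
    · obtain ⟨m, hm⟩ := hc.twoSided_line (Ne.symm hj.1) x hj.2 _ (hm₀ j hj.1)
      exact ⟨m, fun _ _ => hm⟩
    · exact ⟨0, fun h h' => absurd ⟨h, h'⟩ hj⟩
  choose μ hμ using hside
  set B : V → ℝ → List Plane := fun j ε => (c.bendsFrom i j).map fun x => x + ε • μ j x with hB
  -- For `ε = 0` the clone `v` sits on `i` and its lines lie on those of `i`. The line between `v`
  -- and `i` then shrinks to a point, as `bendsFrom i i` is empty.
  set C : ℝ → Config V := fun ε =>
    { pos := Function.update c.pos v (c.pos i + ε • m₀)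
      bends := fun e => if e.1.1 = v then B e.1.2 ε else if e.1.2 = v then (B e.1.1 ε).reverse
        else c.bends e } with hC
  have hCpos : ∀ ε u, u ≠ v → (C ε).pos u = c.pos u := fun ε u hu => by simp [hC, hu]
  have hCposv : ∀ ε, (C ε).pos v = c.pos i + ε • m₀ := fun ε => by simp [hC]
  have hCv : ∀ ε j, j ≠ v → (C ε).line v j =
      (c.pos i + ε • m₀) :: B j ε ++ [c.pos j] := by
    intro ε j hj
    rw [line, hCpos ε j hj, hCposv]
    congr 2
    rcases lt_or_gt_of_ne hj with h | h
    · simp [bendsFrom, h, h.not_gt, hC, hj]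
    · simp [bendsFrom, h, hC]
  have hCo : ∀ ε u w, u ≠ v → w ≠ v → (C ε).line u w = c.line u w := by
    intro ε u w hu hw
    rw [line, line, hCpos ε u hu, hCpos ε w hw]
    simp [bendsFrom, hC, hu, hw]
  -- Crossings for small `ε` are bounded by those in the degenerate limit.
  have husc : ∀ u w k l, u ≠ w → k ≠ l → ∀ᶠ ε in 𝓝[>] (0 : ℝ),
      cross ((C ε).line u w) ((C ε).line k l) ≤
        cross (c.line (if u = v then i else u) (if w = v then i else w))
            (c.line (if k = v then i else k) (if l = v then i else l)) := by
    have hmov : ∀ u w, u ≠ w → ∃ L : List (ℝ → Plane), (∀ φ ∈ L, ContinuousAt φ 0) ∧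
        (∀ ε, (C ε).line u w = L.map (· ε)) ∧
        c.line (if u = v then i else u) (if w = v then i else w) = L.map (· 0) := by
      have key : ∀ w, v ≠ w → ∃ L : List (ℝ → Plane), (∀ φ ∈ L, ContinuousAt φ 0) ∧
        (∀ ε, (C ε).line v w = L.map (· ε)) ∧ c.line i w = L.map (· 0) := by
        intro w hw
        refine ⟨(fun ε => c.pos i + ε • m₀) ::
          (c.bendsFrom i w).map (fun x (ε : ℝ) => x + ε • μ w x) ++ [fun _ => c.pos w], ?_, ?_, ?_⟩
        · intro φ hφ
          simp only [List.cons_append, List.mem_cons, List.mem_append, List.mem_map,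
            List.not_mem_nil, or_false] at hφ
          rcases hφ with rfl | ⟨x, -, rfl⟩ | rfl <;> fun_prop
        · intro ε
          rw [hCv ε w hw.symm]
          simp [hB, Function.comp_def]
        · simp [line, Function.comp_def]
      intro u w huw
      by_cases hu : u = v
      · subst hu
        simpa [huw.symm] using key w huw
      by_cases hw : w = v
      · subst hw
        obtain ⟨L, h1, h2, h3⟩ := key u huw.symm
        refine ⟨L.reverse, fun φ hφ => h1 φ (List.mem_reverse.1 hφ), fun ε => ?_, ?_⟩
        · rw [line_symm, h2]; simp
        · rw [if_neg hu, if_pos rfl, line_symm, h3]; simp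
      · refine ⟨(c.line u w).map fun x _ => x, ?_, fun ε => ?_, ?_⟩
        · intro φ hφ
          obtain ⟨x, -, rfl⟩ := List.mem_map.1 hφ
          exact continuousAt_const
        · rw [hCo ε u w hu hw]; simp [Function.comp_def]
        · rw [if_neg hu, if_neg hw]; simp [Function.comp_def]
    intro u w k l huw hkl
    obtain ⟨L, h1, h2, h3⟩ := hmov u w huw
    obtain ⟨M, k1, k2, k3⟩ := hmov k l hkl
    rw [h3, k3]
    simp only [h2, k2]
    exact eventually_cross_le nhdsWithin_le_nhds h1 k1
  have hpar : ∀ j, j ≠ v → j ≠ i → ∀ᶠ ε in 𝓝[>] (0 : ℝ),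
      cross ((C ε).line v j) (c.line i j) ≤ 1 := by
    intro j hjv hji
    have hsi := isSimpleLine_line hs (Ne.symm hji)
    have hpij : c.pos i ≠ c.pos j := fun h => hji (hc.pos_injective h).symm
    -- All shift vectors along the line at once: `m₀` at the start, and none at `j`, the only point
    -- that the copy shares with the original.
    set M : Plane → Plane := fun x => if x = c.pos i then m₀ else if x = c.pos j then 0 else μ j x
      with hM
    have hnd := hsi.nodup
    have hMi : M (c.pos i) = m₀ := by simp [hM]
    have hMj : M (c.pos j) = 0 := by simp [hM, hpij.symm]
    have hni : c.pos i ∉ c.bendsFrom i j := by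
      intro h; simp [line, h] at hnd
    have hnj : c.pos j ∉ c.bendsFrom i j := by
      intro h
      rw [line, List.nodup_append] at hnd
      exact hnd.2.2 _ (List.mem_cons_of_mem _ h) (c.pos j) (by simp) rfl
    have hout : ∀ u, (c.pos j, u) ∉ segs (c.line i j) :=
      notMem_segs_of_getLast? hnd (by rw [line, List.getLast?_concat])
    have hin : ∀ u, (u, c.pos i) ∉ segs (c.line i j) := notMem_segs_of_head? hnd (by simp [line])
    have hMleft : ∀ x ∈ c.line i j, x ≠ c.pos j →
        LeftOf (wedge (z j - c.pos i) m₀) (c.line i j) x (M x) := by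
      intro x hx hxj
      by_cases hxi : x = c.pos i
      · subst hxi
        rw [hMi]
        refine ⟨fun u hu => absurd hu (hin u), fun u hu => ?_⟩
        have := segs_right_unique hnd hu (hz j hji) rfl
        simp only [Prod.mk.injEq, true_and] at this
        rw [this]
        exact mul_self_pos.2 (hm₀ j hji)
      · have : M x = μ j x := by simp [hM, hxi, hxj]
        rw [this]
        exact hμ j x hji hx
    have hline : ∀ ε, (C ε).line v j = (c.line i j).map fun x => x + ε • M x := by
      intro ε
      rw [hCv ε j hjv, line]
      simp only [List.cons_append, List.map_cons, List.map_append, List.map_nil, hMi, hMj,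
        smul_zero, add_zero]
      congr 2
      refine List.map_congr_left fun x hx => ?_
      have h1 : x ≠ c.pos i := fun h => hni (h ▸ hx)
      have h2 : x ≠ c.pos j := fun h => hnj (h ▸ hx)
      simp [hM, h1, h2]
    have hsh : ∀ s ∈ segs (c.line i j), ∀ᶠ ε : ℝ in 𝓝[>] 0,
        ∀ x ∈ seg (s.1 + ε • M s.1, s.2 + ε • M s.2), x ∈ img (c.line i j) →
          M s.2 = 0 ∧ x = s.2 := by
      intro s hs'
      refine eventually_shift_seg hsi hs' (hMleft _ (left_mem_of_mem_segs hs') ?_) ?_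
      · intro h
        refine hout s.2 ?_
        rw [← h]; exact hs'
      · by_cases h : s.2 = c.pos j
        · exact Or.inr ⟨by rw [h, hMj], by rw [h]; exact hout⟩
        · exact Or.inl (hMleft _ (right_mem_of_mem_segs hs') h)
    have hsh' : ∀ᶠ ε : ℝ in 𝓝[>] 0, ∀ s ∈ segs (c.line i j),
        ∀ x ∈ seg (s.1 + ε • M s.1, s.2 + ε • M s.2), x ∈ img (c.line i j) →
          M s.2 = 0 ∧ x = s.2 := by
      have := (eventually_all_finite (List.finite_toSet (segs (c.line i j)))).2 hsh
      exact this
    filter_upwards [hsh'] with ε hε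
    have hlast : ∀ s ∈ segs (c.line i j), M s.2 = 0 → s.2 = c.pos j := by
      intro s hs' h0
      by_contra hne
      exact (hMleft _ (right_mem_of_mem_segs hs') hne).ne_zero_right (u := s.1) hs' h0
    rw [hline, cross, segs_map]
    -- Only the last segment of the copy can meet the original, and only at the vertex `j`, which
    -- lies on just one segment of the original.
    have hcount : ∀ T : List (Plane × Plane), T.Nodup → (∀ s ∈ T, s ∈ segs (c.line i j)) →
        crossS (T.map (Prod.map (fun x => x + ε • M x) fun x => x + ε • M x))
          (segs (c.line i j)) ≤ 1 := by
      intro T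
      induction T with
      | nil => intro _ _; simp [crossS]
      | cons s T ih =>
        intro hT hsub
        rw [List.nodup_cons] at hT
        rw [List.map_cons, crossS_cons]
        have hsT := hsub s (by simp)
        have hprop := hε s hsT
        by_cases hM0 : M s.2 = 0
        · have hsj := hlast s hsT hM0
          have h1 : crossS (T.map (Prod.map (fun x => x + ε • M x) fun x => x + ε • M x))
              (segs (c.line i j)) = 0 := by
            rw [crossS_eq_zero]
            rintro s' hs' t ht ⟨x, hx1, hx2⟩
            obtain ⟨r, hr, rfl⟩ := List.mem_map.1 hs'
            have hrT := hsub r (List.mem_cons_of_mem _ hr)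
            have := hlast r hrT (hε r hrT x hx1 ⟨t, ht, hx2⟩).1
            exact hT.1 (segs_left_unique hnd hsT hrT (hsj.trans this.symm) ▸ hr)
          rw [h1, add_zero]
          refine crossS_single_le_one (segs_nodup hnd) ?_
          rintro t ht t' ht' ⟨x, hx1, hx2⟩ ⟨y, hy1, hy2⟩
          obtain rfl := (hprop x hx1 ⟨t, ht, hx2⟩).2
          obtain rfl := (hprop y hy1 ⟨t', ht', hy2⟩).2
          by_contra hne
          rw [hsj] at hx2 hy2
          rcases hsi.inter t ht t' ht' hne _ hx2 hy2 with ⟨-, h⟩ | ⟨h, -⟩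
          · exact hout t'.2 (by rw [h]; exact ht')
          · exact hout t.2 (by rw [h]; exact ht)
        · have h1 : crossS [Prod.map (fun x => x + ε • M x) (fun x => x + ε • M x) s]
              (segs (c.line i j)) = 0 := by
            rw [crossS_eq_zero]
            rintro s' hs' t ht ⟨x, hx1, hx2⟩
            rw [List.mem_singleton.1 hs'] at hx1
            exact hM0 (hprop x hx1 ⟨t, ht, hx2⟩).1
          rw [h1, zero_add]
          exact ih hT.2 fun r hr => hsub r (List.mem_cons_of_mem _ hr)
    exact hcount _ (segs_nodup hnd) fun _ h => h
  have hall : ∀ᶠ ε in 𝓝[>] (0 : ℝ), (∀ u w k l, u ≠ w → k ≠ l →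
      cross ((C ε).line u w) ((C ε).line k l) ≤
        cross (c.line (if u = v then i else u) (if w = v then i else w))
            (c.line (if k = v then i else k) (if l = v then i else l))) ∧
      ∀ j, j ≠ v → j ≠ i → cross ((C ε).line v j) (c.line i j) ≤ 1 := by
    refine Filter.Eventually.and ?_ ?_
    · simp only [eventually_all]
      exact husc
    · simp only [eventually_all]
      exact hpar
  obtain ⟨ε, h1, h2⟩ := hall.exists
  obtain ⟨c₁, g1, g2, -⟩ := (C ε).exists_generic
  obtain ⟨c₂, r1, r2, r3, -⟩ := g1.exists_simple
  have hle : ∀ {u w k l}, u ≠ w → k ≠ l → s(u, w) ≠ s(k, l) →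
      cross (c₂.line u w) (c₂.line k l) ≤ cross ((C ε).line u w) ((C ε).line k l) :=
    fun huw hkl hne => cross_line_le (fun e f hef => (r3 e f hef).trans (g2 e f)) huw hkl hne
  refine ⟨c₂, r1, r2, fun u w k l huw hkl hne => (hle huw hkl hne).trans (h1 u w k l huw hkl),
    fun j hjv hji => ?_⟩
  refine (hle hjv.symm hji.symm ?_).trans ?_
  · simp [hiv.symm, hjv.symm]
  · rw [hCo ε i j hiv hjv]
    exact h2 j hjv hji

/-- The edges between the vertices of `A` cross at most once, and they are disjoint unless `M`
allows them to meet. -/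
def CrossesWithin (c : Config V) (M : Sym2 V → Sym2 V → Prop) (A : Set V) : Prop :=
  ∀ u ∈ A, ∀ w ∈ A, ∀ k ∈ A, ∀ l ∈ A, u ≠ w → k ≠ l → s(u, w) ≠ s(k, l) →
    cross (c.line u w) (c.line k l) ≤ 1 ∧
      (¬ M s(u, w) s(k, l) → cross (c.line u w) (c.line k l) = 0)

/-- If every vertex looks like one of the vertices of `A`, as far as the relation `M` is concerned,
then a drawing of the complete graph on `A` extends to all vertices. -/
theorem Generic.exists_crossesWithin_univ [Fintype V] {M : Sym2 V → Sym2 V → Prop}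
    (hM : ∀ e f, M e f → M f e) (hM₁ : ∀ x e f, x ∈ e → x ∈ f → M e f) {A : Set V} {ρ : V → V}
    (hρ : ∀ v, ρ v ∈ A) (hM₂ : ∀ v j e, M s(ρ v, j) e → M s(v, j) e) (hc : c.Generic)
    (hs : ∀ e, IsSimpleLine (c.poly e)) (hA : c.CrossesWithin M A) :
    ∃ c' : Config V, c'.Generic ∧ (∀ e, IsSimpleLine (c'.poly e)) ∧ c'.CrossesWithin M univ := by
  classical
  suffices h : ∀ S : Finset V, ∃ c' : Config V, c'.Generic ∧ (∀ e, IsSimpleLine (c'.poly e)) ∧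
      c'.CrossesWithin M (A ∪ S) by
    obtain ⟨c', h1, h2, h3⟩ := h Finset.univ
    exact ⟨c', h1, h2, by simpa using h3⟩
  intro S
  induction S using Finset.induction_on with
  | empty => exact ⟨c, hc, hs, by simpa using hA⟩
  | insert v S hv ih =>
    obtain ⟨c₁, h1, h2, h3⟩ := ih
    by_cases hvA : v ∈ A
    · refine ⟨c₁, h1, h2, ?_⟩
      have : A ∪ ((insert v S : Finset V) : Set V) = A ∪ S := by
        ext x
        simp only [Finset.coe_insert, mem_union, mem_insert_iff]
        constructor
        · rintro (h | rfl | h)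
          exacts [Or.inl h, Or.inl hvA, Or.inr h]
        · rintro (h | h)
          exacts [Or.inl h, Or.inr (Or.inr h)]
      rwa [this]
    have hiv : ρ v ≠ v := fun h => hvA (h ▸ hρ v)
    obtain ⟨c₂, k1, k2, k3, k4⟩ := h1.exists_clone h2 hiv
    refine ⟨c₂, k1, k2, ?_⟩
    set i := ρ v with hi
    have hmem : ∀ u ∈ A ∪ ((insert v S : Finset V) : Set V),
        (if u = v then i else u) ∈ A ∪ (S : Set V) := by
      intro u hu
      split_ifs with h
      · exact Or.inl (hρ v)
      · rcases hu with hu | hu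
        · exact Or.inl hu
        · exact Or.inr (Finset.mem_of_mem_insert_of_ne hu h)
    have hMτ : ∀ u w e, M s(if u = v then i else u, if w = v then i else w) e → M s(u, w) e := by
      have step : ∀ u w e, M s(if u = v then i else u, w) e → M s(u, w) e := by
        intro u w e h
        split_ifs at h with hu
        · subst hu; exact hM₂ u w e h
        · exact h
      intro u w e h
      have := step u _ e h
      rw [Sym2.eq_swap] at this ⊢
      exact step w u e this
    -- The edge between `v` and `i` degenerates to the point of `i`. It can meet another edge only
    -- if that edge ends at `v` or `i`, in which case `hM₁` permits the meeting.
    have hdiag : ∀ u w k l, u ≠ w → k ≠ l → s(u, w) ≠ s(k, l) →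
        k ∈ A ∪ ((insert v S : Finset V) : Set V) → l ∈ A ∪ ((insert v S : Finset V) : Set V) →
        (if u = v then i else u) = (if w = v then i else w) →
        cross (c₂.line u w) (c₂.line k l) ≤ 1 ∧
          (¬ M s(u, w) s(k, l) → cross (c₂.line u w) (c₂.line k l) = 0) := by
      intro u w k l huw hkl hne hk hl heq
      have hcl := k3 u w k l huw hkl hne
      have huw' : s(u, w) = s(v, i) := by
        split_ifs at heq with h h' h'
        · exact absurd (h.trans h'.symm) huw
        · rw [h, heq]
        · rw [h', ← heq, Sym2.eq_swap]
        · exact absurd heq huw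
      rw [← heq] at hcl
      have hui : (if u = v then i else u) = i := by
        clear hcl
        by_cases h : u = v
        · exact if_pos h
        · rw [if_neg h] at heq ⊢
          by_cases h' : w = v
          · rwa [if_pos h'] at heq
          · rw [if_neg h'] at heq
            exact absurd heq huw
      have hii : c₁.line i i = [c₁.pos i, c₁.pos i] := by rw [line, bendsFrom_self]; rfl
      rw [hui, hii] at hcl
      have hkl' : (if k = v then i else k) ≠ (if l = v then i else l) := by
        intro h
        have : s(k, l) = s(v, i) := by
          split_ifs at h with h1 h2 h2
          · exact absurd (h1.trans h2.symm) hkl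
          · rw [h1, h]
          · rw [h2, ← h, Sym2.eq_swap]
          · exact absurd h hkl
        exact hne (huw'.trans this.symm)
      by_cases hki : (if k = v then i else k) = i
      · rw [hki] at hcl hkl'
        have := cross_point_line_le_one h2 hkl'
        refine ⟨hcl.trans this, fun hn => absurd ?_ hn⟩
        rw [huw']
        refine hM₁ k _ _ ?_ (by simp)
        split_ifs at hki with h
        · simp [h]
        · simp [hki]
      by_cases hli : (if l = v then i else l) = i
      · rw [hli] at hcl hkl'
        have := cross_point_line_le_one h2 hkl'.symm
        rw [← c₁.cross_line_symm_right i] at this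
        refine ⟨hcl.trans this, fun hn => absurd ?_ hn⟩
        rw [huw']
        refine hM₁ l _ _ ?_ (by simp)
        split_ifs at hli with h
        · simp [h]
        · simp [hli]
      · have h0 := h1.pos_notMem_img_line hkl' (Ne.symm hki) (Ne.symm hli)
        rw [← cross_point_eq_zero] at h0
        rw [h0] at hcl
        omega
    intro u hu w hw k hk l hl huw hkl hne
    by_cases hd1 : (if u = v then i else u) = (if w = v then i else w)
    · exact hdiag u w k l huw hkl hne hk hl hd1
    by_cases hd2 : (if k = v then i else k) = (if l = v then i else l)
    · obtain ⟨g1, g2⟩ := hdiag k l u w hkl huw hne.symm hu hw hd2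
      rw [cross_comm]
      exact ⟨g1, fun hn => g2 fun h => hn (hM _ _ h)⟩
    -- Different edges with the same limit are the two edges that join `v` and `i` to a common third
    -- vertex. They are parallel copies that meet at most once, and their common vertex permits it.
    by_cases hsame : s(if u = v then i else u, if w = v then i else w) =
        s(if k = v then i else k, if l = v then i else l)
    · have hpar : ∀ j, j ≠ v → j ≠ i → ∀ a b a' b', s(a, b) = s(v, j) → s(a', b') = s(i, j) →
          cross (c₂.line a b) (c₂.line a' b') ≤ 1 ∧ M s(a, b) s(a', b') ∧ M s(a', b') s(a, b) := by
        intro j hjv hji a b a' b' h h'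
        rw [cross_line_congr h, cross_comm, cross_line_congr h', cross_comm, h, h']
        exact ⟨k4 j hjv hji, hM₁ j _ _ (by simp) (by simp), hM₁ j _ _ (by simp) (by simp)⟩
      have hcase : ∃ j, j ≠ v ∧ j ≠ i ∧ ((s(u, w) = s(v, j) ∧ s(k, l) = s(i, j)) ∨
          (s(u, w) = s(i, j) ∧ s(k, l) = s(v, j))) := by
        have hvi := hiv.symm
        clear hpar hdiag hMτ hmem k3 k4 h3
        simp only [Ne, Sym2.eq_iff] at hne hsame ⊢
        by_cases hu : u = v
        · exact ⟨w, by grind⟩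
        by_cases hw : w = v
        · exact ⟨u, by grind⟩
        by_cases hk : k = v
        · exact ⟨l, by grind⟩
        by_cases hl : l = v
        · exact ⟨k, by grind⟩
        · simp only [if_neg hu, if_neg hw, if_neg hk, if_neg hl] at hsame
          exact absurd hsame hne
      obtain ⟨j, hjv, hji, ⟨e1, e2⟩ | ⟨e1, e2⟩⟩ := hcase
      · obtain ⟨g1, g2, -⟩ := hpar j hjv hji u w k l e1 e2
        exact ⟨g1, fun hn => absurd g2 hn⟩
      · obtain ⟨g1, -, g2⟩ := hpar j hjv hji k l u w e2 e1
        rw [cross_comm]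
        exact ⟨g1, fun hn => absurd g2 hn⟩
    · have hcl := k3 u w k l huw hkl hne
      obtain ⟨g1, g2⟩ := h3 _ (hmem u hu) _ (hmem w hw) _ (hmem k hk) _ (hmem l hl) hd1 hd2 hsame
      refine ⟨hcl.trans g1, fun hn => ?_⟩
      have := g2 fun h => hn (hMτ _ _ _ (hM _ _ (hMτ _ _ _ (hM _ _ h))))
      omega

end Config

/-! ### Approximation of curves by polygonal lines -/

/-- Walks of minimal length from `a` to `b` along a relation visit every clique at most twice, and
successively. -/
theorem exists_short_chain {α : Type*} {r : α → α → Prop} {a b : α}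
    (h : Relation.ReflTransGen r a b) : ∃ l : List α, l.head? = some a ∧ l.getLast? = some b ∧
      l.IsChain r ∧ ∀ s : Set α, (∀ x ∈ s, ∀ y ∈ s, r x y) →
        ∀ A x y B, l = A ++ x :: y :: B → x ∈ s → ∀ t ∈ segs (y :: B), t.2 ∉ s := by
  obtain ⟨l₀, hl₀, hb⟩ := List.exists_isChain_cons_of_relationReflTransGen h
  have hne : {l : List α | l.head? = some a ∧ l.getLast? = some b ∧ l.IsChain r}.Nonempty :=
    ⟨a :: l₀, rfl, by rw [← hb, List.getLast?_eq_getLast_of_ne_nil], hl₀⟩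
  obtain ⟨l, ⟨h1, h2, h3⟩, hmin⟩ := (measure List.length).wf.has_min _ hne
  refine ⟨l, h1, h2, h3, fun s hs A x y B hl hx t ht hts => ?_⟩
  obtain ⟨C, D, hCD⟩ := mem_segs_iff.1 ht
  have hl' : l = (A ++ x :: C ++ [t.1]) ++ t.2 :: D := by rw [hl, hCD]; simp
  -- Going from `x` straight to a later member of the clique would shorten the walk.
  refine hmin (A ++ x :: t.2 :: D) ⟨?_, ?_, ?_⟩ ?_
  · rw [← h1, hl]
    cases A <;> simp
  · rw [← h2, hl']
    simp [List.getLast?_append, List.getLast?_cons]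
  · rw [List.isChain_append_cons_cons]
    refine ⟨?_, hs x hx _ hts, ?_⟩
    · rw [hl, List.isChain_append_cons_cons] at h3
      exact h3.1
    · rw [hl', List.isChain_append] at h3
      exact h3.2.1
  · change (A ++ x :: t.2 :: D).length < l.length
    rw [hl']
    simp

theorem exists_of_segs_eq {α : Type*} {l : List α} {A B : List (α × α)} {s : α × α}
    (h : segs l = A ++ s :: B) :
    ∃ l₁ l₂, l = l₁ ++ s.1 :: s.2 :: l₂ ∧ B = segs (s.2 :: l₂) := by
  induction l generalizing A with
  | nil => simp at h
  | cons a l ih =>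
    cases l with
    | nil => simp at h
    | cons b l =>
      rw [segs_cons_cons] at h
      cases A with
      | nil =>
        simp only [List.nil_append, List.cons.injEq] at h
        obtain ⟨rfl, h⟩ := h
        exact ⟨[], l, rfl, h.symm⟩
      | cons t A =>
        simp only [List.cons_append, List.cons.injEq] at h
        obtain ⟨l₁, l₂, h1, h2⟩ := ih h.2
        exact ⟨a :: l₁, l₂, by rw [h1]; rfl, h2⟩

theorem sum_indicator_le_one {α : Type*} {S : List α} {p : α → Prop} [DecidablePred p]
    (h : ∀ A s B, S = A ++ s :: B → p s → ∀ t ∈ B, ¬ p t) :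
    (S.map fun s => if p s then 1 else 0).sum ≤ 1 := by
  induction S with
  | nil => simp
  | cons s S ih =>
    rw [List.map_cons, List.sum_cons]
    by_cases hs : p s
    · have h0 : (S.map fun s => if p s then 1 else 0).sum = 0 := by
        rw [List.sum_eq_zero_iff]
        intro x hx
        obtain ⟨t, ht, rfl⟩ := List.mem_map.1 hx
        exact if_neg (h [] s S rfl hs t ht)
      rw [h0, if_pos hs]
    · rw [if_neg hs, zero_add]
      exact ih fun A t B hS => h (s :: A) t B (by rw [hS]; rfl)

/-- A bound for the number of crossings if any two crossing segments are close to a common one of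
finitely many places, and each of the two families has at most one segment at each place. -/
theorem crossS_le_card {X : Type*} [DecidableEq X] {S T : List (Plane × Plane)} (F : Finset X)
    (P : X → Plane × Plane → Prop) [∀ x, DecidablePred (P x)]
    (hS : ∀ x, (S.map fun s => if P x s then 1 else 0).sum ≤ 1)
    (hT : ∀ x, (T.map fun s => if P x s then 1 else 0).sum ≤ 1)
    (h : ∀ s ∈ S, ∀ t ∈ T, Meet s t → ∃ x ∈ F, P x s ∧ P x t) : crossS S T ≤ F.card := by
  have key : ∀ S' T' : List (Plane × Plane), (∀ s ∈ S', s ∈ S) → (∀ t ∈ T', t ∈ T) →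
      crossS S' T' ≤ ∑ x ∈ F, (S'.map fun s => if P x s then 1 else 0).sum *
        (T'.map fun s => if P x s then 1 else 0).sum := by
    have one : ∀ s ∈ S, ∀ T' : List (Plane × Plane), (∀ t ∈ T', t ∈ T) →
        crossS [s] T' ≤ ∑ x ∈ F, (if P x s then 1 else 0) *
          (T'.map fun s => if P x s then 1 else 0).sum := by
      intro s hs T'
      induction T' with
      | nil => intro _; simp [crossS]
      | cons t T' ih =>
        intro hT'
        have h1 := ih fun t ht => hT' t (List.mem_cons_of_mem _ ht)
        have h2 : crossS [s] (t :: T') = meets s t + crossS [s] T' := by simp [crossS]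
        have h3 : meets s t ≤ ∑ x ∈ F, (if P x s then 1 else 0) * (if P x t then 1 else 0) := by
          by_cases hm : Meet s t
          · obtain ⟨x, hx, hxs, hxt⟩ := h s hs t (hT' t (by simp)) hm
            rw [meets_eq_one hm]
            refine le_trans ?_ (Finset.single_le_sum (fun _ _ => Nat.zero_le _) hx)
            simp [hxs, hxt]
          · rw [meets_eq_zero hm]
            exact Nat.zero_le _
        simp only [List.map_cons, List.sum_cons, mul_add, Finset.sum_add_distrib]
        omega
    intro S'
    induction S' with
    | nil => intro T' _ _; simp [crossS]
    | cons s S' ih =>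
      intro T' hS' hT'
      rw [crossS_cons]
      simp only [List.map_cons, List.sum_cons, add_mul, Finset.sum_add_distrib]
      exact add_le_add (one s (hS' s (by simp)) T' hT')
        (ih T' (fun s hs => hS' s (List.mem_cons_of_mem _ hs)) hT')
  refine (key S T (fun _ h => h) fun _ h => h).trans ?_
  rw [Finset.card_eq_sum_ones]
  exact Finset.sum_le_sum fun x _ => Nat.mul_le_mul (hS x) (hT x)

/-- Euclidean balls are strictly convex, so a chord touches the boundary only at its ends. -/
theorem eq_of_mem_seg_closedBall {p A B x : Plane} {r : ℝ} (hA : A ∈ Metric.closedBall p r)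
    (hB : B ∈ Metric.closedBall p r) (hx : x ∈ seg (A, B)) (hxr : x ∉ Metric.ball p r) :
    x = A ∨ x = B := by
  by_contra! hne
  have hx' : x ∈ openSegment ℝ A B := mem_openSegment_of_ne_left_right hne.1.symm hne.2.symm hx
  have hAB : A ≠ B := by
    rintro rfl
    rw [openSegment_same] at hx'
    exact hne.1 hx'
  rcases eq_or_ne r 0 with rfl | hr
  · simp only [Metric.closedBall_zero, mem_singleton_iff] at hA hB
    exact hAB (hA.trans hB.symm)
  · have := (strictConvex_closedBall ℝ p r).openSegment_subset hA hB hAB hx'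
    rw [interior_closedBall p hr] at this
    exact hxr this

/-- A segment that starts outside of a ball reaches it in a point of its boundary. -/
theorem exists_entry {p P Q : Plane} {r : ℝ} (hP : P ∉ Metric.closedBall p r)
    (hm : (seg (P, Q) ∩ Metric.closedBall p r).Nonempty) :
    ∃ A ∈ seg (P, Q), A ∈ Metric.closedBall p r ∧ Disjoint (seg (P, A)) (Metric.ball p r) := by
  set h : ℝ → ℝ := fun t => dist (P + t • (Q - P)) p with hh
  have hcont : Continuous h := by fun_prop
  have hcomp : IsCompact (Icc (0 : ℝ) 1 ∩ h ⁻¹' Iic r) :=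
    isCompact_Icc.inter_right (isClosed_Iic.preimage hcont)
  have hne : (Icc (0 : ℝ) 1 ∩ h ⁻¹' Iic r).Nonempty := by
    obtain ⟨x, hx, hxr⟩ := hm
    obtain ⟨t, ht, rfl⟩ := mem_seg_iff.1 hx
    exact ⟨t, ht, hxr⟩
  obtain ⟨T, ⟨hT, hTr⟩, hmin⟩ := hcomp.exists_isLeast hne
  refine ⟨P + T • (Q - P), mem_seg_iff.2 ⟨T, hT, rfl⟩, hTr, ?_⟩
  rw [Set.disjoint_left]
  intro x hx hxr
  obtain ⟨u, hu, rfl⟩ := mem_seg_iff.1 hx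
  have hx' : P + u • (P + T • (Q - P) - P) = P + (u * T) • (Q - P) := by
    rw [add_sub_cancel_left, smul_smul]
  simp only at hxr
  rw [hx'] at hxr
  have h0 : r < h 0 := by simpa [hh, Metric.mem_closedBall] using hP
  have huT : h (u * T) < r := hxr
  have huT0 : 0 ≤ u * T := mul_nonneg hu.1 hT.1
  obtain ⟨v, hv, hvr⟩ := intermediate_value_Ioo' huT0 hcont.continuousOn ⟨huT, h0⟩
  have huT1 : u * T ≤ T := mul_le_of_le_one_left hT.1 hu.2
  have : T ≤ v := hmin ⟨⟨hv.1.le, by linarith [hv.2, hT.2]⟩, hvr.le⟩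
  linarith [hv.2]

/-- Steps inside of `T` that are contained in one of the balls of radius `r` around the points of
`X` or avoid the interiors of all these balls. -/
def BallStep (X T : Set Plane) (r : ℝ) (A B : Plane) : Prop :=
  A ∈ T ∧ B ∈ T ∧ ((∃ p ∈ X, A ∈ Metric.closedBall p r ∧ B ∈ Metric.closedBall p r) ∨
    (seg (A, B) ⊆ T ∧ ∀ p ∈ X, Disjoint (seg (A, B)) (Metric.ball p r)))

theorem BallStep.symm {X T : Set Plane} {r : ℝ} {A B : Plane} (h : BallStep X T r A B) :
    BallStep X T r B A := by
  obtain ⟨hA, hB, ⟨p, hp, h1, h2⟩ | h⟩ := h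
  · exact ⟨hB, hA, Or.inl ⟨p, hp, h2, h1⟩⟩
  · refine ⟨hB, hA, Or.inr ?_⟩
    rwa [show seg (B, A) = seg (A, B) from seg_swap (A, B)]

/-- A segment shorter than `r` that touches one of the balls stays in the concentric ball of radius
`2 * r`, hence away from all the others. It is cut at the first and the last point in its ball, and
the middle piece becomes a chord. -/
theorem reflTransGen_ballStep_of_seg {X T : Set Plane} {r : ℝ}
    (hX : ∀ p ∈ X, ∀ q ∈ X, p ≠ q → Disjoint (Metric.closedBall p (2 * r))
      (Metric.closedBall q (2 * r))) {P Q : Plane} (hPQ : dist P Q < r) (hT : seg (P, Q) ⊆ T) :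
    Relation.ReflTransGen (BallStep X T r) P Q := by
  have hP : P ∈ seg (P, Q) := left_mem_segment ..
  have hQ : Q ∈ seg (P, Q) := right_mem_segment ..
  have hr : 0 ≤ r := dist_nonneg.trans hPQ.le
  by_cases hm : ∃ p ∈ X, (seg (P, Q) ∩ Metric.closedBall p r).Nonempty
  · obtain ⟨p, hp, y, hy, hyr⟩ := hm
    have hsub : seg (P, Q) ⊆ Metric.closedBall p (2 * r) := by
      intro x hx
      have hxy : dist x y ≤ dist P Q := by
        obtain ⟨a, ha, rfl⟩ := mem_seg_iff.1 hx
        obtain ⟨b, hb, rfl⟩ := mem_seg_iff.1 hy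
        simp only [dist_add_left]
        rw [dist_eq_norm, ← sub_smul, norm_smul, dist_comm, dist_eq_norm, Real.norm_eq_abs]
        refine mul_le_of_le_one_left (norm_nonneg _) ?_
        rw [abs_le]
        constructor <;> linarith [ha.1, ha.2, hb.1, hb.2]
      rw [Metric.mem_closedBall] at hyr ⊢
      linarith [dist_triangle x y p]
    have hother : ∀ A ∈ seg (P, Q), ∀ B ∈ seg (P, Q), Disjoint (seg (A, B)) (Metric.ball p r) →
        BallStep X T r A B := by
      intro A hA B hB hd
      refine ⟨hT hA, hT hB, Or.inr ⟨(seg_subset_of_mem hA hB).trans hT, fun q hq => ?_⟩⟩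
      by_cases hqp : q = p
      · rwa [hqp]
      · refine (hX p hp q hq (Ne.symm hqp)).mono ((seg_subset_of_mem hA hB).trans hsub) ?_
        exact Metric.ball_subset_closedBall.trans (Metric.closedBall_subset_closedBall (by linarith))
    have hentry : ∀ P' Q', P' ∈ seg (P, Q) → Q' ∈ seg (P, Q) → y ∈ seg (P', Q') →
        ∃ A ∈ seg (P, Q), A ∈ Metric.closedBall p r ∧ (P' = A ∨ BallStep X T r P' A) := by
      intro P' Q' hP' hQ' hy'
      by_cases hin : P' ∈ Metric.closedBall p r
      · exact ⟨P', hP', hin, Or.inl rfl⟩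
      · obtain ⟨A, hA, hAr, hd⟩ := exists_entry hin ⟨y, hy', hyr⟩
        have hA' := seg_subset_of_mem hP' hQ' hA
        exact ⟨A, hA', hAr, Or.inr (hother P' hP' A hA' hd)⟩
    obtain ⟨A, hA, hAr, hPA⟩ := hentry P Q hP hQ hy
    obtain ⟨B, hB, hBr, hQB⟩ := hentry Q P hQ hP (by
      rwa [show seg (Q, P) = seg (P, Q) from seg_swap (P, Q)])
    have h1 : Relation.ReflTransGen (BallStep X T r) P A := by
      rcases hPA with rfl | h
      · exact .refl
      · exact .single h
    have h2 : Relation.ReflTransGen (BallStep X T r) B Q := by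
      rcases hQB with rfl | h
      · exact .refl
      · exact .single h.symm
    exact (h1.tail ⟨hT hA, hT hB, Or.inl ⟨p, hp, hAr, hBr⟩⟩).trans h2
  · push Not at hm
    refine .single ⟨hT hP, hT hQ, Or.inr ⟨hT, fun p hp => ?_⟩⟩
    rw [Set.disjoint_iff_inter_eq_empty]
    have := hm p hp
    exact subset_eq_empty (inter_subset_inter_right _ Metric.ball_subset_closedBall) this

/-- As the unit interval is connected, it is enough to join nearby points of the curve, and the
segment between them stays in a small ball around one of them. -/
theorem reflTransGen_ballStep {X : Set Plane} {r η : ℝ} (hη : 0 < η) (hηr : η ≤ r)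
    (hX : ∀ p ∈ X, ∀ q ∈ X, p ≠ q → Disjoint (Metric.closedBall p (2 * r))
      (Metric.closedBall q (2 * r))) (c : C(I, Plane)) (s t : I) :
    Relation.ReflTransGen (BallStep X (Metric.thickening η (range c)) r) (c s) (c t) := by
  set R := Relation.ReflTransGen (BallStep X (Metric.thickening η (range c)) r) with hR
  have hsymm : ∀ x y, R x y → R y x := fun x y h => by
    induction h with
    | refl => exact .refl
    | tail _ h ih => exact ih.head h.symm
  refine PreconnectedSpace.induction₂' (fun s t : I => R (c s) (c t)) (fun s => ?_)
    ⟨fun a b d hab hbd => Relation.ReflTransGen.trans hab hbd⟩ s t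
  filter_upwards [c.continuous.continuousAt.preimage_mem_nhds (Metric.ball_mem_nhds (c s) hη)]
    with t ht
  have hd : dist (c s) (c t) < η := by rw [dist_comm]; exact ht
  have : R (c s) (c t) := by
    refine reflTransGen_ballStep_of_seg hX (hd.trans_le hηr) ?_
    have : seg (c s, c t) ⊆ Metric.ball (c s) η :=
      (convex_ball (c s) η).segment_subset (Metric.mem_ball_self hη) ht
    exact this.trans (Metric.ball_subset_thickening (mem_range_self s) η)
  exact ⟨this, hsymm _ _ this⟩

/-- Finitely many curves with finitely many pairwise common points can be replaced with polygonal
lines, without more crossings. -/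
theorem exists_polygonal {ι : Type*} [Finite ι] (c : ι → C(I, Plane))
    (hc : ∀ e f, e ≠ f → (range (c e) ∩ range (c f)).Finite) :
    ∃ L : ι → List Plane, (∀ e, (L e).head? = some (c e 0)) ∧
      (∀ e, (L e).getLast? = some (c e 1)) ∧
      ∀ e f, e ≠ f → cross (L e) (L f) ≤ (range (c e) ∩ range (c f)).ncard := by
  classical
  set X : Set Plane := ⋃ e : ι × ι, if e.1 = e.2 then ∅ else range (c e.1) ∩ range (c e.2) with hX
  have hXf : X.Finite := by
    refine Set.finite_iUnion fun e => ?_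
    split_ifs with h
    · exact Set.finite_empty
    · exact hc _ _ h
  have hXmem : ∀ e f, e ≠ f → range (c e) ∩ range (c f) ⊆ X := by
    intro e f hef x hx
    exact mem_iUnion.2 ⟨(e, f), by simpa [hef] using hx⟩
  have hcl : ∀ e, IsClosed (range (c e)) := fun e => (isCompact_range (c e).continuous).isClosed
  have hev : ∀ᶠ r : ℝ in 𝓝[>] 0, (∀ p ∈ X, ∀ q ∈ X, p ≠ q →
      Disjoint (Metric.closedBall p (2 * r)) (Metric.closedBall q (2 * r))) ∧
      ∀ e, ∀ p ∈ X, p ∉ range (c e) → Disjoint (Metric.closedBall p (2 * r)) (range (c e)) := by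
    refine .and ?_ ?_
    · refine (eventually_all_finite hXf).2 fun p _ => (eventually_all_finite hXf).2 fun q _ => ?_
      by_cases hpq : p = q
      · exact .of_forall fun _ h => absurd hpq h
      · filter_upwards [Ioo_mem_nhdsGT (show (0 : ℝ) < dist p q / 4 by
          have := dist_pos.2 hpq; positivity)] with r hr _
        exact Metric.closedBall_disjoint_closedBall (by linarith [hr.2])
    · refine eventually_all.2 fun e => (eventually_all_finite hXf).2 fun p _ => ?_
      by_cases hp : p ∈ range (c e)
      · exact .of_forall fun _ h => absurd hp h
      · obtain ⟨ε, hε, hball⟩ := Metric.isOpen_iff.1 (hcl e).isOpen_compl p hp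
        filter_upwards [Ioo_mem_nhdsGT (show (0 : ℝ) < ε / 2 by positivity)] with r hr _
        refine Set.disjoint_left.2 fun x hx hxe => hball ?_ hxe
        rw [Metric.mem_closedBall] at hx
        rw [Metric.mem_ball]
        linarith [hr.2]
  obtain ⟨r, ⟨hr1, hr2⟩, hr⟩ := (hev.and self_mem_nhdsWithin).exists
  -- Away from the common points the curves are disjoint compact sets, so sufficiently thin
  -- neighbourhoods of them are disjoint.
  set K : ι → Set Plane := fun e => range (c e) \ ⋃ p ∈ X, Metric.ball p (r / 2) with hK
  have hKc : ∀ e, IsCompact (K e) := fun e =>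
    (isCompact_range (c e).continuous).diff (isOpen_biUnion fun p _ => Metric.isOpen_ball)
  have hKd : ∀ e f, e ≠ f → Disjoint (K e) (K f) := by
    intro e f hef
    refine Set.disjoint_left.2 fun x hx hx' => hx.2 ?_
    exact mem_iUnion₂.2 ⟨x, hXmem e f hef ⟨hx.1, hx'.1⟩, Metric.mem_ball_self (by positivity)⟩
  have hev' : ∀ᶠ η : ℝ in 𝓝[>] 0, (∀ e f, e ≠ f →
      Disjoint (Metric.thickening η (K e)) (Metric.thickening η (K f))) ∧ η < r / 2 := by
    refine .and ?_ ?_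
    · refine eventually_all.2 fun e => eventually_all.2 fun f => ?_
      by_cases hef : e = f
      · exact .of_forall fun _ h => absurd hef h
      · obtain ⟨δ, hδ, hd⟩ := (hKd e f hef).exists_thickenings (hKc e) (hKc f).isClosed
        filter_upwards [Ioo_mem_nhdsGT hδ] with η hη _
        exact hd.mono (Metric.thickening_mono hη.2.le _) (Metric.thickening_mono hη.2.le _)
    · filter_upwards [Ioo_mem_nhdsGT (show (0 : ℝ) < r / 2 by positivity)] with η hη using hη.2
  obtain ⟨η, ⟨hη1, hη2⟩, hη⟩ := (hev'.and self_mem_nhdsWithin).exists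
  set T : ι → Set Plane := fun e => Metric.thickening η (range (c e)) with hT
  have hTK : ∀ e x, x ∈ T e → (∀ p ∈ X, x ∉ Metric.ball p r) → x ∈ Metric.thickening η (K e) := by
    intro e x hx hxr
    obtain ⟨y, hy, hxy⟩ := Metric.mem_thickening_iff.1 hx
    refine Metric.mem_thickening_iff.2 ⟨y, ⟨hy, fun hyX => ?_⟩, hxy⟩
    obtain ⟨p, hp, hyp⟩ := mem_iUnion₂.1 hyX
    refine hxr p hp ?_
    rw [Metric.mem_ball] at hyp ⊢
    linarith [dist_triangle x y p]
  have hout : ∀ e f, e ≠ f → ∀ x, x ∈ T e → x ∈ T f → ∃ p ∈ X, x ∈ Metric.ball p r := by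
    intro e f hef x hxe hxf
    by_contra! hx
    exact Set.disjoint_left.1 (hη1 e f hef) (hTK e x hxe hx) (hTK f x hxf hx)
  have hTX : ∀ e, ∀ p ∈ X, ∀ x, x ∈ T e → x ∈ Metric.closedBall p r → p ∈ range (c e) := by
    intro e p hp x hx hxp
    by_contra hpe
    obtain ⟨y, hy, hxy⟩ := Metric.mem_thickening_iff.1 hx
    refine Set.disjoint_left.1 (hr2 e p hp hpe) ?_ hy
    rw [Metric.mem_closedBall] at hxp ⊢
    linarith [dist_triangle y x p, dist_comm x y]
  -- Any two points of the neighbourhood in the same ball are one step apart, so a shortest walk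
  -- contains at most one chord of each ball.
  have hwalk := fun e => exists_short_chain
    (reflTransGen_ballStep hη (by linarith : η ≤ r) hr1 (c e) 0 1)
  choose L hL0 hL1 hLc hLs using hwalk
  refine ⟨L, hL0, hL1, fun e f hef => ?_⟩
  set P : Plane → Plane × Plane → Prop := fun p s =>
    s.1 ∈ Metric.closedBall p r ∧ s.2 ∈ Metric.closedBall p r with hP
  have hstep : ∀ e, ∀ s ∈ segs (L e), BallStep X (T e) r s.1 s.2 := by
    intro e s hs
    obtain ⟨A, B, hAB⟩ := mem_segs_iff.1 hs
    have := hLc e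
    rw [hAB, List.isChain_append_cons_cons] at this
    exact this.2.1
  set F : Finset Plane := (hc e f hef).toFinset with hF
  have hFX : ∀ p, p ∈ F ↔ p ∈ range (c e) ∧ p ∈ range (c f) := by simp [hF]
  have hcount : ∀ e, ∀ p : {p // p ∈ X},
      ((segs (L e)).map fun s => if P p.1 s then 1 else 0).sum ≤ 1 := by
    rintro e ⟨p, hp⟩
    refine sum_indicator_le_one fun A s B hAB hs t ht htp => ?_
    obtain ⟨l₁, l₂, h1, rfl⟩ := exists_of_segs_eq hAB
    refine hLs e (Metric.closedBall p r ∩ T e) (fun x hx y hy => ?_) l₁ s.1 s.2 l₂ h1 ?_ t ht ?_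
    · exact ⟨hx.2, hy.2, Or.inl ⟨p, hp, hx.1, hy.1⟩⟩
    · exact ⟨hs.1, (hstep e s (by rw [hAB]; simp)).1⟩
    · exact ⟨htp.2, (hstep e t (by rw [hAB]; simp [ht])).2.1⟩
  -- If the first step avoids the open balls, so does the common point. A chord of the second curve
  -- reaches such a point only at an end, so the point lies in both thin neighbourhoods, which are
  -- disjoint outside the balls.
  have hchord : ∀ e f, e ≠ f → ∀ s, BallStep X (T e) r s.1 s.2 → ∀ t, BallStep X (T f) r t.1 t.2 →
      ∀ x, x ∈ seg s → x ∈ seg t → ∃ p ∈ X, P p s := by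
    rintro e f hef s ⟨-, -, ⟨p, hp, h⟩ | ⟨hsT, hsd⟩⟩ t ⟨ht1, ht2, ht⟩ x hxs hxt
    · exact ⟨p, hp, h⟩
    · have hxout : ∀ p ∈ X, x ∉ Metric.ball p r := fun p hp => Set.disjoint_left.1 (hsd p hp) hxs
      have hxf : x ∈ T f := by
        rcases ht with ⟨q, hq, hq1, hq2⟩ | ⟨htT, -⟩
        · rcases eq_of_mem_seg_closedBall hq1 hq2 hxt (hxout q hq) with rfl | rfl
          · exact ht1
          · exact ht2
        · exact htT hxt
      obtain ⟨p, hp, hxp⟩ := hout e f hef x (hsT hxs) hxf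
      exact absurd hxp (hxout p hp)
  have hmeet : ∀ s ∈ segs (L e), ∀ t ∈ segs (L f), Meet s t →
      ∃ p : {p // p ∈ X}, p ∈ F.subtype (· ∈ X) ∧ P p.1 s ∧ P p.1 t := by
    rintro s hs t ht ⟨x, hxs, hxt⟩
    have hss := hstep e s hs
    have hst := hstep f t ht
    obtain ⟨p, hp, hps⟩ := hchord e f hef s hss t hst x hxs hxt
    obtain ⟨q, hq, hqt⟩ := hchord f e hef.symm t hst s hss x hxt hxs
    have hpq : p = q := by
      by_contra hpq
      have hb : ∀ z : Plane, Metric.closedBall z r ⊆ Metric.closedBall z (2 * r) := fun z =>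
        Metric.closedBall_subset_closedBall (by linarith)
      exact Set.disjoint_left.1 (hr1 p hp q hq hpq)
        (hb p ((convex_closedBall p r).segment_subset hps.1 hps.2 hxs))
        (hb q ((convex_closedBall q r).segment_subset hqt.1 hqt.2 hxt))
    subst hpq
    refine ⟨⟨p, hp⟩, ?_, hps, hqt⟩
    rw [Finset.mem_subtype, hFX]
    exact ⟨hTX e p hp _ hss.1 hps.1, hTX f p hp _ hst.1 hqt.1⟩
  -- Meeting steps are chords of the same ball, centred at a common point of the two curves, and
  -- each line has at most one chord there.
  refine (crossS_le_card (F.subtype (· ∈ X)) (fun p s => P p.1 s) (hcount e) (hcount f)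
    hmeet).trans ?_
  rw [Set.ncard_eq_toFinset_card _ (hc e f hef)]
  rw [Finset.card_subtype]
  exact Finset.card_filter_le _ _

/-! ### From polygonal lines to drawings -/

theorem Path.injective_trans {X : Type*} [TopologicalSpace X] {a b d : X} {γ : Path a b}
    {δ : Path b d} (hγ : Function.Injective γ) (hδ : Function.Injective δ)
    (h : range γ ∩ range δ ⊆ {b}) : Function.Injective (γ.trans δ) := by
  have key : ∀ s t : I, (s : ℝ) ≤ 1 / 2 → ¬ (t : ℝ) ≤ 1 / 2 → (γ.trans δ) s ≠ (γ.trans δ) t := by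
    intro s t hs ht hst
    rw [Path.trans_apply, Path.trans_apply, dif_pos hs, dif_neg ht] at hst
    have hb := h ⟨⟨_, hst⟩, mem_range_self _⟩
    have := congrArg Subtype.val (hδ ((mem_singleton_iff.1 hb).trans δ.source.symm))
    simp only [Icc.coe_zero] at this
    exact ht (by linarith)
  intro s t hst
  by_cases hs : (s : ℝ) ≤ 1 / 2 <;> by_cases ht : (t : ℝ) ≤ 1 / 2
  · rw [Path.trans_apply, Path.trans_apply, dif_pos hs, dif_pos ht] at hst
    have := congrArg Subtype.val (hγ hst)
    exact Subtype.ext (by simpa using this)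
  · exact absurd hst (key s t hs ht)
  · exact absurd hst.symm (key t s ht hs)
  · rw [Path.trans_apply, Path.trans_apply, dif_neg hs, dif_neg ht] at hst
    have := congrArg Subtype.val (hδ hst)
    exact Subtype.ext (by simpa using this)

theorem injective_segment {a b : Plane} (h : a ≠ b) : Function.Injective (Path.segment a b) := by
  intro s t hst
  simp only [Path.segment_apply] at hst
  exact Subtype.ext (AffineMap.lineMap_injective ℝ h hst)

theorem IsSimpleLine.tail {a b : Plane} {l : List Plane} (h : IsSimpleLine (a :: b :: l)) :
    IsSimpleLine (b :: l) :=
  ⟨h.nodup.of_cons, fun s hs t ht => h.inter s (by simp [hs]) t (by simp [ht])⟩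

theorem IsSimpleLine.exists_path {a b : Plane} {l : List Plane}
    (h : IsSimpleLine (a :: l)) (hl : l.getLast? = some b) :
    ∃ γ : Path a b, Function.Injective γ ∧ range γ = img (a :: l) := by
  induction l generalizing a with
  | nil => simp at hl
  | cons d l ih =>
    have had : a ≠ d := by
      have := h.nodup
      simp only [List.nodup_cons, List.mem_cons, not_or] at this
      exact this.1.1
    cases l with
    | nil =>
      simp only [List.getLast?_singleton, Option.some.injEq] at hl
      subst hl
      refine ⟨Path.segment a d, injective_segment had, ?_⟩
      rw [Path.range_segment, img_cons_cons]
      simp [img]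
    | cons e l =>
      obtain ⟨γ, h1, h2⟩ := ih h.tail (by simpa using hl)
      refine ⟨(Path.segment a d).trans γ, Path.injective_trans (injective_segment had) h1 ?_, ?_⟩
      · rintro x ⟨hx, hx'⟩
        rw [Path.range_segment] at hx
        rw [h2] at hx'
        obtain ⟨t, ht, hxt⟩ := hx'
        have hne : (a, d) ≠ t := by
          rintro rfl
          have := left_mem_of_mem_segs ht
          exact (List.nodup_cons.1 h.nodup).1 this
        rcases h.inter (a, d) (by simp) t (by rw [segs_cons_cons]; exact List.mem_cons_of_mem _ ht)
          hne x hx hxt with ⟨h, -⟩ | ⟨h3, h4⟩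
        · exact h
        · have hm := right_mem_of_mem_segs ht
          rw [← h4, h3] at hm
          exact absurd hm (List.nodup_cons.1 h.nodup).1
      · rw [Path.trans_range, h2, Path.range_segment, img_cons_cons a d]

/-- Closer to `p` than the nearer end, the segment coincides with its line; the radius used is the
distance to that end. -/
theorem eventually_mem_seg_iff {s : Plane × Plane} {p : Plane} (hp : p ∈ seg s) (h₁ : p ≠ s.1)
    (h₂ : p ≠ s.2) : ∀ᶠ q in 𝓝 p, q ∈ seg s ↔ wedge (s.2 - s.1) (q - p) = 0 := by
  obtain ⟨T, hT, rfl⟩ := mem_seg_iff.1 hp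
  set u := s.2 - s.1 with hu
  have hT0 : 0 < T := lt_of_le_of_ne hT.1 fun h => h₁ (by simp [← h])
  have hT1 : T < 1 := lt_of_le_of_ne hT.2 fun h => h₂ (by simp [h, hu])
  have hu0 : u ≠ 0 := by
    intro h
    exact h₁ (by simp [h])
  have hpos : 0 < min T (1 - T) * ‖u‖ :=
    mul_pos (lt_min hT0 (by linarith)) (norm_pos_iff.2 hu0)
  filter_upwards [Metric.ball_mem_nhds _ hpos] with q hq
  constructor
  · intro h
    have h1 := wedge_of_mem_seg h
    have h2 := wedge_of_mem_seg hp
    rw [← hu] at h1 h2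
    have : q - (s.1 + T • u) = (q - s.1) - (s.1 + T • u - s.1) := by abel
    rw [this, wedge_sub_right, h1, h2, sub_zero]
  · intro h
    obtain ⟨κ, hκ⟩ := exists_smul_of_wedge_eq_zero hu0 h
    rw [Metric.mem_ball, dist_eq_norm, hκ, norm_smul, Real.norm_eq_abs] at hq
    have := lt_of_mul_lt_mul_right hq (norm_nonneg u)
    rw [abs_lt] at this
    have h1 := min_le_left T (1 - T)
    have h2 := min_le_right T (1 - T)
    refine mem_seg_iff.2 ⟨T + κ, ⟨by linarith [this.1], by linarith [this.2]⟩, ?_⟩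
    rw [← hu, add_smul, ← hκ]
    abel

/-- Affine coordinates with respect to two independent directions. -/
noncomputable def wedgeHomeomorph (p u v : Plane) (h : wedge u v ≠ 0) : Plane ≃ₜ ℝ × ℝ where
  toFun q := (wedge (q - p) v / wedge u v, wedge u (q - p) / wedge u v)
  invFun x := p + x.1 • u + x.2 • v
  left_inv q := by
    simp only
    refine Plane.ext' ?_ ?_ <;>
    · simp only [PiLp.add_apply, PiLp.smul_apply, smul_eq_mul]
      field_simp
      simp only [wedge, PiLp.sub_apply]
      ring
  right_inv x := by
    have h1 : p + x.1 • u + x.2 • v - p = x.1 • u + x.2 • v := by abel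
    have hs : ∀ w : Plane, wedge w w = 0 := fun w => by simp [wedge]; ring
    simp only [h1, wedge_add_left, wedge_add_right, wedge_smul_left, wedge_smul_right, hs]
    simp [h]
  continuous_toFun := by
    refine (Continuous.div_const ?_ _).prodMk (Continuous.div_const ?_ _)
    · exact continuous_wedge.comp (by fun_prop : Continuous fun q : Plane => (q - p, v))
    · exact continuous_wedge.comp (by fun_prop : Continuous fun q : Plane => (u, q - p))
  continuous_invFun := by fun_prop

/-- Affine coordinates along the two independent directions straighten both sets near `p`. -/
theorem crossAt_of_eventually {A B : Set Plane} {p u v : Plane} (h : wedge u v ≠ 0)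
    (hA : ∀ᶠ q in 𝓝 p, q ∈ A ↔ wedge u (q - p) = 0)
    (hB : ∀ᶠ q in 𝓝 p, q ∈ B ↔ wedge v (q - p) = 0) : CrossAt A B p := by
  obtain ⟨U, hU, hUo, hpU⟩ := eventually_nhds_iff.1 (hA.and hB)
  refine ⟨(wedgeHomeomorph p u v h).toOpenPartialHomeomorph.restrOpen U hUo, ?_, ?_, ?_⟩
  · rw [OpenPartialHomeomorph.restrOpen_source]
    exact ⟨mem_univ _, hpU⟩
  · change (wedge (p - p) v / wedge u v, wedge u (p - p) / wedge u v) = (0, 0)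
    simp [wedge]
  · intro q hq
    rw [OpenPartialHomeomorph.restrOpen_source] at hq
    obtain ⟨h1, h2⟩ := hU q hq.2
    change (q ∈ A ↔ wedge u (q - p) / wedge u v = 0) ∧ (q ∈ B ↔ wedge (q - p) v / wedge u v = 0)
    rw [div_eq_zero_iff, div_eq_zero_iff, or_iff_left h, or_iff_left h, h1, h2,
      wedge_swap (q - p) v, neg_eq_zero]
    exact ⟨Iff.rfl, Iff.rfl⟩

theorem IsSimpleLine.eventually_mem_img_iff {Q : List Plane} (hQ : IsSimpleLine Q)
    {s : Plane × Plane} (hs : s ∈ segs Q) {p : Plane} (hp : p ∈ seg s) (h₁ : p ≠ s.1)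
    (h₂ : p ≠ s.2) : ∀ᶠ q in 𝓝 p, q ∈ img Q ↔ wedge (s.2 - s.1) (q - p) = 0 := by
  have hother : ∀ᶠ q in 𝓝 p, ∀ t ∈ segs Q, t ≠ s → q ∉ seg t := by
    have : ∀ t ∈ segs Q, ∀ᶠ q in 𝓝 p, t ≠ s → q ∉ seg t := by
      intro t ht
      by_cases hts : t = s
      · exact .of_forall fun _ h => absurd hts h
      · have hpt : p ∉ seg t := fun hpt => by
          rcases hQ.inter s hs t ht (Ne.symm hts) p hp hpt with h | h
          · exact h₂ h.1
          · exact h₁ h.1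
        filter_upwards [(isClosed_seg t).isOpen_compl.mem_nhds hpt] with q hq _
        exact hq
    exact (eventually_all_finite (List.finite_toSet (segs Q))).2 this
  filter_upwards [eventually_mem_seg_iff hp h₁ h₂, hother] with q h1 h2
  rw [← h1]
  constructor
  · rintro ⟨t, ht, hqt⟩
    by_cases hts : t = s
    · rwa [← hts]
    · exact absurd hqt (h2 t ht hts)
  · exact fun h => ⟨s, hs, h⟩

theorem encard_inter_img_le {P Q : List Plane} (h : ∀ s ∈ segs P, ∀ t ∈ segs Q,
    (seg s ∩ seg t).Subsingleton) : (img P ∩ img Q).encard ≤ cross P Q := by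
  have key : ∀ S T : List (Plane × Plane), (∀ s ∈ S, ∀ t ∈ T, (seg s ∩ seg t).Subsingleton) →
      {x | (∃ s ∈ S, x ∈ seg s) ∧ ∃ t ∈ T, x ∈ seg t}.encard ≤ crossS S T := by
    have one : ∀ s, ∀ T : List (Plane × Plane), (∀ t ∈ T, (seg s ∩ seg t).Subsingleton) →
        {x | x ∈ seg s ∧ ∃ t ∈ T, x ∈ seg t}.encard ≤ crossS [s] T := by
      intro s T
      induction T with
      | nil => intro _; simp
      | cons t T ih =>
        intro hT
        have h1 := ih fun t ht => hT t (List.mem_cons_of_mem _ ht)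
        have h2 : crossS [s] (t :: T) = meets s t + crossS [s] T := by simp [crossS]
        have h3 : (seg s ∩ seg t).encard ≤ meets s t := by
          by_cases hm : Meet s t
          · rw [meets_eq_one hm]
            exact encard_le_one_iff_subsingleton.2 (hT t (by simp))
          · rw [Meet, not_nonempty_iff_eq_empty] at hm
            simp [hm]
        have h4 : {x | x ∈ seg s ∧ ∃ t' ∈ t :: T, x ∈ seg t'} ⊆
            (seg s ∩ seg t) ∪ {x | x ∈ seg s ∧ ∃ t ∈ T, x ∈ seg t} := by
          rintro x ⟨hx, t', ht', hxt⟩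
          rcases List.mem_cons.1 ht' with rfl | ht'
          · exact Or.inl ⟨hx, hxt⟩
          · exact Or.inr ⟨hx, t', ht', hxt⟩
        refine (encard_le_encard h4).trans ((encard_union_le _ _).trans ?_)
        rw [h2]
        push_cast
        exact add_le_add h3 h1
    intro S
    induction S with
    | nil => intro T _; simp
    | cons s S ih =>
      intro T hT
      rw [crossS_cons]
      have h4 : {x | (∃ s' ∈ s :: S, x ∈ seg s') ∧ ∃ t ∈ T, x ∈ seg t} ⊆
          {x | x ∈ seg s ∧ ∃ t ∈ T, x ∈ seg t} ∪
            {x | (∃ s ∈ S, x ∈ seg s) ∧ ∃ t ∈ T, x ∈ seg t} := by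
        rintro x ⟨⟨s', hs', hx⟩, ht⟩
        rcases List.mem_cons.1 hs' with rfl | hs'
        · exact Or.inl ⟨hx, ht⟩
        · exact Or.inr ⟨⟨s', hs', hx⟩, ht⟩
      refine (encard_le_encard h4).trans ((encard_union_le _ _).trans ?_)
      push_cast
      exact add_le_add (one s T (hT s (by simp)))
        (ih T fun s hs => hT s (List.mem_cons_of_mem _ hs))
  exact key _ _ h

namespace Config

variable {V : Type*} [LinearOrder V] {c : Config V}

theorem Generic.encard_inter_le (hc : c.Generic) {e f : VPair V} (hef : e ≠ f) :
    (img (c.poly e) ∩ img (c.poly f)).encard ≤ cross (c.poly e) (c.poly f) := by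
  refine encard_inter_img_le fun s hs t ht x hx y hy => ?_
  exact _root_.eq_of_mem_seg (hc.of_mem_seg hef hs ht hx.1 hx.2).1 hx.1 hx.2 hy.1 hy.2

/-- The polygonal lines of a generic family are ranges of simple curves. -/
theorem exists_curves (hs : ∀ e, IsSimpleLine (c.poly e)) : ∃ γ : V → V → C(I, Plane),
    (∀ u w, γ u w 0 = c.pos u) ∧ (∀ u w, range (γ u w) = img (c.line u w)) ∧
    (∀ u w, u ≠ w → Function.Injective (γ u w)) ∧
    (∀ u w t, γ u w t = γ w u (unitInterval.symm t)) ∧ ∀ u t, γ u u t = c.pos u := by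
  have h : ∀ e : VPair V, ∃ γ : Path (c.pos e.1.1) (c.pos e.1.2), Function.Injective γ ∧
      range γ = img (c.poly e) := fun e =>
    IsSimpleLine.exists_path (l := c.bends e ++ [c.pos e.1.2]) (hs e) List.getLast?_concat
  choose γ h1 h2 using h
  refine ⟨fun u w => if h : u < w then (γ ⟨(u, w), h⟩).toContinuousMap else
    if h : w < u then (γ ⟨(w, u), h⟩).symm.toContinuousMap else ContinuousMap.const I (c.pos u),
    ?_, ?_, ?_, ?_, ?_⟩
  · intro u w
    rcases lt_trichotomy u w with h | rfl | h
    · simp [h]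
    · simp
    · simp [h, h.not_gt]
  · intro u w
    rcases lt_trichotomy u w with h | rfl | h
    · simpa [h, ← c.line_eq_poly] using h2 ⟨(u, w), h⟩
    · simp [line, bendsFrom_self, img, seg_self]
    · have := h2 ⟨(w, u), h⟩
      rw [← c.line_eq_poly] at this
      simp only [h, h.not_gt, dite_true, dite_false]
      rw [line_symm, img_reverse, ← this]
      exact Path.symm_range _
  · intro u w huw
    rcases lt_or_gt_of_ne huw with h | h
    · simpa [h] using h1 ⟨(u, w), h⟩
    · simp only [h, h.not_gt, dite_true, dite_false]
      exact (h1 ⟨(w, u), h⟩).comp unitInterval.symm_bijective.injective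
  · intro u w t
    rcases lt_trichotomy u w with h | rfl | h
    · simp [h, h.not_gt]
    · simp
    · simp [h, h.not_gt]
  · intro u t
    simp

theorem _root_.curveInterior_eq {γ : C(I, Plane)} (h : Function.Injective γ) :
    curveInterior γ = range γ \ {γ 0, γ 1} := by
  have h01 : Ioo (0 : I) 1 = univ \ {0, 1} := by
    ext t
    simp only [mem_Ioo, Set.mem_sdiff, mem_univ, mem_insert_iff, mem_singleton_iff, true_and, not_or,
      unitInterval.pos_iff_ne_zero, unitInterval.lt_one_iff_ne_one]
  rw [curveInterior, h01, image_sdiff h, image_univ, image_pair]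

theorem Generic.exists_seg_of_mem_inter (hc : c.Generic) {e f : VPair V} (hef : e ≠ f) {p : Plane}
    (hp : p ∈ img (c.poly e)) (hp' : p ∈ img (c.poly f)) (hv : ∀ v, p ≠ c.pos v) :
    ∃ s ∈ segs (c.poly e), ∃ t ∈ segs (c.poly f), p ∈ seg s ∧ p ∈ seg t ∧ p ≠ s.1 ∧ p ≠ s.2 ∧
      p ≠ t.1 ∧ p ≠ t.2 ∧ wedge (s.2 - s.1) (t.2 - t.1) ≠ 0 := by
  have hno : ∀ {e f : VPair V}, e ≠ f → p ∈ img (c.poly f) → p ∉ c.poly e := by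
    intro e f hef hp' h
    obtain ⟨v, hv', -⟩ := hc.exists_pos_of_mem_poly hef h (hc.mem_poly_of_mem_img h hp')
    exact hv v hv'
  obtain ⟨s, hs, hps⟩ := id hp
  obtain ⟨t, ht, hpt⟩ := id hp'
  have he := hno hef hp'
  have hf := hno hef.symm hp
  refine ⟨s, hs, t, ht, hps, hpt, ?_, ?_, ?_, ?_, (hc.of_mem_seg hef hs ht hps hpt).1⟩
  · exact fun h => he (h ▸ left_mem_of_mem_segs hs)
  · exact fun h => he (h ▸ right_mem_of_mem_segs hs)
  · exact fun h => hf (h ▸ left_mem_of_mem_segs ht)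
  · exact fun h => hf (h ▸ right_mem_of_mem_segs ht)

/-- A generic family of simple polygonal lines gives a drawing of every graph. -/
theorem Generic.exists_graphDrawing (hc : c.Generic) (hs : ∀ e, IsSimpleLine (c.poly e))
    (h₁ : ∀ e f, e ≠ f → cross (c.poly e) (c.poly f) ≤ 1) (G : SimpleGraph V) :
    ∃ D : GraphDrawing G, ((∀ e, c.bends e = []) → D.IsStraightLine) ∧
      ∀ e f : G.edgeSet, e ≠ f → ∀ u w k l, e.1 = s(u, w) → f.1 = s(k, l) →
        (curveInterior (D.arc e) ∩ curveInterior (D.arc f)).ncard ≤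
            cross (c.line u w) (c.line k l) ∧
          (∀ x ∈ e.1, x ∈ f.1 → (curveInterior (D.arc e) ∩ curveInterior (D.arc f)).ncard = 0) := by
  have hpair : ∀ e : G.edgeSet, ∃ p : VPair V, s(p.1.1, p.1.2) = e.1 := by
    rintro ⟨e, he⟩
    induction e using Sym2.ind with
    | _ u w =>
      obtain ⟨p, hp, -⟩ := exists_pair (G.ne_of_adj he)
      exact ⟨p, hp⟩
  choose P hP using hpair
  have hPne : ∀ e f, e ≠ f → P e ≠ P f := fun e f hef h =>
    hef (Subtype.ext ((hP e).symm.trans (h ▸ hP f)))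
  obtain ⟨γ, g1, g2, g3, g4, -⟩ := exists_curves hs
  set arc : G.edgeSet → C(I, Plane) := fun e => γ (P e).1.1 (P e).1.2 with harc
  have hr : ∀ e, range (arc e) = img (c.poly (P e)) := fun e => by
    rw [harc]; simp only; rw [g2, c.line_eq_poly]
  have hinj : ∀ e, Function.Injective (arc e) := fun e => g3 _ _ (P e).2.ne
  have h0 : ∀ e, arc e 0 = c.pos (P e).1.1 := fun e => g1 _ _
  have h1 : ∀ e, arc e 1 = c.pos (P e).1.2 := fun e => by
    rw [harc]; simp only; rw [g4, unitInterval.symm_one, g1]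
  have hav : ∀ e v, c.pos v ∈ range (arc e) → v ∈ e.1 := by
    intro e v hv
    rw [hr] at hv
    rw [← hP e, Sym2.mem_iff]
    by_contra! hn
    exact hc.pos_notMem_img_line (P e).2.ne hn.1 hn.2 (by rwa [c.line_eq_poly])
  have hint : ∀ e, ∀ p ∈ curveInterior (arc e), p ∈ img (c.poly (P e)) ∧ ∀ v, p ≠ c.pos v := by
    intro e p hp
    rw [curveInterior_eq (hinj e), Set.mem_sdiff] at hp
    refine ⟨hr e ▸ hp.1, ?_⟩
    rintro v rfl
    have := hav e v hp.1
    rw [← hP e, Sym2.mem_iff] at this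
    refine hp.2 ?_
    rw [h0, h1]
    rcases this with rfl | rfl <;> simp
  have hsub : ∀ e f, curveInterior (arc e) ∩ curveInterior (arc f) ⊆
      img (c.poly (P e)) ∩ img (c.poly (P f)) := fun e f p hp =>
    ⟨(hint e p hp.1).1, (hint f p hp.2).1⟩
  have henc : ∀ e f, e ≠ f → (img (c.poly (P e)) ∩ img (c.poly (P f))).encard ≤
      cross (c.poly (P e)) (c.poly (P f)) := fun e f hef => hc.encard_inter_le (hPne e f hef)
  have hfin : ∀ e f, e ≠ f → (img (c.poly (P e)) ∩ img (c.poly (P f))).Finite := fun e f hef =>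
    Set.finite_of_encard_le_coe (henc e f hef)
  refine ⟨⟨c.pos, hc.pos_injective, arc, hinj, ?_, hav, ?_, ?_, ?_⟩, ?_, ?_⟩
  · intro e
    rw [h0, h1, ← hP e]
    rfl
  · intro e f hef p hp
    obtain ⟨hpe, hv⟩ := hint e p hp.1
    obtain ⟨hpf, -⟩ := hint f p hp.2
    obtain ⟨s, hs', t, ht, hps, hpt, e1, e2, e3, e4, hw⟩ :=
      hc.exists_seg_of_mem_inter (hPne e f hef) hpe hpf hv
    rw [hr, hr]
    exact crossAt_of_eventually hw ((hs _).eventually_mem_img_iff hs' hps e1 e2)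
      ((hs _).eventually_mem_img_iff ht hpt e3 e4)
  · intro e f g hef heg hfg
    rw [eq_empty_iff_forall_notMem]
    rintro p ⟨⟨hpe, hpf⟩, hpg⟩
    obtain ⟨v, hv⟩ := hc.exists_pos_of_mem_img (hPne e f hef) (hPne e g heg) (hPne f g hfg)
      (hint e p hpe).1 (hint f p hpf).1 (hint g p hpg).1
    exact (hint e p hpe).2 v hv
  · exact fun e f hef => (hfin e f hef).subset (hsub e f)
  · intro hb e
    change range (arc e) = segment ℝ (arc e 0) (arc e 1)
    rw [hr, h0, h1, poly, hb]
    simp [img, seg]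
  · intro e f hef u w k l he hf
    change (curveInterior (arc e) ∩ curveInterior (arc f)).ncard ≤ _ ∧
      (∀ x ∈ e.1, x ∈ f.1 → (curveInterior (arc e) ∩ curveInterior (arc f)).ncard = 0)
    have hcr : cross (c.line u w) (c.line k l) = cross (c.poly (P e)) (c.poly (P f)) := by
      rw [cross_line_congr (he.symm.trans (hP e).symm), cross_comm,
        cross_line_congr (hf.symm.trans (hP f).symm), cross_comm, c.line_eq_poly, c.line_eq_poly]
    refine ⟨?_, fun x hxe hxf => ?_⟩
    · rw [hcr, ← ENat.natCast_le_natCast]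
      refine le_trans ?_ ((encard_le_encard (hsub e f)).trans (henc e f hef))
      exact ((hfin e f hef).subset (hsub e f)).cast_ncard_eq.le
    · have hss : (img (c.poly (P e)) ∩ img (c.poly (P f))).Subsingleton := by
        rw [← encard_le_one_iff_subsingleton]
        exact (henc e f hef).trans (by exact_mod_cast h₁ _ _ (hPne e f hef))
      have hx : ∀ e : G.edgeSet, x ∈ e.1 → c.pos x ∈ img (c.poly (P e)) := by
        intro e hxe
        rw [← hP e, Sym2.mem_iff] at hxe
        refine mem_img_of_mem ?_ (c.two_le_length_poly _)
        rw [mem_poly]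
        rcases hxe with rfl | rfl <;> simp
      -- The two edges have at most one common point, and this is their common vertex.
      have hempty : curveInterior (arc e) ∩ curveInterior (arc f) = ∅ := by
        rw [eq_empty_iff_forall_notMem]
        intro p hp
        exact (hint e p hp.1).2 x (hss (hsub e f hp) ⟨hx e hxe, hx f hxf⟩)
      rw [hempty, ncard_empty]

/-- A generic family of simple polygonal lines that pairwise cross at most once gives a simple
graphon drawing that depends on the part of a partition of `[0,1]` only. -/
theorem Generic.exists_graphonDrawing [Finite V] (hc : c.Generic)
    (hs : ∀ e, IsSimpleLine (c.poly e)) (h₁ : ∀ e f, e ≠ f → cross (c.poly e) (c.poly f) ≤ 1)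
    [MeasurableSpace V] [MeasurableSingletonClass V] {φ : I → V} (hφ : Measurable φ) :
    ∃ D : GraphonDrawing, ∀ x y, range (D.curve x y) = img (c.line (φ x) (φ y)) := by
  obtain ⟨γ, g1, g2, g3, g4, g5⟩ := exists_curves hs
  refine ⟨⟨fun x y => γ (φ x) (φ y), fun x y => ?_, fun x y t => g4 _ _ t, fun x => c.pos (φ x),
    fun x t => g5 _ t, fun x y => g1 _ _, ?_, ?_⟩, fun x y => g2 _ _⟩
  · by_cases h : φ x = φ y
    · exact Or.inr ⟨c.pos (φ y), fun t => by rw [h]; exact g5 _ t⟩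
    · exact Or.inl (g3 _ _ h)
  · intro x₁ y₁ x₂ y₂ hne
    have hconst : ∀ u, (range (γ u u)).Subsingleton := by
      rintro u - ⟨s, rfl⟩ - ⟨t, rfl⟩
      rw [g5, g5]
    by_cases h : φ x₁ = φ y₁
    · rw [h]
      exact (hconst _).anti inter_subset_left
    by_cases h' : φ x₂ = φ y₂
    · rw [h']
      exact (hconst _).anti inter_subset_right
    obtain ⟨e, -, he⟩ := exists_pair h
    obtain ⟨f, -, hf⟩ := exists_pair h'
    have he' : range (γ (φ x₁) (φ y₁)) = img (c.poly e) := by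
      rw [g2]
      rcases he c with he | he <;> rw [he]
      rw [img_reverse]
    have hf' : range (γ (φ x₂) (φ y₂)) = img (c.poly f) := by
      rw [g2]
      rcases hf c with hf | hf <;> rw [hf]
      rw [img_reverse]
    rw [he', hf'] at hne ⊢
    have hef : e ≠ f := fun h => hne (by rw [h])
    rw [← encard_le_one_iff_subsingleton]
    exact (hc.encard_inter_le hef).trans (by exact_mod_cast h₁ e f hef)
  · have hm : Measurable fun x : Fin 4 → I => ((φ (x 0), φ (x 1)), φ (x 2), φ (x 3)) := by
      fun_prop
    exact (hm (Set.toFinite {q : (V × V) × V × V |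
      (range (γ q.1.1 q.1.2) ∩ range (γ q.2.1 q.2.2)).Nonempty}).measurableSet).nullMeasurableSet

end Config

/-! ### Random sampling from the parts of the interval -/

theorem volume_intervalIndex_preimage {n : ℕ} (hn : 0 < n) (i : Fin n) :
    volume (intervalIndex hn ⁻¹' {i}) = (n : ENNReal)⁻¹ := by
  have hn' : (0 : ℝ) < n := by exact_mod_cast hn
  have hi : ((i : ℕ) : ℝ) + 1 ≤ n := by exact_mod_cast i.2
  set a : I := ⟨i / n, by positivity, by rw [div_le_one hn']; linarith⟩ with ha
  set b : I := ⟨(i + 1) / n, by positivity, by rwa [div_le_one hn']⟩ with hb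
  have hab : ENNReal.ofReal ((b : ℝ) - a) = (n : ENNReal)⁻¹ := by
    rw [← ENNReal.ofReal_natCast, ← ENNReal.ofReal_inv_of_pos hn']
    congr 1
    simp only [ha, hb]
    ring
  have hidx : ∀ x : I, intervalIndex hn x = i ↔ min ⌊(n : ℝ) * (x : ℝ)⌋₊ (n - 1) = i := by
    intro x
    simp [intervalIndex, Fin.ext_iff]
  refine le_antisymm ?_ ?_
  · rw [← hab, ← unitInterval.volume_Icc]
    refine measure_mono fun x hx => ?_
    rw [mem_preimage, mem_singleton_iff, hidx] at hx
    have h0 : 0 ≤ (n : ℝ) * x := mul_nonneg hn'.le x.2.1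
    have h1 : (i : ℕ) ≤ ⌊(n : ℝ) * (x : ℝ)⌋₊ := by rw [← hx]; exact min_le_left _ _
    have h2 := (Nat.le_floor_iff h0).1 h1
    refine ⟨?_, ?_⟩
    · change (i : ℝ) / n ≤ x
      rwa [div_le_iff₀' hn']
    · change (x : ℝ) ≤ (i + 1) / n
      rw [le_div_iff₀' hn']
      rcases min_choice ⌊(n : ℝ) * (x : ℝ)⌋₊ (n - 1) with h | h <;> rw [h] at hx
      · rw [← hx]
        exact (Nat.lt_floor_add_one _).le
      · have : ((i : ℕ) : ℝ) + 1 = n := by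
          rw [← hx]
          push_cast [Nat.cast_sub hn]
          ring
        rw [this]
        exact mul_le_of_le_one_right hn'.le x.2.2
  · rw [← hab, ← unitInterval.volume_Ico]
    refine measure_mono fun x hx => ?_
    rw [mem_preimage, mem_singleton_iff, hidx]
    have h1 : (i : ℝ) / n ≤ x := hx.1
    have h2 : (x : ℝ) < (i + 1) / n := hx.2
    rw [div_le_iff₀' hn'] at h1
    rw [lt_div_iff₀' hn'] at h2
    have : ⌊(n : ℝ) * (x : ℝ)⌋₊ = i := (Nat.floor_eq_iff (by linarith [Nat.cast_nonneg (α := ℝ) (i : ℕ)])).2 ⟨h1, h2⟩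
    rw [this]
    have := i.2
    omega

/-- The uniform distribution on one of the parts of the unit interval. -/
noncomputable def blockMeasure {n : ℕ} (hn : 0 < n) (i : Fin n) : Measure I :=
  (n : ENNReal) • volume.restrict (intervalIndex hn ⁻¹' {i})

theorem blockMeasure_apply {n : ℕ} (hn : 0 < n) (i : Fin n) {s : Set I} (hs : MeasurableSet s) :
    blockMeasure hn i s = n * volume (s ∩ intervalIndex hn ⁻¹' {i}) := by
  rw [blockMeasure, Measure.smul_apply, Measure.restrict_apply hs, smul_eq_mul]

instance {n : ℕ} (hn : 0 < n) (i : Fin n) : IsProbabilityMeasure (blockMeasure hn i) := by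
  constructor
  rw [blockMeasure_apply hn i .univ, univ_inter, volume_intervalIndex_preimage]
  exact ENNReal.mul_inv_cancel (by exact_mod_cast hn.ne') (ENNReal.natCast_ne_top n)

theorem pi_blockMeasure {n : ℕ} (hn : 0 < n) (a : Fin 4 → Fin n) :
    Measure.pi (fun k => blockMeasure hn (a k)) =
      (n : ENNReal) ^ 4 • volume.restrict {y : Fin 4 → I | ∀ k, intervalIndex hn (y k) = a k} := by
  refine Measure.pi_eq fun s hs => ?_
  rw [Measure.smul_apply, Measure.restrict_apply (.univ_pi hs)]
  have : (univ.pi s ∩ {y : Fin 4 → I | ∀ k, intervalIndex hn (y k) = a k}) =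
      univ.pi fun k => s k ∩ intervalIndex hn ⁻¹' {a k} := by
    ext y
    simp only [mem_inter_iff, mem_univ_pi, mem_ofPred_eq, mem_preimage, mem_singleton_iff]
    exact forall_and.symm
  rw [this, volume_pi, Measure.pi_pi]
  simp only [blockMeasure_apply hn _ (hs _), Finset.prod_mul_distrib]
  simp

theorem measurableSet_block {n : ℕ} (hn : 0 < n) (a : Fin 4 → Fin n) :
    MeasurableSet {y : Fin 4 → I | ∀ k, intervalIndex hn (y k) = a k} := by
  have : {y : Fin 4 → I | ∀ k, intervalIndex hn (y k) = a k} =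
      ⋂ k, (fun y : Fin 4 → I => intervalIndex hn (y k)) ⁻¹' {a k} := by
    ext y
    simp only [mem_ofPred_eq, mem_iInter, mem_preimage, mem_singleton_iff]
  rw [this]
  exact MeasurableSet.iInter fun k =>
    ((measurable_intervalIndex hn).comp (measurable_pi_apply k)) (measurableSet_singleton _)

/-- Different coordinates are independent. Injectivity is essential, and it is the reason why
sampling controls only quadruples of different vertices. -/
theorem map_comp_pi_blockMeasure {n : ℕ} (hn : 0 < n) {a : Fin 4 → Fin n}
    (ha : Function.Injective a) :
    Measure.map (fun (x : Fin n → I) k => x (a k)) (Measure.pi (blockMeasure hn)) =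
      Measure.pi fun k => blockMeasure hn (a k) := by
  have h1 : ProbabilityTheory.iIndepFun (fun (i : Fin n) (x : Fin n → I) => x i)
      (Measure.pi (blockMeasure hn)) :=
    ProbabilityTheory.iIndepFun_pi (X := fun _ => id) fun _ => aemeasurable_id
  have h2 := h1.precomp ha
  rw [ProbabilityTheory.iIndepFun_iff_map_fun_eq_pi_map
    fun k => (measurable_pi_apply _).aemeasurable] at h2
  rw [h2]
  congr 1
  ext1 k
  exact (measurePreserving_eval (blockMeasure hn) (a k)).map_eq

theorem integral_comp_intervalIndex {n : ℕ} (hn : 0 < n) (C : (Fin 4 → Fin n) → ℝ)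
    {M : Set (Fin 4 → I)} (hM : MeasurableSet M) :
    ∫ y : Fin 4 → I, C (fun k => intervalIndex hn (y k)) * M.indicator 1 y =
      ∑ a, C a * volume.real (M ∩ {y : Fin 4 → I | ∀ k, intervalIndex hn (y k) = a k}) := by
  have hpt : ∀ y : Fin 4 → I, C (fun k => intervalIndex hn (y k)) * M.indicator 1 y =
      ∑ a, C a * (M ∩ {y : Fin 4 → I | ∀ k, intervalIndex hn (y k) = a k}).indicator 1 y := by
    intro y
    rw [Finset.sum_eq_single fun k => intervalIndex hn (y k)]
    · congr 1
      by_cases hy : y ∈ M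
      · rw [indicator_of_mem hy, indicator_of_mem]
        exact ⟨hy, fun k => rfl⟩
      · rw [indicator_of_notMem hy, indicator_of_notMem fun h => hy h.1]
    · intro a _ ha
      rw [indicator_of_notMem, mul_zero]
      exact fun h => ha (funext fun k => (h.2 k).symm)
    · exact fun h => absurd (Finset.mem_univ _) h
  have hmeas := fun a => hM.inter (measurableSet_block hn a)
  simp only [hpt]
  rw [integral_finsetSum]
  · refine Finset.sum_congr rfl fun a _ => ?_
    rw [integral_const_mul, integral_indicator_one (hmeas a)]
  · exact fun a _ => ((integrable_const (1 : ℝ)).indicator (hmeas a)).const_mul _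

theorem volume_block {n : ℕ} (hn : 0 < n) (a : Fin 4 → Fin n) :
    volume.real {y : Fin 4 → I | ∀ k, intervalIndex hn (y k) = a k} = ((n : ℝ) ^ 4)⁻¹ := by
  have : {y : Fin 4 → I | ∀ k, intervalIndex hn (y k) = a k} =
      univ.pi fun k => intervalIndex hn ⁻¹' {a k} := by
    ext y
    simp only [mem_univ_pi, mem_ofPred_eq, mem_preimage, mem_singleton_iff]
  rw [this, volume_pi, Measure.real, Measure.pi_pi]
  simp [volume_intervalIndex_preimage]

/-- The integral of a function that depends on the parts only. -/
theorem integral_step {n : ℕ} (hn : 0 < n) (C : (Fin 4 → Fin n) → ℝ) :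
    ∫ y : Fin 4 → I, C (fun k => intervalIndex hn (y k)) = (∑ a, C a) / (n : ℝ) ^ 4 := by
  have := integral_comp_intervalIndex hn C (MeasurableSet.univ)
  simp only [indicator_univ, Pi.one_apply, mul_one, univ_inter, volume_block] at this
  rw [this, ← Finset.sum_mul, div_eq_mul_inv]

open Classical in
/-- Choosing one point in every part at random shows that some choice is at least as good as the
average. -/
theorem exists_sample {n : ℕ} (hn : 0 < n) {C : (Fin 4 → Fin n) → ℝ} (hC : ∀ a, 0 ≤ C a)
    {M : Set (Fin 4 → I)} (hM : NullMeasurableSet M volume) :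
    ∃ x : Fin n → I, (∀ i, intervalIndex hn (x i) = i) ∧
      (∑ a : Fin 4 → Fin n, if Function.Injective a ∧ (fun k => x (a k)) ∈ M then C a else 0) ≤
        (n : ℝ) ^ 4 * ∫ y, C (fun k => intervalIndex hn (y k)) * M.indicator 1 y := by
  -- The measurable hull makes the random sum measurable. It contains `M`, so the sum does not
  -- decrease, and it differs from `M` by a null set, so the integral is the same.
  set M' := toMeasurable volume M with hM'
  have hmeas : MeasurableSet M' := measurableSet_toMeasurable _ _
  set μ := Measure.pi (blockMeasure hn) with hμ
  set F : (Fin n → I) → ℝ := fun x => ∑ a : Fin 4 → Fin n, if Function.Injective a then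
    C a * ((fun (x : Fin n → I) k => x (a k)) ⁻¹' M').indicator 1 x else 0 with hF
  have hcomp : ∀ a : Fin 4 → Fin n, Measurable fun (x : Fin n → I) k => x (a k) := fun a => by
    fun_prop
  have hint : ∀ a : Fin 4 → Fin n, Integrable (fun x => if Function.Injective a then
      C a * ((fun (x : Fin n → I) k => x (a k)) ⁻¹' M').indicator 1 x else 0) μ := by
    intro a
    split_ifs
    · exact ((integrable_const (1 : ℝ)).indicator (hcomp a hmeas)).const_mul _
    · exact integrable_zero _ _ _
  have hFi : Integrable F μ := integrable_finsetSum _ fun a _ => hint a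
  -- Almost surely every sampled point lies in its part, so a sample no worse than the average can
  -- be taken with this property.
  have hnull : μ {x | ¬ ∀ i, intervalIndex hn (x i) = i} = 0 := by
    have : ∀ᵐ x ∂μ, ∀ i, intervalIndex hn (x i) = i := by
      rw [ae_all_iff]
      intro i
      have h1 : ∀ᵐ y ∂(blockMeasure hn i), intervalIndex hn y = i := by
        rw [ae_iff]
        have hms : MeasurableSet {y | ¬ intervalIndex hn y = i} :=
          (measurable_intervalIndex hn (measurableSet_singleton i)).compl
        rw [blockMeasure_apply hn i hms]
        have : {y | ¬ intervalIndex hn y = i} ∩ intervalIndex hn ⁻¹' {i} = ∅ := by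
          ext y
          simp
        simp [this]
      exact (measurePreserving_eval (blockMeasure hn) i).quasiMeasurePreserving.ae h1
    exact this
  obtain ⟨x, hx, hle⟩ := exists_notMem_null_le_integral hFi hnull
  refine ⟨x, not_not.1 hx, ?_⟩
  have h1 : (∑ a : Fin 4 → Fin n, if Function.Injective a ∧ (fun k => x (a k)) ∈ M
      then C a else 0) ≤ F x := by
    refine Finset.sum_le_sum fun a _ => ?_
    by_cases ha : Function.Injective a
    · by_cases hxM : (fun k => x (a k)) ∈ M
      · have hx' : x ∈ (fun (x : Fin n → I) k => x (a k)) ⁻¹' M' := subset_toMeasurable _ _ hxM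
        rw [if_pos ⟨ha, hxM⟩, if_pos ha, indicator_of_mem hx']
        simp
      · rw [if_neg fun h => hxM h.2, if_pos ha]
        exact mul_nonneg (hC a) (indicator_nonneg (fun _ _ => zero_le_one) _)
    · rw [if_neg fun h => ha h.1, if_neg ha]
  have h2 : ∫ x, F x ∂μ = ∑ a : Fin 4 → Fin n, if Function.Injective a then
      C a * ((n : ℝ) ^ 4 * volume.real
        (M' ∩ {y : Fin 4 → I | ∀ k, intervalIndex hn (y k) = a k})) else 0 := by
    rw [hF, integral_finsetSum _ fun a _ => hint a]
    refine Finset.sum_congr rfl fun a _ => ?_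
    split_ifs with ha
    · rw [integral_const_mul, integral_indicator_one (hcomp a hmeas), Measure.real,
        ← Measure.map_apply (hcomp a) hmeas, map_comp_pi_blockMeasure hn ha, pi_blockMeasure,
        Measure.smul_apply, Measure.restrict_apply hmeas, smul_eq_mul, ENNReal.toReal_mul]
      simp [Measure.real]
    · simp
  have h3 : ∫ y, C (fun k => intervalIndex hn (y k)) * M.indicator 1 y =
      ∫ y, C (fun k => intervalIndex hn (y k)) * M'.indicator 1 y := by
    refine integral_congr_ae ?_
    filter_upwards [indicator_ae_eq_of_ae_eq_set (f := (1 : (Fin 4 → I) → ℝ))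
      hM.toMeasurable_ae_eq] with y hy
    rw [hM', hy]
  rw [h3, integral_comp_intervalIndex hn C hmeas, Finset.mul_sum]
  refine h1.trans (hle.trans ?_)
  rw [h2]
  refine Finset.sum_le_sum fun a _ => ?_
  split_ifs
  · rw [mul_left_comm]
  · exact mul_nonneg (by positivity) (mul_nonneg (hC a) measureReal_nonneg)

/-! ### Sums over pairs of edges -/

section Sums
variable {V : Type*} [LinearOrder V]

/-- The unordered pair that belongs to an ordered one. -/
def VPair.edge (e : VPair V) : Sym2 V := s(e.1.1, e.1.2)

theorem VPair.edge_injective : Function.Injective (VPair.edge (V := V)) := by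
  intro e f h
  rcases Sym2.eq_iff.1 h with ⟨h1, h2⟩ | ⟨h1, h2⟩
  · exact Subtype.ext (Prod.ext h1 h2)
  · have he := e.2
    have hf := f.2
    rw [h1, h2] at he
    exact absurd he hf.not_gt

theorem VPair.exists_edge_eq {e : Sym2 V} (h : ¬ e.IsDiag) : ∃ p : VPair V, p.edge = e := by
  induction e using Sym2.ind with
  | _ u w =>
    obtain ⟨p, hp, -⟩ := Config.exists_pair (u := u) (w := w) (by simpa using h)
    exact ⟨p, hp⟩

theorem weight_diag {V : Type*} (G : EdgeWeightedGraph V) (u : V) : G.weight s(u, u) = 0 :=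
  G.weight_eq_zero _ fun h => G.toSimpleGraph.loopless.irrefl u h

variable [Fintype V]

theorem sum_sum_eq_two_mul {g : V → V → ℝ} (hs : ∀ u w, g u w = g w u) (h₀ : ∀ u, g u u = 0) :
    ∑ u, ∑ w, g u w = 2 * ∑ e : VPair V, g e.1.1 e.1.2 := by
  have h1 : ∑ e : VPair V, g e.1.1 e.1.2 = ∑ u, ∑ w, if u < w then g u w else 0 := by
    rw [← Fintype.sum_prod_type']
    refine Fintype.sum_of_injective (fun e : VPair V => e.1) Subtype.val_injective _ _ ?_ ?_
    · intro p hp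
      refine if_neg fun h => hp ⟨⟨p, h⟩, rfl⟩
    · intro e
      exact (if_pos e.2).symm
  have h2 : ∑ u, ∑ w, g u w = ∑ u, ∑ w, ((if u < w then g u w else 0) +
      if w < u then g w u else 0) := by
    refine Finset.sum_congr rfl fun u _ => Finset.sum_congr rfl fun w _ => ?_
    rcases lt_trichotomy u w with h | rfl | h
    · simp [h, h.not_gt]
    · simp [h₀]
    · simp [h, h.not_gt, hs u w]
  rw [h2, h1]
  simp only [Finset.sum_add_distrib]
  rw [Finset.sum_comm (f := fun u w => if w < u then g w u else 0), two_mul]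

theorem sum_fin_four {α : Type*} [Fintype α] (F : α → α → α → α → ℝ) :
    ∑ a : Fin 4 → α, F (a 0) (a 1) (a 2) (a 3) = ∑ u, ∑ w, ∑ k, ∑ l, F u w k l := by
  let E : (Fin 4 → α) ≃ (α × α) × α × α :=
    { toFun := fun a => ((a 0, a 1), a 2, a 3)
      invFun := fun p => ![p.1.1, p.1.2, p.2.1, p.2.2]
      left_inv := fun a => by
        funext i
        fin_cases i <;> rfl
      right_inv := fun p => rfl }
  rw [Fintype.sum_equiv E (fun a => F (a 0) (a 1) (a 2) (a 3))
    (fun p => F p.1.1 p.1.2 p.2.1 p.2.2) fun a => rfl]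
  simp only [Fintype.sum_prod_type]

/-- Each of the two pairs has two orientations, and degenerate pairs contribute nothing. -/
theorem sum_fin_four_eq_four_mul {K : V → V → V → V → ℝ} (h₁ : ∀ u w k l, K u w k l = K w u k l)
    (h₂ : ∀ u w k l, K u w k l = K u w l k) (h₃ : ∀ u k l, K u u k l = 0)
    (h₄ : ∀ u w k, K u w k k = 0) :
    ∑ a : Fin 4 → V, K (a 0) (a 1) (a 2) (a 3) =
      4 * ∑ e : VPair V, ∑ f : VPair V, K e.1.1 e.1.2 f.1.1 f.1.2 := by
  rw [sum_fin_four]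
  have h5 : ∀ u w, ∑ k, ∑ l, K u w k l = 2 * ∑ f : VPair V, K u w f.1.1 f.1.2 := fun u w =>
    sum_sum_eq_two_mul (h₂ u w) (h₄ u w)
  simp only [h5]
  rw [sum_sum_eq_two_mul (g := fun u w => 2 * ∑ f : VPair V, K u w f.1.1 f.1.2)]
  · rw [← Finset.mul_sum, ← mul_assoc]
    norm_num
  · intro u w
    simp only [h₁ u w]
  · intro u
    simp [h₃]

theorem sum_edgeSet_eq {G : SimpleGraph V} [Fintype G.edgeSet] {g : Sym2 V → ℝ}
    (h : ∀ e, e ∉ G.edgeSet → g e = 0) : ∑ e : G.edgeSet, g e = ∑ e : VPair V, g e.edge := by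
  rw [Fintype.sum_of_injective (fun e : G.edgeSet => e.1) Subtype.val_injective _ g
    (fun e he => h e fun h => he ⟨⟨e, h⟩, rfl⟩) fun _ => rfl]
  refine (Fintype.sum_of_injective VPair.edge VPair.edge_injective _ g (fun e he => ?_)
    fun _ => rfl).symm
  refine h e fun h' => he (VPair.exists_edge_eq ?_)
  exact G.not_isDiag_of_mem_edgeSet h'

variable (G : EdgeWeightedGraph V)

open Classical in
/-- The number of common interior points of the curves of two edges. -/
noncomputable def interCount {G : SimpleGraph V} (D : GraphDrawing G) (e f : Sym2 V) : ℕ :=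
  if h : e ∈ G.edgeSet ∧ f ∈ G.edgeSet then
    (curveInterior (D.arc ⟨e, h.1⟩) ∩ curveInterior (D.arc ⟨f, h.2⟩)).ncard
  else 0

/-- Non-edges have weight zero, so the sum may run over all pairs of vertices, independently of the
graph. -/
theorem two_mul_crDrawing (D : GraphDrawing G.toSimpleGraph) :
    2 * G.crDrawing D = ∑ e : VPair V, ∑ f : VPair V,
      if e = f then 0 else G.weight e.edge * G.weight f.edge * interCount D e.edge f.edge := by
  classical
  have key : ∀ e : Sym2 V, (∑ f : G.edgeSet, if e = f.1 then 0 else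
      G.weight e * G.weight f * interCount D e f.1) = ∑ f : VPair V, if e = f.edge then 0 else
      G.weight e * G.weight f.edge * interCount D e f.edge := by
    intro e
    refine sum_edgeSet_eq (g := fun f => if e = f then 0 else
      G.weight e * G.weight f * interCount D e f) fun f hf => ?_
    simp [G.weight_eq_zero f hf]
  rw [EdgeWeightedGraph.crDrawing, ← mul_assoc]
  norm_num only [one_mul]
  trans ∑ e : G.edgeSet, ∑ f : VPair V, if e.1 = f.edge then 0 else
      G.weight e * G.weight f.edge * interCount D e f.edge
  · refine Finset.sum_congr rfl fun e _ => ?_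
    rw [← key e.1]
    refine Finset.sum_congr rfl fun f _ => ?_
    rw [interCount, dif_pos ⟨e.2, f.2⟩]
    by_cases h : e = f
    · rw [if_pos h, if_pos (congrArg Subtype.val h)]
    · rw [if_neg h, if_neg fun h' => h (Subtype.ext h')]
  rw [sum_edgeSet_eq (G := G.toSimpleGraph) (g := fun e => ∑ f : VPair V, if e = f.edge then 0 else
      G.weight e * G.weight f.edge * interCount D e f.edge)]
  · simp only [VPair.edge_injective.eq_iff]
  · intro e he
    simp [G.weight_eq_zero e he]

open Classical in
/-- A bound for the weighted number of crossings of a drawing whose edges cross at most once. -/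
theorem eight_mul_crDrawing_le (D : GraphDrawing G.toSimpleGraph) {M : Sym2 V → Sym2 V → Prop}
    (h₁ : ∀ e f, e ≠ f → interCount D e f ≤ if M e f then 1 else 0)
    (h₀ : ∀ e f, e ≠ f → ∀ x ∈ e, x ∈ f → interCount D e f = 0) :
    8 * G.crDrawing D ≤ ∑ a : Fin 4 → V,
      if Function.Injective a ∧ M s(a 0, a 1) s(a 2, a 3) then
        G.weight s(a 0, a 1) * G.weight s(a 2, a 3) else 0 := by
  -- Only disjoint pairs matter, since edges with a common vertex do not cross. Two disjoint pairs
  -- of nonzero weight consist of four different vertices, and orienting both pairs gives the factor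
  -- 4 that turns `2 * crDrawing` into `8 * crDrawing`.
  set K : V → V → V → V → ℝ := fun u w k l =>
    if (∀ x, x ∈ s(u, w) → x ∉ s(k, l)) ∧ M s(u, w) s(k, l) then
      G.weight s(u, w) * G.weight s(k, l) else 0 with hK
  have hK4 := sum_fin_four_eq_four_mul (K := K)
    (fun u w k l => by simp only [hK, Sym2.eq_swap (a := u)])
    (fun u w k l => by simp only [hK, Sym2.eq_swap (a := k)])
    (fun u k l => by simp [hK, weight_diag]) (fun u w k => by simp [hK, weight_diag])
  have hcr : 2 * G.crDrawing D ≤ ∑ e : VPair V, ∑ f : VPair V, K e.1.1 e.1.2 f.1.1 f.1.2 := by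
    rw [two_mul_crDrawing]
    refine Finset.sum_le_sum fun e _ => Finset.sum_le_sum fun f _ => ?_
    have hww : 0 ≤ G.weight e.edge * G.weight f.edge :=
      mul_nonneg (G.weight_mem _).1 (G.weight_mem _).1
    by_cases hef : e = f
    · rw [if_pos hef]
      simp only [hK]
      split_ifs
      exacts [mul_nonneg (G.weight_mem _).1 (G.weight_mem _).1, le_rfl]
    · rw [if_neg hef]
      have hef' : e.edge ≠ f.edge := fun h => hef (VPair.edge_injective h)
      by_cases hx : ∀ x, x ∈ e.edge → x ∉ f.edge
      · by_cases hM : M e.edge f.edge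
        · have : K e.1.1 e.1.2 f.1.1 f.1.2 = G.weight e.edge * G.weight f.edge := if_pos ⟨hx, hM⟩
          rw [this]
          refine mul_le_of_le_one_right hww ?_
          have := h₁ _ _ hef'
          rw [if_pos hM] at this
          exact_mod_cast this
        · have : K e.1.1 e.1.2 f.1.1 f.1.2 = 0 := if_neg fun h => hM h.2
          rw [this]
          have := h₁ _ _ hef'
          rw [if_neg hM, Nat.le_zero] at this
          rw [this]
          simp
      · have : K e.1.1 e.1.2 f.1.1 f.1.2 = 0 := if_neg fun h => hx h.1
        rw [this]
        push Not at hx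
        obtain ⟨x, hxe, hxf⟩ := hx
        rw [h₀ _ _ hef' x hxe hxf]
        simp
  have hle : ∑ a : Fin 4 → V, K (a 0) (a 1) (a 2) (a 3) ≤ ∑ a : Fin 4 → V,
      if Function.Injective a ∧ M s(a 0, a 1) s(a 2, a 3) then
        G.weight s(a 0, a 1) * G.weight s(a 2, a 3) else 0 := by
    refine Finset.sum_le_sum fun a _ => ?_
    simp only [hK]
    by_cases hc : (∀ x, x ∈ s(a 0, a 1) → x ∉ s(a 2, a 3)) ∧ M s(a 0, a 1) s(a 2, a 3)
    · rw [if_pos hc]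
      by_cases h01 : a 0 = a 1
      · rw [h01, weight_diag, zero_mul]
        split_ifs <;> exact le_rfl
      by_cases h23 : a 2 = a 3
      · rw [h23, weight_diag, mul_zero]
        split_ifs <;> exact le_rfl
      have h0 := hc.1 (a 0) (by simp)
      have h1 := hc.1 (a 1) (by simp)
      simp only [Sym2.mem_iff, not_or] at h0 h1
      have hinj : Function.Injective a := by
        intro i j hij
        fin_cases i <;> fin_cases j <;> first | rfl | (exfalso; simp at hij; grind)
      rw [if_pos ⟨hinj, hc.2⟩]
    · rw [if_neg hc]
      split_ifs
      exacts [mul_nonneg (G.weight_mem _).1 (G.weight_mem _).1, le_rfl]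
  linarith

open Classical in
/-- Quadruples of vertices with coincidences contribute little. -/
theorem sum_fin_four_weight_le {X N : V → V → V → V → ℝ} (hX₀ : ∀ u w k l, 0 ≤ X u w k l)
    (hX₁ : ∀ u w k l, X u w k l ≤ 1) (h₁ : ∀ u w k l, N u w k l = N w u k l)
    (h₂ : ∀ u w k l, N u w k l = N u w l k)
    (h : ∀ u w k l, G.weight s(u, w) ≠ 0 → G.weight s(k, l) ≠ 0 →
      (∀ x, x ∈ s(u, w) → x ∉ s(k, l)) → X u w k l ≤ N u w k l) :
    ∑ a : Fin 4 → V, G.weight s(a 0, a 1) * G.weight s(a 2, a 3) * X (a 0) (a 1) (a 2) (a 3) ≤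
      4 * (Fintype.card V : ℝ) ^ 3 + 4 * ∑ e : VPair V, ∑ f : VPair V,
        if ∀ x, x ∈ e.edge → x ∉ f.edge then
          G.weight e.edge * G.weight f.edge * N e.1.1 e.1.2 f.1.1 f.1.2 else 0 := by
  set K : V → V → V → V → ℝ := fun u w k l =>
    if ∀ x, x ∈ s(u, w) → x ∉ s(k, l) then
      G.weight s(u, w) * G.weight s(k, l) * N u w k l else 0 with hK
  have hK4 := sum_fin_four_eq_four_mul (K := K)
    (fun u w k l => by simp only [hK, Sym2.eq_swap (a := u), h₁ u w])
    (fun u w k l => by simp only [hK, Sym2.eq_swap (a := k), h₂ u w k l])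
    (fun u k l => by simp [hK, weight_diag]) (fun u w k => by simp [hK, weight_diag])
  change _ ≤ _ + 4 * ∑ e : VPair V, ∑ f : VPair V, K e.1.1 e.1.2 f.1.1 f.1.2
  rw [← hK4]
  -- A bound for the quadruples whose pairs share a vertex: each of the four possible coincidences
  -- leaves three indices free, which gives four times the cube of the number of vertices.
  set J : V → V → V → V → ℝ := fun u w k l => (if u = k then 1 else 0) + (if u = l then 1 else 0) +
    (if w = k then 1 else 0) + if w = l then 1 else 0 with hJ
  have hJ4 : ∑ a : Fin 4 → V, J (a 0) (a 1) (a 2) (a 3) = 4 * (Fintype.card V : ℝ) ^ 3 := by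
    rw [sum_fin_four]
    simp only [hJ, Finset.sum_add_distrib, Finset.sum_ite_eq, Finset.mem_univ,
      if_true, Finset.sum_const, Finset.card_univ, nsmul_eq_mul, mul_one,
      Finset.mul_sum]
    simp only [Finset.sum_const, Finset.card_univ, nsmul_eq_mul, mul_ite, mul_one, mul_zero,
      Finset.sum_ite_eq, Finset.mem_univ, if_true]
    ring
  rw [← hJ4, ← Finset.sum_add_distrib]
  refine Finset.sum_le_sum fun a _ => ?_
  have hw1 := G.weight_mem s(a 0, a 1)
  have hw2 := G.weight_mem s(a 2, a 3)
  have hww : 0 ≤ G.weight s(a 0, a 1) * G.weight s(a 2, a 3) := mul_nonneg hw1.1 hw2.1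
  have hite : ∀ p q : V, (0 : ℝ) ≤ if p = q then 1 else 0 := fun p q => by split_ifs <;> norm_num
  have hJ0 : 0 ≤ J (a 0) (a 1) (a 2) (a 3) :=
    add_nonneg (add_nonneg (add_nonneg (hite _ _) (hite _ _)) (hite _ _)) (hite _ _)
  by_cases hd : ∀ x, x ∈ s(a 0, a 1) → x ∉ s(a 2, a 3)
  · have : K (a 0) (a 1) (a 2) (a 3) =
        G.weight s(a 0, a 1) * G.weight s(a 2, a 3) * N (a 0) (a 1) (a 2) (a 3) := if_pos hd
    rw [this]
    rcases eq_or_ne (G.weight s(a 0, a 1)) 0 with h0 | h0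
    · simpa [h0] using hJ0
    rcases eq_or_ne (G.weight s(a 2, a 3)) 0 with h0' | h0'
    · simpa [h0'] using hJ0
    have := mul_le_mul_of_nonneg_left (h _ _ _ _ h0 h0' hd) hww
    linarith
  · have : K (a 0) (a 1) (a 2) (a 3) = 0 := if_neg hd
    rw [this, add_zero]
    have h1 : G.weight s(a 0, a 1) * G.weight s(a 2, a 3) * X (a 0) (a 1) (a 2) (a 3) ≤ 1 := by
      have := mul_le_one₀ (mul_le_one₀ hw1.2 hw2.1 hw2.2) (hX₀ _ _ _ _) (hX₁ (a 0) (a 1) (a 2) (a 3))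
      exact this
    refine h1.trans ?_
    push Not at hd
    obtain ⟨x, hx, hx'⟩ := hd
    rw [Sym2.mem_iff] at hx hx'
    have e1 := hite (a 0) (a 2)
    have e2 := hite (a 0) (a 3)
    have e3 := hite (a 1) (a 2)
    have e4 := hite (a 1) (a 3)
    rcases hx with hx | hx <;> rcases hx' with hx' | hx' <;>
    · have := hx.symm.trans hx'
      simp only [hJ]
      rw [if_pos this] at *
      linarith

end Sums

/-! ### Lower bounds for the densities of step graphons -/

section Lower
variable {V : Type*} [Fintype V] (G : EdgeWeightedGraph V)

-- The sampling argument with the parts renamed to vertices. The family `S` is arbitrary, so that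
-- segments and curves are treated alike.
open Classical in
theorem exists_sample_weight [DecidableEq V] {n : ℕ} (hn : 0 < n) (ord : Fin n ≃ V) {S : I → I → Set Plane}
    (hS : NullMeasurableSet {z : Fin 4 → I | (S (z 0) (z 1) ∩ S (z 2) (z 3)).Nonempty} volume) :
    ∃ y : V → I, (∑ a : Fin 4 → V, if Function.Injective a ∧
        (S (y (a 0)) (y (a 1)) ∩ S (y (a 2)) (y (a 3))).Nonempty then
          G.weight s(a 0, a 1) * G.weight s(a 2, a 3) else 0) ≤
      (n : ℝ) ^ 4 * ∫ z : Fin 4 → I, (G.stepGraphon hn ord).toFun (z 0) (z 1) *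
        (G.stepGraphon hn ord).toFun (z 2) (z 3) *
        (if (S (z 0) (z 1) ∩ S (z 2) (z 3)).Nonempty then (1 : ℝ) else 0) := by
  obtain ⟨x, -, hx⟩ := exists_sample hn (C := fun a => G.weight s(ord (a 0), ord (a 1)) *
    G.weight s(ord (a 2), ord (a 3)))
    (fun a => mul_nonneg (G.weight_mem _).1 (G.weight_mem _).1) hS
  refine ⟨fun v => x (ord.symm v), ?_⟩
  have h1 : ∀ z : Fin 4 → I, (G.stepGraphon hn ord).toFun (z 0) (z 1) *
        (G.stepGraphon hn ord).toFun (z 2) (z 3) *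
        (if (S (z 0) (z 1) ∩ S (z 2) (z 3)).Nonempty then (1 : ℝ) else 0) =
      G.weight s(ord (intervalIndex hn (z 0)), ord (intervalIndex hn (z 1))) *
        G.weight s(ord (intervalIndex hn (z 2)), ord (intervalIndex hn (z 3))) *
        {z : Fin 4 → I | (S (z 0) (z 1) ∩ S (z 2) (z 3)).Nonempty}.indicator 1 z := by
    intro z
    rw [indicator_apply]
    rfl
  simp only [h1]
  refine le_trans (le_of_eq ?_) hx
  refine (Fintype.sum_equiv (Equiv.arrowCongr (Equiv.refl (Fin 4)) ord) _ _ fun b => ?_).symm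
  have hinj : Function.Injective ((Equiv.arrowCongr (Equiv.refl (Fin 4)) ord) b) ↔
      Function.Injective b := by
    change Function.Injective (ord ∘ b) ↔ _
    exact ord.injective.of_comp_iff b
  have happ : ∀ k, (Equiv.arrowCongr (Equiv.refl (Fin 4)) ord) b k = ord (b k) := fun k => rfl
  simp only [hinj, happ, Equiv.symm_apply_apply]
  rfl

theorem crDrawing_nonneg (D : GraphDrawing G.toSimpleGraph) : 0 ≤ G.crDrawing D := by
  classical
  refine mul_nonneg (by norm_num) (Finset.sum_nonneg fun e _ => Finset.sum_nonneg fun f _ => ?_)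
  split_ifs
  · rfl
  · exact mul_nonneg (mul_nonneg (G.weight_mem _).1 (G.weight_mem _).1) (Nat.cast_nonneg _)

theorem cr_le (D : GraphDrawing G.toSimpleGraph) : G.cr ≤ G.crDrawing D :=
  ciInf_le ⟨0, by rintro _ ⟨D, rfl⟩; exact crDrawing_nonneg G D⟩ D

theorem rectCr_le {D : GraphDrawing G.toSimpleGraph} (hD : D.IsStraightLine) :
    G.rectCr ≤ G.crDrawing D :=
  ciInf_le (f := fun D : {D : GraphDrawing G.toSimpleGraph // D.IsStraightLine} => G.crDrawing D.1)
    ⟨0, by rintro _ ⟨D, rfl⟩; exact crDrawing_nonneg G D.1⟩ ⟨D, hD⟩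

end Lower

namespace Config

variable {V : Type*} [LinearOrder V] [Fintype V] (G : EdgeWeightedGraph V)

open Classical in
theorem Generic.exists_crDrawing_le {c : Config V} (hc : c.Generic)
    (hs : ∀ e, IsSimpleLine (c.poly e)) {M : Sym2 V → Sym2 V → Prop} (hM : c.CrossesWithin M univ) :
    ∃ D : GraphDrawing G.toSimpleGraph, ((∀ e, c.bends e = []) → D.IsStraightLine) ∧
      8 * G.crDrawing D ≤ ∑ a : Fin 4 → V,
        if Function.Injective a ∧ M s(a 0, a 1) s(a 2, a 3) then
          G.weight s(a 0, a 1) * G.weight s(a 2, a 3) else 0 := by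
  obtain ⟨D, h1, h2⟩ := hc.exists_graphDrawing hs (fun e f hef => by
    rw [← c.line_eq_poly, ← c.line_eq_poly]
    exact (hM _ trivial _ trivial _ trivial _ trivial e.2.ne f.2.ne
      fun h => hef (VPair.edge_injective h)).1) G.toSimpleGraph
  refine ⟨D, h1, eight_mul_crDrawing_le G D ?_ ?_⟩
  · intro e f hef
    rw [interCount]
    split_ifs with h h' h'
    · induction e using Sym2.ind with
      | _ u w =>
      induction f using Sym2.ind with
      | _ k l =>
      refine (h2 ⟨_, h.1⟩ ⟨_, h.2⟩ (fun h => hef (congrArg Subtype.val h)) u w k l rfl rfl).1.trans ?_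
      exact (hM _ trivial _ trivial _ trivial _ trivial (G.ne_of_adj h.1) (G.ne_of_adj h.2) hef).1
    · induction e using Sym2.ind with
      | _ u w =>
      induction f using Sym2.ind with
      | _ k l =>
      refine (h2 ⟨_, h.1⟩ ⟨_, h.2⟩ (fun h => hef (congrArg Subtype.val h)) u w k l rfl rfl).1.trans ?_
      exact ((hM _ trivial _ trivial _ trivial _ trivial (G.ne_of_adj h.1) (G.ne_of_adj h.2)
        hef).2 h').le
    · exact Nat.zero_le _
    · exact le_rfl
  · intro e f hef x hxe hxf
    rw [interCount]
    split_ifs with h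
    · induction e using Sym2.ind with
      | _ u w =>
      induction f using Sym2.ind with
      | _ k l =>
      exact (h2 ⟨_, h.1⟩ ⟨_, h.2⟩ (fun h => hef (congrArg Subtype.val h)) u w k l rfl rfl).2 x hxe hxf
    · rfl

end Config

section Lower
variable {V : Type*} [LinearOrder V] [Fintype V] (G : EdgeWeightedGraph V)

theorem nullMeasurableSet_meet {f : I → Plane} (hf : AEMeasurable f volume) :
    NullMeasurableSet {z : Fin 4 → I | (convexHull ℝ {f (z 0), f (z 1)} ∩
      convexHull ℝ {f (z 2), f (z 3)}).Nonempty} volume := by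
  have h : ∀ k : Fin 4, AEMeasurable (fun z : Fin 4 → I => f (z k)) volume := fun k =>
    hf.comp_quasiMeasurePreserving
      (measurePreserving_eval (fun _ : Fin 4 => (volume : Measure I)) k).quasiMeasurePreserving
  have := (((h 0).prodMk (h 1)).prodMk ((h 2).prodMk (h 3))).nullMeasurableSet_preimage
    isClosed_meet.measurableSet
  simp only [convexHull_pair]
  exact this

/-- The sampled points may coincide or be collinear, but a small perturbation makes no disjoint
segments meet, and two segments count as at most one crossing in any case. No cloning is needed. -/
theorem exists_straight_crDrawing_le {n : ℕ} (hn : 0 < n) (ord : Fin n ≃ V) {f : I → Plane}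
    (hf : AEMeasurable f volume) : ∃ D : GraphDrawing G.toSimpleGraph, D.IsStraightLine ∧
      G.crDrawing D ≤ (n : ℝ) ^ 4 * (G.stepGraphon hn ord).rectCdMap f := by
  classical
  obtain ⟨y, hy⟩ := exists_sample_weight G hn ord
    (S := fun a b => convexHull ℝ {f a, f b}) (nullMeasurableSet_meet hf)
  set Q : Sym2 V → Set Plane := Sym2.lift ⟨fun u w => convexHull ℝ {f (y u), f (y w)},
    fun u w => congrArg _ (pair_comm _ _)⟩ with hQ
  obtain ⟨c₁, g1, g2, g3⟩ := (⟨fun v => f (y v), fun _ => []⟩ : Config V).exists_generic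
  obtain ⟨c₂, r1, r2, r3, r4⟩ := g1.exists_simple
  have hb : ∀ e, c₂.bends e = [] := r4 fun e => List.length_eq_zero_iff.1 (by rw [g3]; rfl)
  have hM : c₂.CrossesWithin (fun e f => (Q e ∩ Q f).Nonempty) univ := by
    intro u _ w _ k _ l _ huw hkl hne
    have h1 := Config.cross_line_le (fun e f hef => (r3 e f hef).trans (g2 e f)) huw hkl hne
    have hl : ∀ u w, (⟨fun v => f (y v), fun _ => []⟩ : Config V).line u w =
        [f (y u), f (y w)] := by
      intro u w
      have : (⟨fun v => f (y v), fun _ => []⟩ : Config V).bendsFrom u w = [] := by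
        simp [Config.bendsFrom]
      rw [Config.line, this]
      rfl
    rw [hl, hl] at h1
    have h2 : cross [f (y u), f (y w)] [f (y k), f (y l)] =
        meets (f (y u), f (y w)) (f (y k), f (y l)) := by simp [cross, crossS]
    rw [h2] at h1
    refine ⟨h1.trans (meets_le_one _ _), fun hno => ?_⟩
    rw [meets_eq_zero] at h1
    · omega
    · intro hm
      refine hno ?_
      change (convexHull ℝ {f (y u), f (y w)} ∩ convexHull ℝ {f (y k), f (y l)}).Nonempty
      rw [convexHull_pair, convexHull_pair]
      exact hm
  obtain ⟨D, h1, h2⟩ := r1.exists_crDrawing_le G r2 hM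
  refine ⟨D, h1 hb, ?_⟩
  have h3 := h2.trans hy
  rw [Graphon.rectCdMap]
  linarith

/-! ### From simple graphon drawings to drawings of graphs -/

/-- The change of parameter is a continuous bijection of the unit interval, hence monotone, and so
it keeps or exchanges the ends. -/
theorem eq_pair_of_range_eq {γ δ : C(I, Plane)} (hγ : Function.Injective γ)
    (hδ : Function.Injective δ) (h : range γ = range δ) :
    (γ 0 = δ 0 ∧ γ 1 = δ 1) ∨ (γ 0 = δ 1 ∧ γ 1 = δ 0) := by
  have he : Topology.IsClosedEmbedding γ :=
    γ.continuous.isClosedEmbedding hγ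
  choose φ hφ using fun t : I => (h ▸ mem_range_self t : δ t ∈ range γ)
  have hcont : Continuous φ := by
    rw [he.isInducing.continuous_iff]
    exact δ.continuous.congr fun t => (hφ t).symm
  have hinj : Function.Injective φ := fun s t hst => hδ (by rw [← hφ, ← hφ, hst])
  have hsurj : Function.Surjective φ := by
    intro s
    obtain ⟨t, ht⟩ : γ s ∈ range δ := h ▸ mem_range_self s
    exact ⟨t, hγ ((hφ t).trans ht)⟩
  rcases hcont.strictMono_of_inj_boundedOrder' hinj with hm | hm
  · obtain ⟨s, hs⟩ := hsurj 0
    obtain ⟨t, ht⟩ := hsurj 1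
    have h0 : φ 0 = 0 := le_antisymm ((hm.monotone unitInterval.nonneg').trans_eq hs) unitInterval.nonneg'
    have h1 : φ 1 = 1 := le_antisymm unitInterval.le_one' (ht.symm.trans_le (hm.monotone unitInterval.le_one'))
    exact Or.inl ⟨by rw [← hφ 0, h0], by rw [← hφ 1, h1]⟩
  · obtain ⟨s, hs⟩ := hsurj 0
    obtain ⟨t, ht⟩ := hsurj 1
    have h0 : φ 0 = 1 := le_antisymm unitInterval.le_one' (ht.symm.trans_le (hm.antitone unitInterval.nonneg'))
    have h1 : φ 1 = 0 := le_antisymm ((hm.antitone unitInterval.le_one').trans_eq hs) unitInterval.nonneg'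
    exact Or.inr ⟨by rw [← hφ 1, h1], by rw [← hφ 0, h0]⟩

namespace GraphonDrawing

variable (D : GraphonDrawing)

theorem curve_one (x y : I) : D.curve x y 1 = D.pos y := by
  rw [D.curve_symm, unitInterval.symm_one, D.curve_zero]

theorem range_curve_symm (x y : I) : range (D.curve x y) = range (D.curve y x) := by
  have : ⇑(D.curve x y) = D.curve y x ∘ unitInterval.symm := funext fun t => D.curve_symm x y t
  rw [this, unitInterval.symm_bijective.surjective.range_comp]

theorem injective_curve {x y : I} (h : D.pos x ≠ D.pos y) : Function.Injective (D.curve x y) := by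
  refine (D.simple_or_const x y).resolve_right ?_
  rintro ⟨p, hp⟩
  exact h (by rw [← D.curve_zero x y, ← D.curve_one x y, hp, hp])

theorem pos_mem_range_left (x y : I) : D.pos x ∈ range (D.curve x y) := ⟨0, D.curve_zero x y⟩

theorem pos_mem_range_right (x y : I) : D.pos y ∈ range (D.curve x y) := ⟨1, D.curve_one x y⟩

theorem range_curve_of_pos_eq {x y : I} (h : D.pos x = D.pos y) :
    range (D.curve x y) = {D.pos x} := by
  rcases D.simple_or_const x y with hi | ⟨p, hp⟩
  · have := hi ((D.curve_zero x y).trans (h.trans (D.curve_one x y).symm))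
    exact absurd this zero_ne_one
  · have h0 := hp 0
    rw [D.curve_zero] at h0
    rw [h0]
    refine eq_singleton_iff_unique_mem.2 ⟨⟨0, hp 0⟩, ?_⟩
    rintro _ ⟨t, rfl⟩
    exact hp t

/-- Curves with the same two different ends share two points, so their images must agree; if the
ends coincide, the curves are constant. -/
theorem range_curve_congr {x x' : I} (h : D.pos x = D.pos x') (y : I) :
    range (D.curve x y) = range (D.curve x' y) := by
  by_cases hy : D.pos x = D.pos y
  · rw [D.range_curve_of_pos_eq hy, D.range_curve_of_pos_eq (h.symm.trans hy), h]
  · by_contra hne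
    exact hy (D.inter_subsingleton _ _ _ _ hne
      ⟨D.pos_mem_range_left x y, h ▸ D.pos_mem_range_left x' y⟩
      ⟨D.pos_mem_range_right x y, D.pos_mem_range_right x' y⟩)

end GraphonDrawing

/-- The relation passed to the cloning step is that the sampled curves meet. It is compatible with
clones because vertices sampled at the same point have curves with the same images. -/
theorem exists_crDrawing_le_cdDrawing {n : ℕ} (hn : 0 < n) (ord : Fin n ≃ V) (D : GraphonDrawing) :
    ∃ D' : GraphDrawing G.toSimpleGraph,
      G.crDrawing D' ≤ (n : ℝ) ^ 4 * (G.stepGraphon hn ord).cdDrawing D := by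
  classical
  obtain ⟨y, hy⟩ := exists_sample_weight G hn ord
    (S := fun a b => range (D.curve a b)) D.measurable_meet
  set Q : Sym2 V → Set Plane := Sym2.lift ⟨fun u w => range (D.curve (y u) (y w)),
    fun u w => D.range_curve_symm _ _⟩ with hQ
  have hQmem : ∀ x e, x ∈ e → D.pos (y x) ∈ Q e := by
    intro x e hx
    induction e using Sym2.ind with
    | _ u w =>
      rcases Sym2.mem_iff.1 hx with rfl | rfl
      · exact D.pos_mem_range_left _ _
      · exact D.pos_mem_range_right _ _
  have : Nonempty V := ⟨ord ⟨0, hn⟩⟩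
  set P : V → Plane := fun v => D.pos (y v) with hP
  -- One representative is chosen among the vertices that are sampled at the same point.
  set ρ : V → V := fun v => Function.invFun P (P v) with hρ
  have hPρ : ∀ v, P (ρ v) = P v := fun v => Function.invFun_eq ⟨v, rfl⟩
  set A : Set V := range ρ with hA
  have hPA : ∀ u ∈ A, ∀ w ∈ A, P u = P w → u = w := by
    rintro _ ⟨u, rfl⟩ _ ⟨w, rfl⟩ h
    rw [hPρ, hPρ] at h
    simp only [hρ, h]
  let ι := {e : VPair V // e.1.1 ∈ A ∧ e.1.2 ∈ A}
  set κ : ι → C(I, Plane) := fun e => D.curve (y e.1.1.1) (y e.1.1.2) with hκ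
  have hκi : ∀ e, Function.Injective (κ e) := fun e =>
    D.injective_curve fun h => e.1.2.ne (hPA _ e.2.1 _ e.2.2 h)
  -- The image of a simple curve determines its ends, so different pairs of representatives have
  -- different images and meet at most once.
  have hκs : ∀ e f, e ≠ f → (range (κ e) ∩ range (κ f)).Subsingleton := by
    intro e f hef
    refine D.inter_subsingleton _ _ _ _ fun hr => hef (Subtype.ext (VPair.edge_injective ?_))
    refine Sym2.eq_iff.2 ?_
    have h0 : ∀ e, κ e 0 = P e.1.1.1 := fun e => D.curve_zero _ _
    have h1 : ∀ e, κ e 1 = P e.1.1.2 := fun e => D.curve_one _ _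
    rcases eq_pair_of_range_eq (hκi e) (hκi f) hr with ⟨h, h'⟩ | ⟨h, h'⟩
    · rw [h0, h0] at h
      rw [h1, h1] at h'
      exact Or.inl ⟨hPA _ e.2.1 _ f.2.1 h, hPA _ e.2.2 _ f.2.2 h'⟩
    · rw [h0, h1] at h
      rw [h1, h0] at h'
      exact Or.inr ⟨hPA _ e.2.1 _ f.2.2 h, hPA _ e.2.2 _ f.2.1 h'⟩
  obtain ⟨L, hL0, hL1, hLc⟩ := exists_polygonal κ fun e f hef => (hκs e f hef).finite
  have hmid : ∀ e : ι, ∃ m, L e = P e.1.1.1 :: m ++ [P e.1.1.2] := by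
    intro e
    refine exists_eq_cons_concat ?_ ?_ fun h => e.1.2.ne (hPA _ e.2.1 _ e.2.2 h)
    · rw [hL0]
      exact congrArg some (D.curve_zero _ _)
    · rw [hL1]
      exact congrArg some (D.curve_one _ _)
  choose m hm using hmid
  -- Pairs with a vertex outside `A` are drawn straight for the time being; cloning redraws them, so
  -- their crossings do not matter.
  set c₀ : Config V := ⟨P, fun e => if h : e.1.1 ∈ A ∧ e.1.2 ∈ A then m ⟨e, h⟩ else []⟩ with hc₀
  have hc₀L : ∀ e : ι, c₀.poly e.1 = L e := by
    intro e
    rw [hm, Config.poly, hc₀]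
    simp only [dif_pos e.2]
    rfl
  obtain ⟨c₁, g1, g2, -⟩ := c₀.exists_generic
  obtain ⟨c₂, r1, r2, r3, -⟩ := g1.exists_simple
  have hA₁ : c₂.CrossesWithin (fun e f => (Q e ∩ Q f).Nonempty) A := by
    intro u hu w hw k hk l hl huw hkl hne
    have h1 := Config.cross_line_le (fun e f hef => (r3 e f hef).trans (g2 e f)) huw hkl hne
    obtain ⟨e, he, -⟩ := Config.exists_pair huw
    obtain ⟨f, hf, -⟩ := Config.exists_pair hkl
    have hmem : ∀ {u w : V} {e : VPair V}, s(e.1.1, e.1.2) = s(u, w) → u ∈ A → w ∈ A →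
        e.1.1 ∈ A ∧ e.1.2 ∈ A := by
      intro u w e he hu hw
      rcases Sym2.eq_iff.1 he with ⟨h, h'⟩ | ⟨h, h'⟩ <;> rw [h, h']
      exacts [⟨hu, hw⟩, ⟨hw, hu⟩]
    have he' := hmem he hu hw
    have hf' := hmem hf hk hl
    have hef : (⟨e, he'⟩ : ι) ≠ ⟨f, hf'⟩ := fun h => hne (by
      rw [← he, ← hf, show e = f from congrArg Subtype.val h])
    have hE : cross (c₀.line u w) (c₀.line k l) = cross (L ⟨e, he'⟩) (L ⟨f, hf'⟩) := by
      rw [Config.cross_line_congr he.symm, cross_comm, Config.cross_line_congr hf.symm, cross_comm,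
        Config.line_eq_poly, Config.line_eq_poly, ← hc₀L, ← hc₀L]
    rw [hE] at h1
    have h2 := h1.trans (hLc _ _ hef)
    refine ⟨h2.trans ?_, fun hno => ?_⟩
    · have hss := hκs _ _ hef
      exact (ncard_le_one hss.finite).2 fun a ha b hb => hss ha hb
    · have hQe : range (κ ⟨e, he'⟩) = Q s(u, w) := by rw [← he]; rfl
      have hQf : range (κ ⟨f, hf'⟩) = Q s(k, l) := by rw [← hf]; rfl
      rw [hQe, hQf, not_nonempty_iff_eq_empty.1 hno, ncard_empty] at h2
      omega
  obtain ⟨c₃, k1, k2, k3⟩ := r1.exists_crossesWithin_univ (ρ := ρ)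
    (M := fun e f => (Q e ∩ Q f).Nonempty)
    (fun e f h => by rwa [inter_comm]) (fun x e f hxe hxf => ⟨_, hQmem x e hxe, hQmem x f hxf⟩)
    (fun v => mem_range_self v) (fun v j e h => by
      have : Q s(ρ v, j) = Q s(v, j) := D.range_curve_congr (hPρ v) (y j)
      rwa [this] at h) r2 hA₁
  obtain ⟨D', -, h2⟩ := k1.exists_crDrawing_le G k2 k3
  refine ⟨D', ?_⟩
  have h3 := h2.trans hy
  rw [Graphon.cdDrawing]
  linarith

end Lower

/-! ### Upper bounds for the densities of step graphons -/

namespace GraphDrawing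

variable {V : Type*} {G : SimpleGraph V} (D : GraphDrawing G)

theorem mem_curveInterior_or {e : G.edgeSet} {p : Plane} (hp : p ∈ range (D.arc e)) :
    p ∈ curveInterior (D.arc e) ∨ ∃ v ∈ e.1, p = D.pos v := by
  rw [curveInterior_eq (D.arc_simple e), or_iff_not_imp_left, Set.mem_sdiff]
  intro h
  have h' : p ∈ s(D.arc e 0, D.arc e 1) := by
    rw [Sym2.mem_iff]
    by_contra hne
    exact h ⟨hp, hne⟩
  rw [D.arc_endpoints, Sym2.mem_map] at h'
  obtain ⟨v, hv, rfl⟩ := h'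
  exact ⟨v, hv, rfl⟩

theorem inter_range_subset (e f : G.edgeSet) : range (D.arc e) ∩ range (D.arc f) ⊆
    (curveInterior (D.arc e) ∩ curveInterior (D.arc f)) ∪ D.pos '' {v | v ∈ e.1 ∧ v ∈ f.1} := by
  rintro p ⟨hpe, hpf⟩
  rcases D.mem_curveInterior_or hpe with he | ⟨v, hv, rfl⟩
  · rcases D.mem_curveInterior_or hpf with hf | ⟨v, hv, rfl⟩
    · exact Or.inl ⟨he, hf⟩
    · exact Or.inr ⟨v, ⟨D.avoids_vertices e v hpe, hv⟩, rfl⟩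
  · exact Or.inr ⟨v, ⟨hv, D.avoids_vertices f v hpf⟩, rfl⟩

theorem subsingleton_common {e f : Sym2 V} (h : e ≠ f) : {v | v ∈ e ∧ v ∈ f}.Subsingleton := by
  rintro u ⟨hu, hu'⟩ w ⟨hw, hw'⟩
  by_contra huw
  exact h (((Sym2.mem_and_mem_iff huw).1 ⟨hu, hw⟩).trans ((Sym2.mem_and_mem_iff huw).1 ⟨hu', hw'⟩).symm)

theorem finite_inter_range {e f : G.edgeSet} (h : e ≠ f) :
    (range (D.arc e) ∩ range (D.arc f)).Finite :=
  ((D.finite_crossings e f h).union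
    ((subsingleton_common fun h' => h (Subtype.ext h')).finite.image _)).subset
      (D.inter_range_subset e f)

open Classical in
theorem ncard_inter_range_le {e f : G.edgeSet} (h : e ≠ f) :
    (range (D.arc e) ∩ range (D.arc f)).ncard ≤
      interCount D e f + if ∀ x, x ∈ e.1 → x ∉ f.1 then 0 else 1 := by
  have hss := subsingleton_common fun h' : e.1 = f.1 => h (Subtype.ext h')
  rw [interCount, dif_pos ⟨e.2, f.2⟩]
  refine (ncard_le_ncard (D.inter_range_subset e f)
    ((D.finite_crossings e f h).union (hss.finite.image _))).trans ?_
  refine (ncard_union_le _ _).trans (Nat.add_le_add_left ?_ _)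
  split_ifs with hd
  · have : {v | v ∈ e.1 ∧ v ∈ f.1} = ∅ :=
      eq_empty_iff_forall_notMem.2 fun v hv => hd v hv.1 hv.2
    rw [this, image_empty, ncard_empty]
  · exact (ncard_image_le hss.finite).trans ((ncard_le_one hss.finite).2 fun a ha b hb => hss ha hb)

end GraphDrawing

theorem integral_stepGraphon {V : Type*} [Fintype V] (G : EdgeWeightedGraph V) {n : ℕ}
    (hn : 0 < n) (ord : Fin n ≃ V)
    (X : V → V → V → V → ℝ) :
    ∫ z : Fin 4 → I, (G.stepGraphon hn ord).toFun (z 0) (z 1) *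
        (G.stepGraphon hn ord).toFun (z 2) (z 3) *
        X (ord (intervalIndex hn (z 0))) (ord (intervalIndex hn (z 1)))
          (ord (intervalIndex hn (z 2))) (ord (intervalIndex hn (z 3))) =
      (∑ a : Fin 4 → V, G.weight s(a 0, a 1) * G.weight s(a 2, a 3) *
        X (a 0) (a 1) (a 2) (a 3)) / (n : ℝ) ^ 4 := by
  refine (integral_step hn fun a => G.weight s(ord (a 0), ord (a 1)) *
    G.weight s(ord (a 2), ord (a 3)) * X (ord (a 0)) (ord (a 1)) (ord (a 2)) (ord (a 3))).trans ?_
  congr 1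
  exact Fintype.sum_equiv (Equiv.arrowCongr (Equiv.refl (Fin 4)) ord) _ _ fun b => rfl

theorem Config.one_le_cross {V : Type*} [LinearOrder V] (c : Config V) {e f : VPair V}
    (h : ¬ ∀ x, x ∈ e.edge → x ∉ f.edge) : 1 ≤ cross (c.poly e) (c.poly f) := by
  push Not at h
  obtain ⟨x, hxe, hxf⟩ := h
  have key : ∀ e : VPair V, x ∈ e.edge → c.pos x ∈ img (c.poly e) := by
    intro e hx
    refine mem_img_of_mem ?_ (c.two_le_length_poly e)
    rw [mem_poly]
    rcases Sym2.mem_iff.1 hx with rfl | rfl <;> simp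
  rw [Nat.one_le_iff_ne_zero, Ne, cross_eq_zero]
  exact fun hd => Set.disjoint_left.1 hd (key e hxe) (key f hxf)

section Upper
variable {V : Type*} [LinearOrder V] [Fintype V] (G : EdgeWeightedGraph V)

/-- The map is constant on every part. Segments of disjoint edges that meet have a common interior
point, as no edge passes through a foreign vertex, so the indicator is at most the number of
crossings. -/
theorem exists_rectCdMap_le {n : ℕ} (hn : 0 < n) (ord : Fin n ≃ V)
    {D : GraphDrawing G.toSimpleGraph} (hD : D.IsStraightLine) :
    ∃ f : I → Plane, Measurable f ∧ Bornology.IsBounded (range f) ∧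
      (G.stepGraphon hn ord).rectCdMap f ≤
        1 / 8 * ((4 * (Fintype.card V : ℝ) ^ 3 + 8 * G.crDrawing D) / (n : ℝ) ^ 4) := by
  classical
  refine ⟨fun z => D.pos (ord (intervalIndex hn z)), ?_, ?_, ?_⟩
  · exact (measurable_of_finite fun i => D.pos (ord i)).comp (measurable_intervalIndex hn)
  · exact ((Set.finite_range fun i => D.pos (ord i)).subset
      (range_comp_subset_range (intervalIndex hn) fun i => D.pos (ord i))).isBounded
  rw [Graphon.rectCdMap]
  refine mul_le_mul_of_nonneg_left ?_ (by norm_num)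
  set X : V → V → V → V → ℝ := fun u w k l => if (convexHull ℝ {D.pos u, D.pos w} ∩
    convexHull ℝ {D.pos k, D.pos l}).Nonempty then 1 else 0 with hX
  refine (integral_stepGraphon G hn ord X).trans_le ?_
  refine div_le_div_of_nonneg_right ?_ (by positivity)
  refine (sum_fin_four_weight_le G (N := fun u w k l => interCount D s(u, w) s(k, l))
    (fun u w k l => by simp only [hX]; split_ifs <;> norm_num)
    (fun u w k l => by simp only [hX]; split_ifs <;> norm_num)
    (fun u w k l => by rw [Sym2.eq_swap]) (fun u w k l => by rw [Sym2.eq_swap (a := k)])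
    ?_).trans ?_
  · intro u w k l huw hkl hd
    have he : s(u, w) ∈ G.edgeSet := by
      by_contra h
      exact huw (G.weight_eq_zero _ h)
    have hf : s(k, l) ∈ G.edgeSet := by
      by_contra h
      exact hkl (G.weight_eq_zero _ h)
    have hef : (⟨_, he⟩ : G.edgeSet) ≠ ⟨_, hf⟩ := fun h => by
      have h' : s(u, w) = s(k, l) := congrArg Subtype.val h
      exact hd u (by simp) (by rw [← h']; simp)
    have hran : ∀ (u w : V) (he : s(u, w) ∈ G.edgeSet),
        range (D.arc ⟨s(u, w), he⟩) = convexHull ℝ {D.pos u, D.pos w} := by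
      intro u w he
      rw [hD, convexHull_pair]
      have := D.arc_endpoints ⟨s(u, w), he⟩
      rw [Sym2.map_mk, Sym2.eq_iff] at this
      rcases this with ⟨h1, h2⟩ | ⟨h1, h2⟩
      · rw [h1, h2]
      · rw [h1, h2, segment_symm]
    simp only [hX]
    split_ifs with hm
    · rw [← hran u w he, ← hran k l hf] at hm
      have hne : (curveInterior (D.arc ⟨_, he⟩) ∩ curveInterior (D.arc ⟨_, hf⟩)).Nonempty := by
        obtain ⟨p, hp⟩ := hm
        rcases D.inter_range_subset _ _ hp with h | ⟨v, hv, -⟩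
        · exact ⟨p, h⟩
        · exact absurd hv.2 (hd v hv.1)
      rw [interCount, dif_pos ⟨he, hf⟩]
      exact_mod_cast (ncard_pos (D.finite_crossings _ _ hef)).2 hne
    · exact Nat.cast_nonneg _
  · have : (8 : ℝ) * G.crDrawing D = 4 * (2 * G.crDrawing D) := by ring
    rw [this, two_mul_crDrawing]
    refine add_le_add le_rfl (mul_le_mul_of_nonneg_left ?_ (by norm_num))
    refine Finset.sum_le_sum fun e _ => Finset.sum_le_sum fun f _ => ?_
    have hnn : 0 ≤ G.weight e.edge * G.weight f.edge * interCount D e.edge f.edge :=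
      mul_nonneg (mul_nonneg (G.weight_mem _).1 (G.weight_mem _).1) (Nat.cast_nonneg _)
    by_cases hd : ∀ x, x ∈ e.edge → x ∉ f.edge
    · have hef : e ≠ f := by
        rintro rfl
        exact hd e.1.1 (by simp [VPair.edge]) (by simp [VPair.edge])
      rw [if_pos hd, if_neg hef]
      exact le_rfl
    · rw [if_neg hd]
      split_ifs
      exacts [le_rfl, hnn]

open Classical in
/-- Every drawing of a graph can be replaced with a family of polygonal lines. -/
theorem GraphDrawing.exists_config {G : SimpleGraph V} (D : GraphDrawing G) :
    ∃ c : Config V, ∀ e f : VPair V, e ≠ f → e.edge ∈ G.edgeSet → f.edge ∈ G.edgeSet →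
      cross (c.poly e) (c.poly f) ≤ interCount D e.edge f.edge +
        if ∀ x, x ∈ e.edge → x ∉ f.edge then 0 else 1 := by
  obtain ⟨L, hL0, hL1, hLc⟩ := exists_polygonal D.arc fun e f hef => D.finite_inter_range hef
  have hmid : ∀ e : VPair V, ∃ m, ∀ h : e.edge ∈ G.edgeSet, ∀ R,
      cross (D.pos e.1.1 :: m ++ [D.pos e.1.2]) R = cross (L ⟨e.edge, h⟩) R := by
    intro e
    by_cases h : e.edge ∈ G.edgeSet
    · have hne : D.pos e.1.1 ≠ D.pos e.1.2 := D.pos_injective.ne e.2.ne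
      have h' := D.arc_endpoints ⟨e.edge, h⟩
      replace h' : s(D.arc ⟨e.edge, h⟩ 0, D.arc ⟨e.edge, h⟩ 1) = s(D.pos e.1.1, D.pos e.1.2) := h'
      rw [Sym2.eq_iff] at h'
      have k0 := hL0 ⟨e.edge, h⟩
      have k1 := hL1 ⟨e.edge, h⟩
      rcases h' with ⟨h0, h1⟩ | ⟨h0, h1⟩
      · obtain ⟨m, hm⟩ := exists_eq_cons_concat (k0.trans (congrArg some h0))
          (k1.trans (congrArg some h1)) hne
        exact ⟨m, fun _ R => by rw [← hm]⟩
      · obtain ⟨m, hm⟩ := exists_eq_cons_concat (l := (L ⟨e.edge, h⟩).reverse)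
          (by rw [List.head?_reverse]; exact k1.trans (congrArg some h1))
          (by rw [List.getLast?_reverse]; exact k0.trans (congrArg some h0)) hne
        exact ⟨m, fun _ R => by rw [← hm, cross_reverse_left]⟩
    -- A non-edge becomes a straight segment whose crossings are not controlled; it will carry only
    -- a tiny weight.
    · exact ⟨[], fun h' => absurd h' h⟩
  choose m hm using hmid
  refine ⟨⟨D.pos, m⟩, fun e f hef he hf => ?_⟩
  change cross (D.pos e.1.1 :: m e ++ [D.pos e.1.2]) (D.pos f.1.1 :: m f ++ [D.pos f.1.2]) ≤ _
  rw [hm e he, cross_comm, hm f hf, cross_comm]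
  have hne : (⟨e.edge, he⟩ : G.edgeSet) ≠ ⟨f.edge, hf⟩ := fun h =>
    hef (VPair.edge_injective (congrArg Subtype.val h))
  refine (hLc _ _ hne).trans ((D.ncard_inter_range_le hne).trans (Nat.add_le_add_left ?_ _))
  split_ifs <;> simp_all

theorem exists_cdDrawing_le_of_config {n : ℕ} (hn : 0 < n) (ord : Fin n ≃ V) {c : Config V}
    (hc : c.Generic) (hs : ∀ e, IsSimpleLine (c.poly e))
    (h₁ : ∀ e f, e ≠ f → cross (c.poly e) (c.poly f) ≤ 1) :
    ∃ D : GraphonDrawing, (G.stepGraphon hn ord).cdDrawing D ≤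
      1 / 8 * ((4 * (Fintype.card V : ℝ) ^ 3 + 4 * ∑ e : VPair V, ∑ f : VPair V,
        if ∀ x, x ∈ e.edge → x ∉ f.edge then
          G.weight e.edge * G.weight f.edge * cross (c.poly e) (c.poly f) else 0) /
            (n : ℝ) ^ 4) := by
  classical
  let _ : MeasurableSpace V := ⊤
  have : MeasurableSingletonClass V := ⟨fun _ => trivial⟩
  obtain ⟨D, hD⟩ := hc.exists_graphonDrawing hs h₁ (φ := fun z => ord (intervalIndex hn z))
    ((measurable_of_finite ord).comp (measurable_intervalIndex hn))
  refine ⟨D, ?_⟩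
  rw [Graphon.cdDrawing]
  refine mul_le_mul_of_nonneg_left ?_ (by norm_num)
  set X : V → V → V → V → ℝ := fun u w k l =>
    if (img (c.line u w) ∩ img (c.line k l)).Nonempty then 1 else 0 with hX
  simp only [hD]
  refine (integral_stepGraphon G hn ord X).trans_le ?_
  refine div_le_div_of_nonneg_right ?_ (by positivity)
  refine (sum_fin_four_weight_le G (N := fun u w k l => cross (c.line u w) (c.line k l))
    (fun u w k l => by simp only [hX]; split_ifs <;> norm_num)
    (fun u w k l => by simp only [hX]; split_ifs <;> norm_num)
    (fun u w k l => by rw [c.cross_line_symm_left]) (fun u w k l => by rw [c.cross_line_symm_right])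
    ?_).trans (le_of_eq ?_)
  · intro u w k l _ _ _
    simp only [hX]
    split_ifs with hm
    · have : cross (c.line u w) (c.line k l) ≠ 0 := fun h =>
        hm.ne_empty (Set.disjoint_iff_inter_eq_empty.1 (cross_eq_zero.1 h))
      exact_mod_cast Nat.one_le_iff_ne_zero.2 this
    · exact Nat.cast_nonneg _
  · simp only [c.line_eq_poly]

/-- All pairs of vertices have to be drawn, and uncrossing requires positive weights, so every
weight is raised by a small `ε`. The weighted cost depends continuously on `ε`, and this produces
the error `η`. -/
theorem exists_cdDrawing_le {n : ℕ} (hn : 0 < n) (ord : Fin n ≃ V)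
    (D : GraphDrawing G.toSimpleGraph) {η : ℝ} (hη : 0 < η) :
    ∃ D' : GraphonDrawing, (G.stepGraphon hn ord).cdDrawing D' ≤
      1 / 8 * ((4 * (Fintype.card V : ℝ) ^ 3 + 8 * G.crDrawing D + η) / (n : ℝ) ^ 4) := by
  classical
  obtain ⟨c₀, hc₀⟩ := D.exists_config
  -- The meeting of two edges at a common vertex, which `cross` counts although it is no crossing.
  set α : VPair V → VPair V → ℝ := fun e f => if ∀ x, x ∈ e.edge → x ∉ f.edge then 0 else 1 with hα
  set w : ℝ → VPair V → ℝ := fun ε e => G.weight e.edge + ε with hw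
  set T : ℝ → ℝ := fun ε => ∑ e : VPair V, ∑ f : VPair V, if e = f then 0 else
    w ε e * w ε f * (cross (c₀.poly e) (c₀.poly f) - α e f) with hT
  have hT0 : T 0 ≤ 2 * G.crDrawing D := by
    rw [two_mul_crDrawing]
    refine Finset.sum_le_sum fun e _ => Finset.sum_le_sum fun f _ => ?_
    by_cases hef : e = f
    · simp [hef]
    rw [if_neg hef, if_neg hef]
    simp only [hw, add_zero]
    by_cases he : e.edge ∈ G.edgeSet
    · by_cases hf : f.edge ∈ G.edgeSet
      · refine mul_le_mul_of_nonneg_left ?_ (mul_nonneg (G.weight_mem _).1 (G.weight_mem _).1)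
        have := hc₀ e f hef he hf
        have h' : (cross (c₀.poly e) (c₀.poly f) : ℝ) ≤ interCount D e.edge f.edge + α e f := by
          simp only [hα]
          exact_mod_cast this
        linarith
      · simp [G.weight_eq_zero _ hf]
    · simp [G.weight_eq_zero _ he]
  have hcont : Continuous T := by
    refine continuous_finsetSum _ fun e _ => continuous_finsetSum _ fun f _ => ?_
    split_ifs
    · exact continuous_const
    · simp only [hw]
      fun_prop
  -- The sum over pairs of edges enters the final estimate with the factor 4, so a quarter of `η` is
  -- available here.
  obtain ⟨ε, hε, hTε⟩ : ∃ ε : ℝ, 0 < ε ∧ T ε < 2 * G.crDrawing D + η / 4 := by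
    have h1 : ∀ᶠ ε in 𝓝[>] (0 : ℝ), T ε < 2 * G.crDrawing D + η / 4 :=
      (hcont.tendsto 0).mono_left nhdsWithin_le_nhds |>.eventually_lt_const (by linarith)
    obtain ⟨ε, h, h'⟩ := (h1.and self_mem_nhdsWithin).exists
    exact ⟨ε, h', h⟩
  have hwpos : ∀ e, 0 < w ε e := fun e => add_pos_of_nonneg_of_pos (G.weight_mem _).1 hε
  obtain ⟨c₁, g1, g2, -⟩ := c₀.exists_generic
  obtain ⟨c, k1, k2, k3, k4⟩ := g1.exists_uncrossed hwpos
  obtain ⟨D', hD'⟩ := exists_cdDrawing_le_of_config G hn ord k1 k2 k3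
  refine ⟨D', hD'.trans ?_⟩
  refine mul_le_mul_of_nonneg_left (div_le_div_of_nonneg_right ?_ (by positivity)) (by norm_num)
  have hcost : c.cost (w ε) ≤ c₀.cost (w ε) :=
    k4.trans (Config.cost_mono (fun e => (hwpos e).le) fun e f _ => g2 e f)
  -- The cost of the meetings at common vertices. It is contained in the initial cost, and it
  -- persists after uncrossing because adjacent edges always meet; hence it cancels.
  set J : ℝ := ∑ e : VPair V, ∑ f : VPair V, if e = f then 0 else w ε e * w ε f * α e f with hJ
  have hT' : T ε + J = c₀.cost (w ε) := by
    rw [hT, hJ, Config.cost]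
    simp only [← Finset.sum_add_distrib]
    refine Finset.sum_congr rfl fun e _ => Finset.sum_congr rfl fun f _ => ?_
    split_ifs
    · simp
    · ring
  have hsum : (∑ e : VPair V, ∑ f : VPair V, if ∀ x, x ∈ e.edge → x ∉ f.edge then
      G.weight e.edge * G.weight f.edge * (cross (c.poly e) (c.poly f) : ℝ) else 0) + J ≤
        c.cost (w ε) := by
    rw [hJ, Config.cost]
    simp only [← Finset.sum_add_distrib]
    refine Finset.sum_le_sum fun e _ => Finset.sum_le_sum fun f _ => ?_
    by_cases hef : e = f
    · have hd : ¬ ∀ x, x ∈ e.edge → x ∉ f.edge := fun h =>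
        h e.1.1 (by simp [VPair.edge]) (by simp [hef, VPair.edge])
      rw [if_neg hd, if_pos hef, if_pos hef, add_zero]
    · rw [if_neg hef, if_neg hef]
      simp only [hα]
      have hww : 0 ≤ w ε e * w ε f := mul_nonneg (hwpos e).le (hwpos f).le
      split_ifs with hd
      · rw [mul_zero, add_zero]
        refine mul_le_mul_of_nonneg_right ?_ (Nat.cast_nonneg _)
        exact mul_le_mul (by simp only [hw]; linarith) (by simp only [hw]; linarith)
          (G.weight_mem _).1 (hwpos e).le
      · rw [zero_add]
        refine mul_le_mul_of_nonneg_left ?_ hww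
        exact_mod_cast c.one_le_cross hd
  linarith

theorem cdDrawing_nonneg (W : Graphon) (D : GraphonDrawing) : 0 ≤ W.cdDrawing D := by
  refine mul_nonneg (by norm_num) (integral_nonneg fun z => ?_)
  refine mul_nonneg (mul_nonneg (W.mem_Icc _ _).1 (W.mem_Icc _ _).1) ?_
  split_ifs <;> norm_num

theorem rectCdMap_nonneg (W : Graphon) (f : I → Plane) : 0 ≤ W.rectCdMap f := by
  refine mul_nonneg (by norm_num) (integral_nonneg fun z => ?_)
  refine mul_nonneg (mul_nonneg (W.mem_Icc _ _).1 (W.mem_Icc _ _).1) ?_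
  split_ifs <;> norm_num

end Upper

theorem mainTheorem6 {V : Type*} [Fintype V] (G : EdgeWeightedGraph V) {n : ℕ} (hn : 0 < n)
    (ord : Fin n ≃ V) :
    (0 ≤ (G.stepGraphon hn ord).rectCd - G.rectCd ∧
      (G.stepGraphon hn ord).rectCd - G.rectCd ≤ 1 / (n : ℝ)) ∧
    (0 ≤ (G.stepGraphon hn ord).cd - G.cd ∧
      (G.stepGraphon hn ord).cd - G.cd ≤ 1 / (n : ℝ)) := by
  -- Any linear order would do; it only serves to list each unordered pair of vertices once.
  let _ : LinearOrder V := LinearOrder.lift' ord.symm ord.symm.injective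
  have hcard : (Fintype.card V : ℝ) = n := by
    rw [← Fintype.card_congr ord, Fintype.card_fin]
  have hn' : (0 : ℝ) < n := by exact_mod_cast hn
  have hn4 : (0 : ℝ) < (n : ℝ) ^ 4 := by positivity
  -- The quadruples with coincidences cost only `1 / (2 n)`, half of what the theorem allows.
  have hhalf : ∀ x : ℝ, 1 / 8 * ((4 * (n : ℝ) ^ 3 + 8 * x) / (n : ℝ) ^ 4) =
      1 / n / 2 + x / (n : ℝ) ^ 4 := by
    intro x
    field_simp
    ring
  have h1n : 1 / (n : ℝ) / 2 ≤ 1 / n := half_le_self (by positivity)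
  have hstraight : ∃ D : GraphDrawing G.toSimpleGraph, D.IsStraightLine := by
    obtain ⟨D, hD, -⟩ := exists_straight_crDrawing_le G hn ord (f := fun _ => 0) aemeasurable_const
    exact ⟨D, hD⟩
  obtain ⟨D₀, hD₀⟩ := hstraight
  have : Nonempty {D : GraphDrawing G.toSimpleGraph // D.IsStraightLine} := ⟨⟨D₀, hD₀⟩⟩
  have : Nonempty (GraphDrawing G.toSimpleGraph) := ⟨D₀⟩
  have : Nonempty GraphonDrawing := ⟨(exists_cdDrawing_le G hn ord D₀ one_pos).choose⟩
  have : Nonempty {f : I → Plane // AEMeasurable f volume ∧ Bornology.IsBounded (range f)} :=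
    ⟨⟨fun _ => 0, aemeasurable_const, (Set.finite_range_const).isBounded⟩⟩
  refine ⟨⟨?_, ?_⟩, ?_, ?_⟩
  · rw [sub_nonneg, EdgeWeightedGraph.rectCd, hcard, div_le_iff₀' hn4, ← div_le_iff₀' hn4]
    refine le_ciInf fun f => ?_
    rw [div_le_iff₀' hn4]
    obtain ⟨D, hD, hle⟩ := exists_straight_crDrawing_le G hn ord f.2.1
    exact (rectCr_le G hD).trans hle
  · have key : ((G.stepGraphon hn ord).rectCd - 1 / n / 2) * (n : ℝ) ^ 4 ≤ G.rectCr := by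
      refine le_ciInf fun D => ?_
      obtain ⟨f, hf, hb, hle⟩ := exists_rectCdMap_le G hn ord D.2
      rw [hcard, hhalf] at hle
      have h2 : (G.stepGraphon hn ord).rectCd ≤ (G.stepGraphon hn ord).rectCdMap f :=
        ciInf_le (f := fun f : {f : I → Plane // AEMeasurable f volume ∧
          Bornology.IsBounded (range f)} => (G.stepGraphon hn ord).rectCdMap f.1)
          ⟨0, by rintro _ ⟨f, rfl⟩; exact rectCdMap_nonneg _ _⟩ ⟨f, hf.aemeasurable, hb⟩
      rw [← le_div_iff₀ hn4]
      linarith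
    rw [← le_div_iff₀ hn4] at key
    rw [EdgeWeightedGraph.rectCd, hcard]
    linarith
  · rw [sub_nonneg, EdgeWeightedGraph.cd, hcard]
    refine le_ciInf fun D => ?_
    rw [div_le_iff₀' hn4]
    obtain ⟨D', hle⟩ := exists_crDrawing_le_cdDrawing G hn ord D
    exact (cr_le G D').trans hle
  · have key : ((G.stepGraphon hn ord).cd - 1 / n / 2) * (n : ℝ) ^ 4 ≤ G.cr := by
      refine le_ciInf fun D => ?_
      refine le_of_forall_pos_le_add fun η hη => ?_
      -- After the factor 1/8 the error `8 * η` becomes an error `η` in the crossing number.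
      obtain ⟨D', hle⟩ := exists_cdDrawing_le G hn ord D (η := 8 * η) (by positivity)
      rw [hcard, add_assoc, ← mul_add, hhalf] at hle
      have h2 : (G.stepGraphon hn ord).cd ≤ (G.stepGraphon hn ord).cdDrawing D' :=
        ciInf_le ⟨0, by rintro _ ⟨D, rfl⟩; exact cdDrawing_nonneg _ _⟩ D'
      rw [← le_div_iff₀ hn4]
      linarith
    rw [← le_div_iff₀ hn4] at key
    rw [EdgeWeightedGraph.cd, hcard]
    linarith
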